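/- Corollary 3.7 (Existence). Let $N\ge 1$, $T>0$, $Q_T:=\mathbb{R}^N\times(0,T)$ and $r\in[1,\infty)$. Assume: * $\varphi:\mathbb{R}\to\mathbb{R}$ is nondecreasing and locally Hölder continuous with exponent $\kappa\in(0,1]$; * $g$ is measurable on $Q_T$ and $\int_0^T\big(\|g(\cdot,t)\|_{L^1(\mathbb{R}^N)}+\|g(\cdot,t)\|_{L^\infty(\mathbb{R}^N)}\big)\,dt<\infty$; * $u_0\in L^1(\mathbb{R}^N)\cap L^\infty(\mathbb{R}^N)$; * $c\in\{0,1\}$, and $\mu$ is a nonnegative symmetric Radon measure on $\mathbb{R}^N\setminus\{0\}$ with $\int_{0<|z|\le1}|z|^2\,d\mu(z)+\int_{|z|>1}d\mu(z)<\infty$. Put $\mathfrak{L}[\psi](x):=c\,\Delta\psi(x)+\int_{\mathbb{R}^N\setminus\{0\}}\big(\psi(x+z)-\psi(x)-z\cdot D\psi(x)\mathbf{1}_{|z|\le1}\big)\,d\mu(z)$. For $h>0$ let $$\mathcal{L}^h[\psi](x)=\sum_{0\ne\gamma\in\mathbb{Z}^N}\big(\psi(x+z_\gamma)-\psi(x)\big)\,\omega_{\gamma,h},$$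 where $z_\gamma=z_{\gamma}(h)\in h\mathbb{Z}^N$, $z_{-\gamma}=-z_\gamma$, $\omega_{\gamma,h}=\omega_{-\gamma,h}\ge0$ and $\sum_{\gamma\neq0}\omega_{\gamma,h}<\infty$. Consider the conditions * (A) $\displaystyle\sup_{0<h<1}\Big\{\sum_{h\le|z_\gamma|\le1}|z_\gamma|^2\omega_{\gamma,h}+\sum_{|z_\gamma|>1}\omega_{\gamma,h}\Big\}<\infty$; * (A$'$) $\displaystyle\sup_{0<h<1}\Big\{\sum_{h\le|z_\gamma|\le1}|z_\gamma|^2\omega_{\gamma,h}+\sum_{|z_\gamma|>1}|z_\gamma|\,\omega_{\gamma,h}\Big\}<\infty$; * (A$''_\alpha$) (A) holds and $\displaystyle\sup_{R>1}\,\sup_{0<h<1}\Big\{R^{\alpha-2}\sum_{1<|z_\gamma|\le R}|z_\gamma|^2\omega_{\gamma,h}+R^{\alpha}\sum_{|z_\gamma|>R}\omega_{\gamma,h}\Big\}<\infty$. Assume that at least one of the following holds: 1. $\mathcal{L}^h=\Delta_h$ for all $h>0$, where $\Delta_h\psi(x)=\sum_{i=1}^N h^{-2}\big(\psi(x+he_i)+\psi(x-he_i)-2\psi(x)\big)$,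 (A) holds, and $\frac{(N-2)^+}{N}<\kappa$; 2. (A$'$) holds and $\frac{N-1}{N}<\kappa$; 3. (A$''_\alpha$) holds for some $\alpha\in(0,2)$ and $\frac{(N-\alpha)^+}{N}<\kappa$. Assume finally that $\mathcal{L}^h$ is consistent with $\mathfrak{L}$: for every $\psi\in C_c^\infty(\mathbb{R}^N)$, $\mathcal{L}^h[\psi]\to\mathfrak{L}[\psi]$ in $L^1(\mathbb{R}^N)$ as $h\to0^+$. Then there exists $u\in L^1(Q_T)\cap L^\infty(Q_T)\cap C([0,T];L^r(\mathbb{R}^N))$ which is a very weak solution of $$\partial_tu-\mathfrak{L}[\varphi(u)]=g\ \text{ in }Q_T,\qquad u(\cdot,0)=u_0\ \text{ on }\mathbb{R}^N,$$ that is, for all $\psi\in C_c^\infty(\mathbb{R}^N\times[0,T))$ one has $\varphi(u)\,\mathfrak{L}[\psi]\in L^1(Q_T)$ and $$\iint_{Q_T}\big(u\,\partial_t\psi+\varphi(u)\,\mathfrak{L}[\psi]+g\,\psi\big)\,dx\,dt+\int_{\mathbb{R}^N}u_0(x)\,\psi(x,0)\,dx=0 .$$ Here $u\in C([0,T];L^r(\mathbb{R}^N))$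 means that $u$ has an a.e.-version that is continuous from $[0,T]$ to $L^r(\mathbb{R}^N)$. -/

import Mathlib

open MeasureTheory Set Filter Topology
open scoped ENNReal NNReal

noncomputable section

namespace GPME

/-- The Euclidean space `ℝ^N`. -/
abbrev E (N : ℕ) := EuclideanSpace ℝ (Fin N)

/-- The space-time cylinder `Q_T = ℝ^N × (0,T)`. -/
def QT (N : ℕ) (T : ℝ) : Set (E N × ℝ) := univ ×ˢ Ioo 0 T

/-- `φ` is nondecreasing and locally Hölder continuous with exponent `κ ∈ (0,1]`. -/
structure IsNonlinearity (κ : ℝ≥0) (φ : ℝ → ℝ) : Prop where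
  exponent_pos : 0 < κ
  exponent_le_one : κ ≤ 1
  monotone : Monotone φ
  locHolder : ∀ K : Set ℝ, IsCompact K → ∃ C : ℝ≥0, HolderOnWith C κ φ K

/-- `g` is (Lebesgue) measurable on `Q_T` and
`∫_0^T (‖g(·,t)‖_{L¹} + ‖g(·,t)‖_{L^∞}) dt < ∞`. -/
structure IsSource {N : ℕ} (T : ℝ) (g : E N × ℝ → ℝ) : Prop where
  aestronglyMeasurable : AEStronglyMeasurable g (volume.restrict (QT N T))
  lintegral_lt_top :
    ∫⁻ t in Ioo 0 T, (eLpNorm (fun x => g (x, t)) 1 volume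
      + eLpNorm (fun x => g (x, t)) ∞ volume) < ∞

/-- `μ` is a symmetric Lévy measure. A measure on `ℝ^N ∖ {0}` is represented by a Borel measure on
`ℝ^N` whose mass at the origin is never used; finiteness on compact subsets of `ℝ^N ∖ {0}` is a
consequence of the integrability condition. -/
structure IsSymmetricLevy {N : ℕ} (μ : Measure (E N)) : Prop where
  symm : μ.map (fun z => -z) = μ
  lintegral_lt_top :
    (∫⁻ z in {z | 0 < ‖z‖ ∧ ‖z‖ ≤ 1}, ENNReal.ofReal (‖z‖ ^ 2) ∂μ) + μ {z | 1 < ‖z‖} < ∞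

/-- The Lévy operator
`ψ ↦ ∫_{z ≠ 0} (ψ(x+z) - ψ(x) - z·Dψ(x) 1_{|z| ≤ 1}) dμ(z)`. -/
def levyOp {N : ℕ} (μ : Measure (E N)) (ψ : E N → ℝ) (x : E N) : ℝ :=
  ∫ z in ({0}ᶜ : Set (E N)),
    (ψ (x + z) - ψ x - {y : E N | ‖y‖ ≤ 1}.indicator (fun y => fderiv ℝ ψ x y) z) ∂μ

/-- The full diffusion operator `c Δ + 𝓛^μ`. -/
def diffusionOp {N : ℕ} (c : ℝ) (μ : Measure (E N)) (ψ : E N → ℝ) (x : E N) : ℝ :=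
  c * Laplacian.laplacian ψ x + levyOp μ ψ x

/-- Test functions in `C_c^∞(ℝ^N × [0,T))`, represented by smooth functions on `ℝ^N × ℝ` with compact
support contained in `ℝ^N × (-∞,T)`. -/
structure IsTestFunction {N : ℕ} (T : ℝ) (ψ : E N × ℝ → ℝ) : Prop where
  contDiff : ContDiff ℝ ((⊤ : ℕ∞) : WithTop ℕ∞) ψ
  hasCompactSupport : HasCompactSupport ψ
  tsupport_subset : tsupport ψ ⊆ univ ×ˢ Iio T

/-- `u` is a very weak solution of `∂ₜu - (cΔ + 𝓛^μ)[φ(u)] = g` in `Q_T`, `u(·,0) = u₀`. -/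
structure IsVeryWeakSolution {N : ℕ} (T c : ℝ) (μ : Measure (E N)) (φ : ℝ → ℝ)
    (g : E N × ℝ → ℝ) (u₀ : E N → ℝ) (u : E N × ℝ → ℝ) : Prop where
  locallyIntegrable : LocallyIntegrableOn u (QT N T)
  integrable : ∀ ψ : E N × ℝ → ℝ, IsTestFunction T ψ →
    Integrable (fun p : E N × ℝ => φ (u p) * diffusionOp c μ (fun y => ψ (y, p.2)) p.1)
      (volume.restrict (QT N T))
  weak_eq : ∀ ψ : E N × ℝ → ℝ, IsTestFunction T ψ →
    (∫ p in QT N T,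
        (u p * deriv (fun t => ψ (p.1, t)) p.2
          + φ (u p) * diffusionOp c μ (fun y => ψ (y, p.2)) p.1
          + g p * ψ p))
      + ∫ x, u₀ x * ψ (x, 0) = 0

/-- `u ∈ C([0,T]; L^r(ℝ^N))`: the function `u` on `Q_T` has an a.e.-version `v` such that
`t ↦ v(·,t)` is continuous from `[0,T]` to `L^r(ℝ^N)`. -/
def MemCLr {N : ℕ} (T : ℝ) (r : ℝ≥0∞) (u : E N × ℝ → ℝ) : Prop :=
  ∃ v : E N × ℝ → ℝ, u =ᵐ[volume.restrict (QT N T)] v ∧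
    (∀ t ∈ Icc 0 T, MemLp (fun x => v (x, t)) r volume) ∧
    ∀ t ∈ Icc 0 T, Tendsto (fun s => eLpNorm (fun x => v (x, s) - v (x, t)) r volume)
      (𝓝[Icc 0 T] t) (𝓝 0)

/-- The operator `ψ ↦ ∑_{γ ≠ 0} (ψ(x + z_γ) - ψ(x)) ω_γ`. -/
def discreteOp {N : ℕ} (z : (Fin N → ℤ) → E N) (ω : (Fin N → ℤ) → ℝ) (ψ : E N → ℝ) (x : E N) : ℝ :=
  ∑' γ : {γ : Fin N → ℤ // γ ≠ 0}, (ψ (x + z γ) - ψ x) * ω γ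

/-- The standard finite-difference Laplacian with step `h`. -/
def discreteLaplacian {N : ℕ} (h : ℝ) (ψ : E N → ℝ) (x : E N) : ℝ :=
  ∑ i : Fin N, (ψ (x + h • EuclideanSpace.single i 1) + ψ (x - h • EuclideanSpace.single i 1)
    - 2 * ψ x) / h ^ 2

/-- For every `h > 0` the nodes `z_γ = z h γ`, `γ ≠ 0`, lie on the grid `hℤ^N` and are odd in `γ`,
and the weights `ω_{γ,h} = ω h γ` are nonnegative, even in `γ` and summable. -/
structure IsDiscretization {N : ℕ} (z : ℝ → (Fin N → ℤ) → E N) (ω : ℝ → (Fin N → ℤ) → ℝ) :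
    Prop where
  node_mem_grid : ∀ h, 0 < h → ∀ γ, γ ≠ 0 →
    ∃ β : Fin N → ℤ, z h γ = h • WithLp.toLp 2 (fun i => (β i : ℝ))
  node_neg : ∀ h, 0 < h → ∀ γ, γ ≠ 0 → z h (-γ) = -z h γ
  weight_nonneg : ∀ h, 0 < h → ∀ γ, γ ≠ 0 → 0 ≤ ω h γ
  weight_neg : ∀ h, 0 < h → ∀ γ, γ ≠ 0 → ω h (-γ) = ω h γ
  weight_summable : ∀ h, 0 < h → Summable (fun γ : {γ : Fin N → ℤ // γ ≠ 0} => ω h γ)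

/-- The sum `∑ f(|z_γ|) ω_γ` over those `γ ≠ 0` with `|z_γ| ∈ A`, as a value in `[0,∞]`. -/
def nodeSum {N : ℕ} (z : (Fin N → ℤ) → E N) (ω : (Fin N → ℤ) → ℝ) (A : Set ℝ) (f : ℝ → ℝ) : ℝ≥0∞ :=
  ∑' γ : {γ : Fin N → ℤ // γ ≠ 0 ∧ ‖z γ‖ ∈ A}, ENNReal.ofReal (f ‖z γ‖ * ω γ)

/-- Uniform discrete Lévy condition:
`sup_{0<h<1} (∑_{h ≤ |z_γ| ≤ 1} |z_γ|² ω_{γ,h} + ∑_{|z_γ| > 1} ω_{γ,h}) < ∞`. -/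
def DiscreteLevy {N : ℕ} (z : ℝ → (Fin N → ℤ) → E N) (ω : ℝ → (Fin N → ℤ) → ℝ) : Prop :=
  ⨆ h ∈ Ioo (0 : ℝ) 1,
    (nodeSum (z h) (ω h) (Icc h 1) (fun s => s ^ 2)
      + nodeSum (z h) (ω h) (Ioi 1) (fun _ => 1)) < ∞

/-- Uniform discrete Lévy condition with a first moment at infinity:
`sup_{0<h<1} (∑_{h ≤ |z_γ| ≤ 1} |z_γ|² ω_{γ,h} + ∑_{|z_γ| > 1} |z_γ| ω_{γ,h}) < ∞`. -/
def DiscreteLevyMoment {N : ℕ} (z : ℝ → (Fin N → ℤ) → E N) (ω : ℝ → (Fin N → ℤ) → ℝ) : Prop :=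
  ⨆ h ∈ Ioo (0 : ℝ) 1,
    (nodeSum (z h) (ω h) (Icc h 1) (fun s => s ^ 2)
      + nodeSum (z h) (ω h) (Ioi 1) (fun s => s)) < ∞

/-- Uniform discrete Lévy condition with tails of fractional order `α`: in addition to
`DiscreteLevy`,
`sup_{R>1} sup_{0<h<1} (R^{α-2} ∑_{1<|z_γ|≤R} |z_γ|² ω_{γ,h} + R^α ∑_{|z_γ|>R} ω_{γ,h}) < ∞`. -/
def DiscreteLevyFrac {N : ℕ} (α : ℝ) (z : ℝ → (Fin N → ℤ) → E N) (ω : ℝ → (Fin N → ℤ) → ℝ) :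
    Prop :=
  DiscreteLevy z ω ∧
  ⨆ R ∈ Ioi (1 : ℝ), ⨆ h ∈ Ioo (0 : ℝ) 1,
    (ENNReal.ofReal (R ^ (α - 2)) * nodeSum (z h) (ω h) (Ioc 1 R) (fun s => s ^ 2)
      + ENNReal.ofReal (R ^ α) * nodeSum (z h) (ω h) (Ioi R) (fun _ => 1)) < ∞

/-- The three admissible classes of discretizations, with the corresponding range of the Hölder
exponent `κ`. -/
def Admissible {N : ℕ} (κ : ℝ≥0) (z : ℝ → (Fin N → ℤ) → E N) (ω : ℝ → (Fin N → ℤ) → ℝ) : Prop :=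
  ((∀ h, 0 < h → discreteOp (z h) (ω h) = discreteLaplacian h) ∧ DiscreteLevy z ω ∧
      max ((N : ℝ) - 2) 0 / N < κ) ∨
  (DiscreteLevyMoment z ω ∧ ((N : ℝ) - 1) / N < κ) ∨
  (∃ α ∈ Ioo (0 : ℝ) 2, DiscreteLevyFrac α z ω ∧ max ((N : ℝ) - α) 0 / N < κ)

/-- Consistency: `𝓛^h[ψ] → (cΔ + 𝓛^μ)[ψ]` in `L¹(ℝ^N)` as `h → 0⁺` for every `ψ ∈ C_c^∞(ℝ^N)`. -/
def Consistent {N : ℕ} (c : ℝ) (μ : Measure (E N)) (z : ℝ → (Fin N → ℤ) → E N)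
    (ω : ℝ → (Fin N → ℤ) → ℝ) : Prop :=
  ∀ ψ : E N → ℝ, ContDiff ℝ ((⊤ : ℕ∞) : WithTop ℕ∞) ψ → HasCompactSupport ψ →
    Tendsto (fun h => eLpNorm (fun x => discreteOp (z h) (ω h) ψ x - diffusionOp c μ ψ x) 1 volume)
      (𝓝[>] 0) (𝓝 0)

end GPME

end

/-! ### Finite symmetric jump operators and second-difference estimates. -/

noncomputable section

namespace GPME

variable {N : ℕ}

/-! The solution is a limit of explicit Euler schemes `U_{j+1} = U_j + τ 𝓛^h[φ_δ(U_j)] + ∫ g`. For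
fixed `h` the discrete operator is `jumpOp ν` for a finite symmetric measure `ν`, so it is bounded
on bounded integrable functions. The nonlinearity is truncated outside the a priori range of the
solution, shifted to vanish at 0, and Steklov-averaged to become Lipschitz; the scheme is then
monotone for small `τ`. The mass of `ν` and the Lipschitz constant may blow up along the
approximation, but they enter only the choice of `τ`. The uniform estimates see `ν` only through
`truncMoment ν R`, the integral of `min (|z|²/R²) 1`.

Monotonicity gives a maximum principle and, for a weight `w ≥ 0`, an `L¹` comparison whose error is
`∫ |φ(U) - φ(V)| |jumpOp ν w|` (`IsStable.integral_abs_euler_sub_mul_le`). With `w = 1` this is `L¹`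
contraction; as the scheme commutes with translations, it yields spatial equicontinuity. With `w = 1
- η(x/R)` and `|φ(s)| ≤ C|s|^κ` it yields tightness: the error is of order `R^{N(1-κ)-β}`, where
`R^{-β}` is the decay rate of the truncated moments and `β` is 2, 1 or `α` in the three admissible
cases. The restriction on `κ` says that this exponent is negative, and is used only there.
Equicontinuity in time is shown first for spatial mollifications, where the operator falls on the
kernel, and is then transferred to the scheme itself.

The Riesz–Kolmogorov and Arzelà–Ascoli theorems produce a subsequence converging in `L¹`, uniformly
in time (`IsSchemeFamily.exists_limit`). Boundedness upgrades continuity in `L¹` to continuity in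
`L^r`.

Summation by parts puts every discrete operator on the test function
(`IsSchemeFamily.discrete_weak_eq`). Consistency and the Hölder bound then allow passage to the
limit (`IsSchemeFamily.weak_limit`). The shift by `φ 0` is undone at no cost because `∫ 𝔏[ψ] dx =
0`, a property inherited from the discrete operators. -/

/-- Bounded measurable integrable functions, as honest functions. -/
structure BddIntegrable (f : E N → ℝ) : Prop where
  measurable : Measurable f
  integrable : Integrable f
  bounded : ∃ M, ∀ x, |f x| ≤ M

namespace BddIntegrable

variable {f g : E N → ℝ}

theorem add (hf : BddIntegrable f) (hg : BddIntegrable g) : BddIntegrable (fun x => f x + g x) := by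
  obtain ⟨A, hA⟩ := hf.bounded
  obtain ⟨B, hB⟩ := hg.bounded
  exact ⟨hf.measurable.add hg.measurable, hf.integrable.add hg.integrable, A + B, fun x =>
    (abs_add_le _ _).trans (add_le_add (hA x) (hB x))⟩

theorem const_mul (hf : BddIntegrable f) (c : ℝ) : BddIntegrable (fun x => c * f x) := by
  obtain ⟨A, hA⟩ := hf.bounded
  refine ⟨hf.measurable.const_mul c, hf.integrable.const_mul c, |c| * A, fun x => ?_⟩
  rw [abs_mul]
  exact mul_le_mul_of_nonneg_left (hA x) (abs_nonneg c)

theorem sub (hf : BddIntegrable f) (hg : BddIntegrable g) : BddIntegrable (fun x => f x - g x) := by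
  simpa [sub_eq_add_neg] using hf.add (hg.const_mul (-1))

theorem abs (hf : BddIntegrable f) : BddIntegrable (fun x => |f x|) := by
  obtain ⟨A, hA⟩ := hf.bounded
  exact ⟨hf.measurable.abs, hf.integrable.abs, A, fun x => by simpa using hA x⟩

theorem translate (hf : BddIntegrable f) (ξ : E N) : BddIntegrable (fun x => f (x + ξ)) := by
  obtain ⟨A, hA⟩ := hf.bounded
  exact ⟨hf.measurable.comp (measurable_id.add_const ξ), hf.integrable.comp_add_right ξ, A,
    fun x => hA _⟩

theorem comp_lipschitz (hf : BddIntegrable f) {φ : ℝ → ℝ} {ℓ : ℝ≥0} (hφ : LipschitzWith ℓ φ)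
    (h0 : φ 0 = 0) : BddIntegrable (fun x => φ (f x)) := by
  obtain ⟨A, hA⟩ := hf.bounded
  have key : ∀ x, |φ (f x)| ≤ ℓ * |f x| := fun x => by
    simpa [Real.dist_eq, h0] using hφ.dist_le_mul (f x) 0
  refine ⟨hφ.continuous.measurable.comp hf.measurable, ?_, ℓ * A, fun x =>
    (key x).trans (mul_le_mul_of_nonneg_left (hA x) ℓ.2)⟩
  refine (hf.integrable.abs.const_mul (ℓ : ℝ)).mono'
    (hφ.continuous.measurable.comp hf.measurable).aestronglyMeasurable ?_
  exact Eventually.of_forall fun x => by simpa using key x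

theorem mul_bdd (hf : BddIntegrable f) {w : E N → ℝ} (hw : Measurable w) {B : ℝ}
    (hB : ∀ x, |w x| ≤ B) : Integrable (fun x => f x * w x) :=
  hf.integrable.mul_bdd hw.aestronglyMeasurable (Eventually.of_forall hB)

end BddIntegrable

/-- The generator of a compound Poisson process with finite jump measure `ν`. -/
def jumpOp (ν : Measure (E N)) (f : E N → ℝ) (x : E N) : ℝ := ∫ z, (f (x + z) - f x) ∂ν

section JumpOp

variable (ν : Measure (E N)) [IsFiniteMeasure ν] {f g w : E N → ℝ}

theorem integrable_shift (hf : Measurable f) {M : ℝ} (hM : ∀ x, |f x| ≤ M) (x : E N) :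
    Integrable (fun z => f (x + z)) ν :=
  Integrable.of_bound (hf.comp (measurable_id.const_add x)).aestronglyMeasurable M
    (Eventually.of_forall fun _ => hM _)

theorem jumpOp_eq (hf : Measurable f) {M : ℝ} (hM : ∀ x, |f x| ≤ M) (x : E N) :
    jumpOp ν f x = ∫ z, f (x + z) ∂ν - ν.real univ * f x := by
  rw [jumpOp, integral_sub (integrable_shift ν hf hM x) (integrable_const _)]
  simp

theorem measurable_integral_shift (hf : Measurable f) : Measurable fun x => ∫ z, f (x + z) ∂ν := by
  have h : StronglyMeasurable (fun p : E N × E N => f (p.1 + p.2)) :=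
    (hf.comp (measurable_fst.add measurable_snd)).stronglyMeasurable
  exact h.integral_prod_right.measurable

theorem measurable_jumpOp (hf : Measurable f) : Measurable (jumpOp ν f) := by
  have h : StronglyMeasurable (fun p : E N × E N => f (p.1 + p.2) - f p.1) :=
    ((hf.comp (measurable_fst.add measurable_snd)).sub
      (hf.comp measurable_fst)).stronglyMeasurable
  exact h.integral_prod_right.measurable

theorem abs_jumpOp_le {M : ℝ} (hM : ∀ x, |f x| ≤ M) (x : E N) :
    |jumpOp ν f x| ≤ 2 * M * ν.real univ := by
  have := norm_integral_le_of_norm_le_const (μ := ν) (f := fun z => f (x + z) - f x)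
    (C := 2 * M) (Eventually.of_forall fun z => by
      rw [Real.norm_eq_abs]
      calc |f (x + z) - f x| ≤ |f (x + z)| + |f x| := abs_sub _ _
        _ ≤ 2 * M := by linarith [hM (x + z), hM x])
  simpa [jumpOp] using this

theorem integrable_shift_prod (hf : BddIntegrable f) :
    Integrable (fun p : E N × E N => f (p.1 + p.2)) (volume.prod ν) := by
  have hm : Measurable (fun p : E N × E N => f (p.1 + p.2)) :=
    hf.measurable.comp (measurable_fst.add measurable_snd)
  refine (integrable_prod_iff' hm.aestronglyMeasurable).2
    ⟨Eventually.of_forall fun z => hf.integrable.comp_add_right z, ?_⟩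
  have : (fun z => ∫ x, ‖f (x + z)‖) = fun _ => ∫ x, ‖f x‖ := by
    funext z
    exact integral_add_right_eq_self (fun x => ‖f x‖) z
  rw [this]
  exact integrable_const _

theorem BddIntegrable.integral_shift (hf : BddIntegrable f) :
    BddIntegrable fun x => ∫ z, f (x + z) ∂ν := by
  obtain ⟨M, hM⟩ := hf.bounded
  refine ⟨measurable_integral_shift ν hf.measurable,
    (integrable_shift_prod ν hf).integral_prod_left, M * ν.real univ, fun x => ?_⟩
  have := norm_integral_le_of_norm_le_const (μ := ν) (f := fun z => f (x + z))
    (C := M) (Eventually.of_forall fun z => hM _)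
  simpa using this

theorem BddIntegrable.jumpOp (hf : BddIntegrable f) : BddIntegrable (jumpOp ν f) := by
  obtain ⟨M, hM⟩ := hf.bounded
  have : GPME.jumpOp ν f = fun x => ∫ z, f (x + z) ∂ν - ν.real univ * f x :=
    funext fun x => jumpOp_eq ν hf.measurable hM x
  rw [this]
  exact (hf.integral_shift ν).sub (hf.const_mul _)

omit [IsFiniteMeasure ν] in
theorem jumpOp_translate (ξ x : E N) :
    GPME.jumpOp ν (fun y => f (y + ξ)) x = GPME.jumpOp ν f (x + ξ) := by
  simp only [GPME.jumpOp, add_right_comm]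

theorem jumpOp_sub (hf : Measurable f) {A : ℝ} (hA : ∀ x, |f x| ≤ A) (hg : Measurable g) {B : ℝ}
    (hB : ∀ x, |g x| ≤ B) (x : E N) :
    jumpOp ν (fun y => f y - g y) x = jumpOp ν f x - jumpOp ν g x := by
  rw [jumpOp, jumpOp, jumpOp, ← integral_sub]
  · congr 1; funext z; ring
  · exact (integrable_shift ν hf hA x).sub (integrable_const _)
  · exact (integrable_shift ν hg hB x).sub (integrable_const _)

/-- Self-adjointness. The diagonal terms coincide; in the others a translation in `x` turns `f (x +
z) * w x` into `f x * w (x - z)`, and reflection invariance of `ν` restores `x + z`. The weight need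
only be bounded, which permits `w = 1` and complements of cutoffs. -/
theorem integral_jumpOp_mul [ν.IsNegInvariant] (hf : BddIntegrable f) (hw : Measurable w) {B : ℝ}
    (hB : ∀ x, |w x| ≤ B) :
    ∫ x, jumpOp ν f x * w x = ∫ x, f x * jumpOp ν w x := by
  obtain ⟨M, hM⟩ := hf.bounded
  have e1 : ∀ x, jumpOp ν f x * w x = (∫ z, f (x + z) * w x ∂ν) - ν.real univ * (f x * w x) := by
    intro x
    rw [jumpOp_eq ν hf.measurable hM, integral_mul_const]; ring
  have e2 : ∀ x, f x * jumpOp ν w x = (∫ z, f x * w (x + z) ∂ν) - ν.real univ * (f x * w x) := by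
    intro x
    rw [jumpOp_eq ν hw hB, integral_const_mul]; ring
  have i1 : Integrable (fun p : E N × E N => f (p.1 + p.2) * w p.1) (volume.prod ν) :=
    (integrable_shift_prod ν hf).mul_bdd (hw.comp measurable_fst).aestronglyMeasurable
      (Eventually.of_forall fun p => hB p.1)
  have i2 : Integrable (fun p : E N × E N => f p.1 * w (p.1 + p.2)) (volume.prod ν) :=
    (hf.integrable.comp_fst ν).mul_bdd
      (hw.comp (measurable_fst.add measurable_snd)).aestronglyMeasurable
      (Eventually.of_forall fun p => hB _)
  have i3 : Integrable (fun x => ν.real univ * (f x * w x)) := (hf.mul_bdd hw hB).const_mul _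
  simp_rw [e1, e2]
  rw [integral_sub i1.integral_prod_left i3, integral_sub i2.integral_prod_left i3]
  congr 1
  rw [integral_integral_swap i1, integral_integral_swap (f := fun x z => f x * w (x + z)) i2]
  have : ∀ z, ∫ x, f (x + z) * w x = ∫ x, f x * w (x + -z) := fun z => by
    rw [← integral_add_right_eq_self (fun x => f x * w (x + -z)) z]
    simp
  simp_rw [this]
  exact integral_neg_eq_self (fun z => ∫ x, f x * w (x + z)) ν

end JumpOp

/-- The symmetric second difference. -/
def secondDiff (η : E N → ℝ) (z x : E N) : ℝ := η (x + z) + η (x - z) - 2 * η x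

/-- The truncated second moment at scale `R`. -/
def truncMoment (ν : Measure (E N)) (R : ℝ) : ℝ := ∫ z, min (‖z‖ ^ 2 / R ^ 2) 1 ∂ν

section SecondDiff

variable (ν : Measure (E N)) [IsFiniteMeasure ν] {η : E N → ℝ}

theorem measurable_secondDiff (hη : Measurable η) :
    Measurable fun p : E N × E N => secondDiff η p.2 p.1 := by
  unfold secondDiff
  exact ((hη.comp (measurable_fst.add measurable_snd)).add
    (hη.comp (measurable_fst.sub measurable_snd))).sub ((hη.comp measurable_fst).const_mul 2)

theorem integrable_truncMoment (R : ℝ) : Integrable (fun z : E N => min (‖z‖ ^ 2 / R ^ 2) 1) ν := by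
  refine Integrable.of_bound (by fun_prop) 1 (Eventually.of_forall fun z => ?_)
  rw [Real.norm_eq_abs, abs_of_nonneg (le_min (by positivity) zero_le_one)]
  exact min_le_right _ _

omit [IsFiniteMeasure ν] in
theorem truncMoment_nonneg (R : ℝ) : 0 ≤ truncMoment ν R :=
  integral_nonneg fun _ => le_min (by positivity) zero_le_one

/-- Averaging over `z` and `-z` cancels the first-order part, so smooth functions can be estimated
by second moments of `ν` instead of its total mass. -/
theorem jumpOp_eq_secondDiff [ν.IsNegInvariant] (hη : Measurable η) {M : ℝ}
    (hM : ∀ x, |η x| ≤ M) (x : E N) : jumpOp ν η x = (∫ z, secondDiff η z x ∂ν) / 2 := by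
  have i1 := integrable_shift ν hη hM x
  have i2 : Integrable (fun z => η (x - z)) ν := by
    simpa [sub_eq_add_neg] using i1.comp_neg
  have e : ∫ z, η (x - z) ∂ν = ∫ z, η (x + z) ∂ν := by
    simpa [sub_eq_add_neg] using integral_neg_eq_self (fun z => η (x + z)) ν
  have : ∫ z, secondDiff η z x ∂ν
      = ∫ z, η (x + z) ∂ν + ∫ z, η (x - z) ∂ν - ν.real univ * (2 * η x) := by
    unfold secondDiff
    rw [integral_sub (f := fun z => η (x + z) + η (x - z)) (i1.add i2) (integrable_const _),
      integral_add i1 i2]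
    simp
  rw [this, e, jumpOp_eq ν hη hM]
  ring

theorem abs_jumpOp_le_truncMoment [ν.IsNegInvariant] (hη : Measurable η) {M : ℝ}
    (hM : ∀ x, |η x| ≤ M) {K R : ℝ}
    (hK : ∀ z x, |secondDiff η z x| ≤ K * min (‖z‖ ^ 2 / R ^ 2) 1) (x : E N) :
    |jumpOp ν η x| ≤ K * truncMoment ν R / 2 := by
  rw [jumpOp_eq_secondDiff ν hη hM, abs_div, abs_two, truncMoment, ← integral_const_mul]
  gcongr
  rw [← Real.norm_eq_abs]
  exact norm_integral_le_of_norm_le ((integrable_truncMoment ν R).const_mul K)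
    (Eventually.of_forall fun z => hK z x)

theorem integrable_secondDiff (hη : Integrable η) (z : E N) : Integrable (secondDiff η z) :=
  ((hη.comp_add_right z).add (by simpa [sub_eq_add_neg] using hη.comp_add_right (-z))).sub
    (hη.const_mul 2)

/-- Tonelli applied to the symmetrized form: the bound on each second difference in `L¹(dx)` is
integrated against `ν`. -/
theorem integral_abs_jumpOp_le_truncMoment [ν.IsNegInvariant] (hη : BddIntegrable η) {S R : ℝ}
    (hS : ∀ z, ∫ x, |secondDiff η z x| ≤ S * min (‖z‖ ^ 2 / R ^ 2) 1) :
    ∫ x, |jumpOp ν η x| ≤ S * truncMoment ν R / 2 := by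
  obtain ⟨M, hM⟩ := hη.bounded
  have hm := measurable_secondDiff hη.measurable
  have hprod : Integrable (fun p : E N × E N => secondDiff η p.2 p.1) (volume.prod ν) := by
    refine (integrable_prod_iff' hm.aestronglyMeasurable).2
      ⟨Eventually.of_forall fun z => integrable_secondDiff hη.integrable z, ?_⟩
    refine ((integrable_truncMoment ν R).const_mul S).mono' ?_ (Eventually.of_forall fun z => ?_)
    · exact (hm.norm.stronglyMeasurable.integral_prod_left (μ := volume)).aestronglyMeasurable
    · rw [Real.norm_eq_abs, abs_of_nonneg (integral_nonneg fun _ => norm_nonneg _)]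
      exact hS z
  have step : ∀ x, |jumpOp ν η x| ≤ (∫ z, |secondDiff η z x| ∂ν) / 2 := fun x => by
    rw [jumpOp_eq_secondDiff ν hη.measurable hM, abs_div, abs_two]
    gcongr
    exact abs_integral_le_integral_abs
  have i1 : Integrable fun x => (∫ z, |secondDiff η z x| ∂ν) / 2 :=
    (hprod.abs.integral_prod_left).div_const 2
  calc ∫ x, |jumpOp ν η x| ≤ ∫ x, (∫ z, |secondDiff η z x| ∂ν) / 2 :=
        integral_mono (hη.jumpOp ν).integrable.abs i1 step
    _ = (∫ z, (∫ x, |secondDiff η z x|) ∂ν) / 2 := by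
        rw [integral_div,
          integral_integral_swap (f := fun x z => |secondDiff η z x|) hprod.abs]
    _ ≤ S * truncMoment ν R / 2 := by
        rw [truncMoment, ← integral_const_mul]
        exact div_le_div_of_nonneg_right (integral_mono hprod.abs.integral_prod_right
          ((integrable_truncMoment ν R).const_mul S) hS) two_pos.le

end SecondDiff

end GPME

end

/-! ### The explicit Euler scheme: monotonicity and weighted contraction. -/

noncomputable section

namespace GPME

variable {N : ℕ}

/-- One explicit Euler step of `∂ₜu = 𝓛[φ(u)]`. -/
def eulerStep (ν : Measure (E N)) (φ : ℝ → ℝ) (τ : ℝ) (U : E N → ℝ) (x : E N) : ℝ :=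
  U x + τ * jumpOp ν (fun y => φ (U y)) x

/-- The explicit Euler scheme for `∂ₜu = 𝓛[φ(u)] + g` with source increments `G j`. -/
def euler (ν : Measure (E N)) (φ : ℝ → ℝ) (τ : ℝ) (u₀ : E N → ℝ) (G : ℕ → E N → ℝ) : ℕ → E N → ℝ
  | 0 => u₀
  | j + 1 => fun x => eulerStep ν φ τ (euler ν φ τ u₀ G j) x + G j x

/-- The stability condition under which the explicit Euler scheme is monotone. -/
structure IsStable (ν : Measure (E N)) (φ : ℝ → ℝ) (τ : ℝ) : Prop where
  monotone : Monotone φ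
  lipschitz : ∃ ℓ : ℝ≥0, LipschitzWith ℓ φ
  map_zero : φ 0 = 0
  step_nonneg : 0 ≤ τ
  cfl : ∀ a b, a ≤ b → τ * ν.real univ * (φ b - φ a) ≤ b - a

section Step

variable {ν : Measure (E N)} [IsFiniteMeasure ν] {φ : ℝ → ℝ} {τ : ℝ} {U V : E N → ℝ}

omit [IsFiniteMeasure ν] in
theorem IsStable.bddIntegrable (h : IsStable ν φ τ) (hU : BddIntegrable U) :
    BddIntegrable (fun x => φ (U x)) := by
  obtain ⟨ℓ, hℓ⟩ := h.lipschitz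
  exact hU.comp_lipschitz hℓ h.map_zero

theorem IsStable.eulerStep (h : IsStable ν φ τ) (hU : BddIntegrable U) :
    BddIntegrable (eulerStep ν φ τ U) :=
  hU.add (((h.bddIntegrable hU).jumpOp ν).const_mul τ)

-- The condition `cfl` says that `a ↦ a - τ ν(univ) φ a` is nondecreasing. Hence all three
-- differences have the same sign and their absolute values combine linearly.
omit [IsFiniteMeasure ν] in
theorem IsStable.abs_sub_eq (h : IsStable ν φ τ) (a b : ℝ) :
    |(a - b) - τ * ν.real univ * (φ a - φ b)| = |a - b| - τ * ν.real univ * |φ a - φ b| := by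
  rcases le_total a b with hab | hab
  · have h1 := h.cfl a b hab
    have h2 := h.monotone hab
    rw [abs_of_nonpos (by linarith), abs_of_nonpos (by linarith), abs_of_nonpos (by linarith)]
    ring
  · have h1 := h.cfl b a hab
    have h2 := h.monotone hab
    rw [abs_of_nonneg (by linarith), abs_of_nonneg (by linarith), abs_of_nonneg (by linarith)]

/-- A discrete Kato inequality. The diagonal part is handled exactly by `IsStable.abs_sub_eq`, the
gain from neighbouring points by the triangle inequality, and the two reassemble into a jump
operator acting on `|φ(U) - φ(V)|`. -/
theorem IsStable.abs_eulerStep_sub_le (h : IsStable ν φ τ) (hU : BddIntegrable U)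
    (hV : BddIntegrable V) (x : E N) :
    |GPME.eulerStep ν φ τ U x - GPME.eulerStep ν φ τ V x|
      ≤ |U x - V x| + τ * jumpOp ν (fun y => |φ (U y) - φ (V y)|) x := by
  have hD := (h.bddIntegrable hU).sub (h.bddIntegrable hV)
  obtain ⟨A, hA⟩ := (h.bddIntegrable hU).bounded
  obtain ⟨B, hB⟩ := (h.bddIntegrable hV).bounded
  obtain ⟨C, hC⟩ := hD.bounded
  have e : GPME.eulerStep ν φ τ U x - GPME.eulerStep ν φ τ V x
      = ((U x - V x) - τ * ν.real univ * (φ (U x) - φ (V x)))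
        + τ * ∫ z, (φ (U (x + z)) - φ (V (x + z))) ∂ν := by
    have := jumpOp_sub ν (h.bddIntegrable hU).measurable hA (h.bddIntegrable hV).measurable hB x
    rw [jumpOp_eq ν hD.measurable hC] at this
    simp only [GPME.eulerStep]
    linear_combination -τ * this
  rw [e, jumpOp_eq ν hD.abs.measurable (M := C) (fun y => by simpa using hC y)]
  refine (abs_add_le _ _).trans ?_
  rw [h.abs_sub_eq, abs_mul, abs_of_nonneg h.step_nonneg]
  have := mul_le_mul_of_nonneg_left (abs_integral_le_integral_abs (μ := ν)
    (f := fun z => φ (U (x + z)) - φ (V (x + z)))) h.step_nonneg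
  linarith

/-- Maximum principle: constants are fixed by the step, and monotonicity compares `U` with `M` and
`-M`. -/
theorem IsStable.abs_eulerStep_le (h : IsStable ν φ τ) (hU : BddIntegrable U) {M : ℝ}
    (hM : ∀ x, |U x| ≤ M) (x : E N) : |GPME.eulerStep ν φ τ U x| ≤ M := by
  have hφU := h.bddIntegrable hU
  obtain ⟨A, hA⟩ := hφU.bounded
  have i1 := integrable_shift ν hφU.measurable hA x
  have up : ∫ z, φ (U (x + z)) ∂ν ≤ ν.real univ * φ M := by
    have := integral_mono i1 (integrable_const (φ M))
      (fun z => h.monotone (le_of_abs_le (hM (x + z))))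
    simpa using this
  have lo : ν.real univ * φ (-M) ≤ ∫ z, φ (U (x + z)) ∂ν := by
    have := integral_mono (integrable_const (φ (-M))) i1
      (fun z => h.monotone (neg_le_of_abs_le (hM (x + z))))
    simpa using this
  have c1 := h.cfl (U x) M (le_of_abs_le (hM x))
  have c2 := h.cfl (-M) (U x) (neg_le_of_abs_le (hM x))
  have u1 := mul_le_mul_of_nonneg_left up h.step_nonneg
  have l1 := mul_le_mul_of_nonneg_left lo h.step_nonneg
  rw [GPME.eulerStep, jumpOp_eq ν hφU.measurable hA, abs_le]
  constructor <;> linarith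

/-- The Kato inequality is integrated against `w ≥ 0` and the operator is moved onto `w`. This one
estimate is the source of contraction, spatial equicontinuity and tightness. -/
theorem IsStable.integral_abs_step_sub_mul_le [ν.IsNegInvariant] (h : IsStable ν φ τ)
    {G H w : E N → ℝ} (hU : BddIntegrable U) (hV : BddIntegrable V) (hG : BddIntegrable G)
    (hH : BddIntegrable H) (hw : Measurable w) (hw0 : ∀ x, 0 ≤ w x) {B : ℝ}
    (hB : ∀ x, |w x| ≤ B) :
    ∫ x, |(GPME.eulerStep ν φ τ U x + G x) - (GPME.eulerStep ν φ τ V x + H x)| * w x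
      ≤ (∫ x, |U x - V x| * w x) + (τ * (∫ x, |φ (U x) - φ (V x)| * |jumpOp ν w x|)
        + (∫ x, |G x - H x| * w x)) := by
  have hD := ((h.bddIntegrable hU).sub (h.bddIntegrable hV)).abs
  have i1 := (hU.sub hV).abs.mul_bdd hw hB
  have i2 := (hG.sub hH).abs.mul_bdd hw hB
  have i3 := (hD.jumpOp ν).mul_bdd hw hB
  have i4 := hD.mul_bdd (measurable_jumpOp ν hw) (abs_jumpOp_le ν hB)
  have i5 := hD.mul_bdd (measurable_jumpOp ν hw).abs (B := 2 * B * ν.real univ)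
    (fun x => by simpa using abs_jumpOp_le ν hB x)
  have i0 := (((h.eulerStep hU).add hG).sub ((h.eulerStep hV).add hH)).abs.mul_bdd hw hB
  have s1 : ∫ x, |(GPME.eulerStep ν φ τ U x + G x) - (GPME.eulerStep ν φ τ V x + H x)| * w x
      ≤ ∫ x, (|U x - V x| * w x + (τ * (jumpOp ν (fun y => |φ (U y) - φ (V y)|) x * w x)
        + |G x - H x| * w x)) := by
    refine integral_mono i0 (i1.add ((i3.const_mul τ).add i2)) fun x => ?_
    have a := h.abs_eulerStep_sub_le hU hV x
    have b := abs_add_le (GPME.eulerStep ν φ τ U x - GPME.eulerStep ν φ τ V x) (G x - H x)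
    have e : (GPME.eulerStep ν φ τ U x + G x) - (GPME.eulerStep ν φ τ V x + H x)
      = (GPME.eulerStep ν φ τ U x - GPME.eulerStep ν φ τ V x) + (G x - H x) := by ring
    dsimp only
    rw [e]
    have := mul_le_mul_of_nonneg_right (b.trans (add_le_add_left a _)) (hw0 x)
    linarith
  have s2 : ∫ x, |φ (U x) - φ (V x)| * jumpOp ν w x
      ≤ ∫ x, |φ (U x) - φ (V x)| * |jumpOp ν w x| :=
    integral_mono i4 i5 fun x => mul_le_mul_of_nonneg_left (le_abs_self _) (abs_nonneg _)
  rw [integral_add (g := fun x => τ * (jumpOp ν (fun y => |φ (U y) - φ (V y)|) x * w x)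
      + |G x - H x| * w x) i1 ((i3.const_mul τ).add i2), integral_add (i3.const_mul τ) i2,
    integral_const_mul, integral_jumpOp_mul ν hD hw hB] at s1
  have := mul_le_mul_of_nonneg_left s2 h.step_nonneg
  linarith

end Step

section Scheme

variable {ν : Measure (E N)} [IsFiniteMeasure ν] {φ : ℝ → ℝ} {τ : ℝ} {u₀ v₀ : E N → ℝ}
  {G H : ℕ → E N → ℝ}

theorem IsStable.euler (h : IsStable ν φ τ) (hu : BddIntegrable u₀)
    (hG : ∀ j, BddIntegrable (G j)) (n : ℕ) : BddIntegrable (euler ν φ τ u₀ G n) := by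
  induction n with
  | zero => exact hu
  | succ n ih => exact (h.eulerStep ih).add (hG n)

theorem IsStable.abs_euler_le (h : IsStable ν φ τ) (hu : BddIntegrable u₀)
    (hG : ∀ j, BddIntegrable (G j)) {M : ℝ} {b : ℕ → ℝ} (hM : ∀ x, |u₀ x| ≤ M)
    (hb : ∀ j x, |G j x| ≤ b j) (n : ℕ) (x : E N) :
    |GPME.euler ν φ τ u₀ G n x| ≤ M + ∑ i ∈ Finset.range n, b i := by
  induction n generalizing x with
  | zero => simpa [GPME.euler] using hM x
  | succ n ih =>
    rw [Finset.sum_range_succ, ← add_assoc]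
    exact (abs_add_le _ _).trans
      (add_le_add (h.abs_eulerStep_le (h.euler hu hG n) ih x) (hb n x))

theorem IsStable.integral_abs_euler_sub_mul_le [ν.IsNegInvariant] (h : IsStable ν φ τ)
    (hu : BddIntegrable u₀) (hv : BddIntegrable v₀) (hG : ∀ j, BddIntegrable (G j))
    (hH : ∀ j, BddIntegrable (H j)) {w : E N → ℝ} (hw : Measurable w) (hw0 : ∀ x, 0 ≤ w x)
    {B : ℝ} (hB : ∀ x, |w x| ≤ B) (n : ℕ) :
    ∫ x, |GPME.euler ν φ τ u₀ G n x - GPME.euler ν φ τ v₀ H n x| * w x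
      ≤ (∫ x, |u₀ x - v₀ x| * w x) + ∑ i ∈ Finset.range n,
        (τ * (∫ x, |φ (GPME.euler ν φ τ u₀ G i x) - φ (GPME.euler ν φ τ v₀ H i x)|
          * |jumpOp ν w x|) + (∫ x, |G i x - H i x| * w x)) := by
  induction n with
  | zero => simp [GPME.euler]
  | succ n ih =>
    rw [Finset.sum_range_succ]
    have := h.integral_abs_step_sub_mul_le (h.euler hu hG n) (h.euler hv hH n) (hG n) (hH n)
      hw hw0 hB
    simp only [GPME.euler] at this ih ⊢
    linarith

/-- The weight `w = 1` is annihilated by the jump operator, so only the data remain. -/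
theorem IsStable.integral_abs_euler_sub_le [ν.IsNegInvariant] (h : IsStable ν φ τ)
    (hu : BddIntegrable u₀) (hv : BddIntegrable v₀) (hG : ∀ j, BddIntegrable (G j))
    (hH : ∀ j, BddIntegrable (H j)) (n : ℕ) :
    ∫ x, |GPME.euler ν φ τ u₀ G n x - GPME.euler ν φ τ v₀ H n x|
      ≤ (∫ x, |u₀ x - v₀ x|) + ∑ i ∈ Finset.range n, (∫ x, |G i x - H i x|) := by
  have := h.integral_abs_euler_sub_mul_le hu hv hG hH (w := fun _ => 1) measurable_const
    (fun _ => zero_le_one) (B := 1) (fun _ => by simp) n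
  simpa [jumpOp] using this

omit [IsFiniteMeasure ν] in
theorem euler_translate (ξ : E N) (n : ℕ) (x : E N) :
    GPME.euler ν φ τ (fun y => u₀ (y + ξ)) (fun j y => G j (y + ξ)) n x
      = GPME.euler ν φ τ u₀ G n (x + ξ) := by
  induction n generalizing x with
  | zero => rfl
  | succ n ih =>
    simp only [GPME.euler, eulerStep, ih]
    rw [jumpOp_translate ν (f := fun y => φ (GPME.euler ν φ τ u₀ G n y))]

omit [IsFiniteMeasure ν] in
theorem IsStable.euler_zero (h : IsStable ν φ τ) (n : ℕ) :
    GPME.euler ν φ τ (fun _ => 0) (fun _ _ => 0) n = fun _ => 0 := by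
  induction n with
  | zero => rfl
  | succ n ih =>
    funext x
    simp only [GPME.euler, ih]
    simp [GPME.eulerStep, jumpOp, h.map_zero]

theorem BddIntegrable.zero : BddIntegrable (fun _ : E N => (0 : ℝ)) :=
  ⟨measurable_const, integrable_zero _ _ _, 0, by simp⟩

theorem IsStable.integral_abs_euler_le [ν.IsNegInvariant] (h : IsStable ν φ τ)
    (hu : BddIntegrable u₀) (hG : ∀ j, BddIntegrable (G j)) (n : ℕ) :
    ∫ x, |GPME.euler ν φ τ u₀ G n x| ≤ (∫ x, |u₀ x|) + ∑ i ∈ Finset.range n, (∫ x, |G i x|) := by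
  have := h.integral_abs_euler_sub_le hu .zero hG (fun _ => .zero) n
  simpa [h.euler_zero] using this

/-- Split at `s = l`: below it `s ^ κ ≤ l ^ κ`, above it `s ^ (κ - 1) ≤ l ^ (κ - 1)`. A Hölder bound
thus becomes affine in `s`, usable with `L¹` information alone, and the level `l` remains free for
optimization. -/
theorem rpow_le_add_mul {κ l s : ℝ} (hκ : 0 < κ) (hκ1 : κ ≤ 1) (hl : 0 < l) (hs : 0 ≤ s) :
    s ^ κ ≤ l ^ κ + l ^ (κ - 1) * s := by
  rcases le_total s l with h | h
  · have := Real.rpow_le_rpow hs h hκ.le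
    have : 0 ≤ l ^ (κ - 1) * s := by positivity
    linarith
  · have hs' : 0 < s := hl.trans_le h
    have e : s ^ κ = s ^ (κ - 1) * s := by
      rw [← Real.rpow_add_one hs'.ne']; simp
    have := mul_le_mul_of_nonneg_right
      (Real.rpow_le_rpow_of_nonpos hl h (by linarith : κ - 1 ≤ 0)) hs
    have : 0 ≤ l ^ κ := by positivity
    linarith

/-- Weighted estimate controlling the mass of the scheme where the cutoff `η` vanishes. -/
theorem IsStable.integral_abs_euler_mul_le [ν.IsNegInvariant] (h : IsStable ν φ τ)
    (hu : BddIntegrable u₀) (hG : ∀ j, BddIntegrable (G j)) {η : E N → ℝ}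
    (hη : BddIntegrable η) (hη0 : ∀ x, 0 ≤ η x) (hη1 : ∀ x, η x ≤ 1)
    {κ C l A S K : ℝ} (hκ : 0 < κ) (hκ1 : κ ≤ 1) (hl : 0 < l) (hC : 0 ≤ C)
    (hφ : ∀ s, |φ s| ≤ C * |s| ^ κ) (hA : ∀ n, ∫ x, |GPME.euler ν φ τ u₀ G n x| ≤ A)
    (hS : ∫ x, |jumpOp ν η x| ≤ S) (hK : ∀ x, |jumpOp ν η x| ≤ K) (n : ℕ) :
    ∫ x, |GPME.euler ν φ τ u₀ G n x| * (1 - η x)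
      ≤ (∫ x, |u₀ x| * (1 - η x)) + ∑ i ∈ Finset.range n, (∫ x, |G i x| * (1 - η x))
        + n * τ * (C * (l ^ κ * S + l ^ (κ - 1) * A * K)) := by
  have hw : ∀ x, |1 - η x| ≤ 1 := fun x => by
    rw [abs_le]; constructor <;> linarith [hη0 x, hη1 x]
  have hL : ∀ x, |jumpOp ν (fun y => 1 - η y) x| = |jumpOp ν η x| := fun x => by
    rw [← abs_neg, jumpOp, jumpOp, ← integral_neg]
    congr 2; funext z; ring
  have key := h.integral_abs_euler_sub_mul_le hu .zero hG (fun _ => .zero)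
    (w := fun x => 1 - η x) (measurable_const.sub hη.measurable)
    (fun x => by linarith [hη1 x]) hw n
  simp only [h.euler_zero, sub_zero, h.map_zero, hL] at key
  have hK0 : 0 ≤ K := (abs_nonneg _).trans (hK 0)
  -- The constant part `l ^ κ` meets the `L¹` bound `S` of the operator on `η`; the linear part
  -- meets its sup bound `K` and the mass bound `A` of the scheme.
  have est : ∀ i, ∫ x, |φ (GPME.euler ν φ τ u₀ G i x)| * |jumpOp ν η x|
      ≤ C * (l ^ κ * S + l ^ (κ - 1) * A * K) := by
    intro i
    set U := GPME.euler ν φ τ u₀ G i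
    have hU : BddIntegrable U := h.euler hu hG i
    have hLη := (hη.jumpOp ν).abs
    have i1 : Integrable fun x => |φ (U x)| * |jumpOp ν η x| :=
      (h.bddIntegrable hU).abs.mul_bdd hLη.measurable (by simpa using hK)
    have i2 : Integrable fun x => C * (l ^ κ * |jumpOp ν η x| + l ^ (κ - 1) * K * |U x|) :=
      ((hLη.integrable.const_mul _).add (hU.integrable.abs.const_mul _)).const_mul _
    have := integral_mono i1 i2 fun x => by
      have a := rpow_le_add_mul hκ hκ1 hl (abs_nonneg (U x))
      have b : l ^ (κ - 1) * |U x| * |jumpOp ν η x| ≤ l ^ (κ - 1) * |U x| * K :=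
        mul_le_mul_of_nonneg_left (hK x) (by positivity)
      calc |φ (U x)| * |jumpOp ν η x|
          ≤ C * (l ^ κ + l ^ (κ - 1) * |U x|) * |jumpOp ν η x| :=
            mul_le_mul_of_nonneg_right ((hφ _).trans (mul_le_mul_of_nonneg_left a hC))
              (abs_nonneg _)
        _ = C * (l ^ κ * |jumpOp ν η x| + l ^ (κ - 1) * |U x| * |jumpOp ν η x|) := by ring
        _ ≤ C * (l ^ κ * |jumpOp ν η x| + l ^ (κ - 1) * |U x| * K) := by gcongr
        _ = C * (l ^ κ * |jumpOp ν η x| + l ^ (κ - 1) * K * |U x|) := by ring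
    rw [integral_const_mul, integral_add (hLη.integrable.const_mul _)
      (hU.integrable.abs.const_mul _), integral_const_mul, integral_const_mul] at this
    refine this.trans (mul_le_mul_of_nonneg_left ?_ hC)
    have a : l ^ κ * ∫ x, |jumpOp ν η x| ≤ l ^ κ * S :=
      mul_le_mul_of_nonneg_left hS (by positivity)
    have b : l ^ (κ - 1) * K * ∫ x, |U x| ≤ l ^ (κ - 1) * K * A :=
      mul_le_mul_of_nonneg_left (hA i) (by positivity)
    linarith
  have hsum : ∑ i ∈ Finset.range n, (τ * (∫ x, |φ (GPME.euler ν φ τ u₀ G i x)| * |jumpOp ν η x|)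
        + (∫ x, |G i x| * (1 - η x)))
      ≤ ∑ i ∈ Finset.range n, (∫ x, |G i x| * (1 - η x))
        + n * τ * (C * (l ^ κ * S + l ^ (κ - 1) * A * K)) := by
    rw [Finset.sum_add_distrib, add_comm]
    gcongr
    calc _ ≤ ∑ i ∈ Finset.range n, τ * (C * (l ^ κ * S + l ^ (κ - 1) * A * K)) :=
          Finset.sum_le_sum fun i _ => mul_le_mul_of_nonneg_left (est i) h.step_nonneg
      _ = _ := by simp [mul_assoc]
  linarith

end Scheme

end GPME

end

/-! ### Compactness tools: Arzelà–Ascoli, mollification, Riesz–Kolmogorov. -/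

noncomputable section

namespace GPME

variable {N : ℕ}

/-- Compactness for asymptotically equicontinuous families of curves in a compact set. -/
theorem exists_subseq_uniform_limit {X : Type*} [PseudoMetricSpace X] [Nonempty X] {K : Set X}
    (hK : IsCompact K) {T : ℝ} (F : ℕ → ℝ → X) (hF : ∀ k, ∀ t ∈ Icc 0 T, F k t ∈ K)
    (heq : ∀ ε > 0, ∃ δ > 0, ∃ k₀, ∀ k ≥ k₀, ∀ s ∈ Icc 0 T, ∀ t ∈ Icc 0 T, |s - t| ≤ δ →
      dist (F k s) (F k t) ≤ ε) :
    ∃ f : ℝ → X, ContinuousOn f (Icc 0 T) ∧ ∃ θ : ℕ → ℕ, StrictMono θ ∧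
      ∀ i, ∀ t ∈ Icc 0 T, dist (F (θ i) t) (f t) ≤ (1 / 2 : ℝ) ^ i := by
  classical
  -- Along a nonprincipal ultrafilter every curve value converges by compactness, at all times
  -- simultaneously, so no diagonal extraction is needed to define the limit.
  set 𝒰 : Ultrafilter ℕ := hyperfilter ℕ
  have h𝒰 : (𝒰 : Filter ℕ) ≤ atTop := by
    rw [← Nat.cofinite_eq_atTop]; exact hyperfilter_le_cofinite
  have hlim : ∀ t ∈ Icc 0 T, ∃ y, Tendsto (fun k => F k t) 𝒰 (𝓝 y) := fun t ht => by
    obtain ⟨y, -, hy⟩ := hK.ultrafilter_le_nhds (𝒰.map fun k => F k t)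
      (le_principal_iff.2 (mem_map.2 (Eventually.of_forall fun k => hF k t ht)))
    exact ⟨y, hy⟩
  choose! f hf using hlim
  have hfdist : ∀ ε > 0, ∃ δ > 0, ∃ k₀, (∀ k ≥ k₀, ∀ s ∈ Icc 0 T, ∀ t ∈ Icc 0 T, |s - t| ≤ δ →
      dist (F k s) (F k t) ≤ ε) ∧ ∀ s ∈ Icc 0 T, ∀ t ∈ Icc 0 T, |s - t| ≤ δ →
      dist (f s) (f t) ≤ ε := by
    intro ε hε
    obtain ⟨δ, hδ, k₀, h⟩ := heq ε hε
    refine ⟨δ, hδ, k₀, h, fun s hs t ht hst => ?_⟩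
    refine le_of_tendsto ((hf s hs).dist (hf t ht)) (h𝒰 ?_)
    filter_upwards [eventually_ge_atTop k₀] with k hk using h k hk s hs t ht hst
  have hcont : ContinuousOn f (Icc 0 T) := by
    rw [Metric.continuousOn_iff]
    intro t ht ε hε
    obtain ⟨δ, hδ, -, -, h⟩ := hfdist (ε / 2) (half_pos hε)
    exact ⟨δ, hδ, fun s hs hst => (h s hs t ht (by rw [← Real.dist_eq]; exact hst.le)).trans_lt
      (half_lt_self hε)⟩
  -- A finite net of times and equicontinuity make the convergence uniform along the ultrafilter.
  -- What holds eventually there holds frequently along `atTop`, and this suffices to extract a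
  -- genuine subsequence.
  have hunif : ∀ ε > 0, ∃ᶠ k in atTop, ∀ t ∈ Icc 0 T, dist (F k t) (f t) ≤ ε := by
    intro ε hε
    obtain ⟨δ, hδ, k₀, h1, h2⟩ := hfdist (ε / 3) (by positivity)
    obtain ⟨S, hST, hS, hcov⟩ :=
      finite_cover_balls_of_compact (isCompact_Icc (a := (0 : ℝ)) (b := T)) hδ
    have hev : ∀ᶠ k in 𝒰, ∀ s ∈ S, dist (F k s) (f s) ≤ ε / 3 := by
      rw [eventually_all_finite hS]
      intro s hs
      filter_upwards [Metric.tendsto_nhds.1 (hf s (hST hs)) (ε / 3) (by positivity)] with k hk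
        using hk.le
    have hev' : ∀ᶠ k in 𝒰, ∀ t ∈ Icc 0 T, dist (F k t) (f t) ≤ ε := by
      filter_upwards [hev, h𝒰 (eventually_ge_atTop k₀)] with k hk hk0 t ht
      obtain ⟨s, hs, hts⟩ := mem_iUnion₂.1 (hcov ht)
      have hts' : |t - s| ≤ δ := by rw [← Real.dist_eq]; exact (Metric.mem_ball.1 hts).le
      have a := h1 k hk0 t ht s (hST hs) hts'
      have b := h2 t ht s (hST hs) hts'
      rw [dist_comm] at b
      have c := dist_triangle4 (F k t) (F k s) (f s) (f t)
      have d := hk s hs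
      linarith
    exact hev'.frequently.filter_mono h𝒰
  obtain ⟨θ, hθ, h⟩ := extraction_forall_of_frequently
    (P := fun i k => ∀ t ∈ Icc 0 T, dist (F k t) (f t) ≤ (1 / 2 : ℝ) ^ i)
    (fun i => hunif _ (by positivity))
  exact ⟨f, hcont, θ, hθ, h⟩

/-- A smooth probability density supported in the ball of radius `δ`. -/
structure IsMollifier (δ : ℝ) (ρ : E N → ℝ) : Prop where
  contDiff : ContDiff ℝ ((⊤ : ℕ∞) : WithTop ℕ∞) ρ
  hasCompactSupport : HasCompactSupport ρ
  nonneg : ∀ x, 0 ≤ ρ x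
  eq_zero : ∀ x, δ < ‖x‖ → ρ x = 0
  integral_eq_one : ∫ x, ρ x = 1

theorem exists_isMollifier {δ : ℝ} (hδ : 0 < δ) : ∃ ρ : E N → ℝ, IsMollifier δ ρ := by
  let b : ContDiffBump (0 : E N) := ⟨δ / 2, δ, half_pos hδ, half_lt_self hδ⟩
  refine ⟨b.normed volume, b.contDiff_normed, b.hasCompactSupport_normed, b.nonneg_normed,
    fun x hx => ?_, b.integral_normed⟩
  have : x ∉ Function.support (b.normed volume) := by
    rw [b.support_normed_eq, mem_ball_zero_iff]
    exact not_lt.2 hx.le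
  simpa using this

theorem bddIntegrable_of_continuous {f : E N → ℝ} (hf : Continuous f) (hc : HasCompactSupport f) :
    BddIntegrable f := by
  obtain ⟨C, hC⟩ := hc.exists_bound_of_continuous hf
  exact ⟨hf.measurable, hf.integrable_of_hasCompactSupport hc, C, hC⟩

/-- Mollification of `f` with the kernel `ρ`. -/
def mollify (ρ f : E N → ℝ) (x : E N) : ℝ := ∫ y, f y * ρ (y - x)

section Mollify

variable {δ : ℝ} {ρ f g : E N → ℝ}

theorem IsMollifier.bddIntegrable (hρ : IsMollifier δ ρ) : BddIntegrable ρ :=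
  bddIntegrable_of_continuous hρ.contDiff.continuous hρ.hasCompactSupport

theorem mollify_sub_eq (hρ : IsMollifier δ ρ) (hf : BddIntegrable f) (x : E N) :
    mollify ρ f x - f x = ∫ z, (f (x + z) - f x) * ρ z := by
  have e : mollify ρ f x = ∫ z, f (x + z) * ρ z := by
    rw [mollify, ← integral_add_left_eq_self (fun y => f y * ρ (y - x)) x]
    simp
  obtain ⟨M, hM⟩ := hf.bounded
  have i1 : Integrable fun z => f (x + z) * ρ z :=
    hρ.bddIntegrable.integrable.bdd_mul
      (hf.measurable.comp (measurable_id.const_add x)).aestronglyMeasurable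
      (Eventually.of_forall fun z => hM _)
  simp_rw [sub_mul]
  rw [integral_sub i1 (hρ.bddIntegrable.integrable.const_mul _), integral_const_mul,
    hρ.integral_eq_one, e, mul_one]

/-- The mollification error is an average of translation differences over shifts of size at most
`δ`, so by Fubini it inherits their `L¹` bound. -/
theorem integral_abs_mollify_sub_le (hρ : IsMollifier δ ρ) (hf : BddIntegrable f) {ε : ℝ}
    (hε : ∀ ξ, ‖ξ‖ ≤ δ → ∫ x, |f (x + ξ) - f x| ≤ ε) :
    Integrable (fun x => mollify ρ f x - f x) ∧ ∫ x, |mollify ρ f x - f x| ≤ ε := by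
  obtain ⟨M, hM⟩ := hρ.bddIntegrable.bounded
  have hm : Measurable fun p : E N × E N => (f (p.1 + p.2) - f p.1) * ρ p.2 :=
    ((hf.measurable.comp (measurable_fst.add measurable_snd)).sub
      (hf.measurable.comp measurable_fst)).mul (hρ.bddIntegrable.measurable.comp measurable_snd)
  have hle : ∀ z, ∫ x, |(f (x + z) - f x) * ρ z| ≤ ε * ρ z := fun z => by
    simp_rw [abs_mul, abs_of_nonneg (hρ.nonneg z)]
    rw [integral_mul_const]
    rcases le_or_gt ‖z‖ δ with h | h
    · exact mul_le_mul_of_nonneg_right (hε z h) (hρ.nonneg z)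
    · simp [hρ.eq_zero z h]
  have hprod : Integrable (fun p : E N × E N => (f (p.1 + p.2) - f p.1) * ρ p.2)
      (volume.prod volume) := by
    refine (integrable_prod_iff' hm.aestronglyMeasurable).2 ⟨Eventually.of_forall fun z =>
      ((hf.translate z).sub hf).integrable.mul_const (ρ z), ?_⟩
    refine (hρ.bddIntegrable.integrable.const_mul ε).mono' ?_ (Eventually.of_forall fun z => ?_)
    · exact (hm.norm.stronglyMeasurable.integral_prod_left (μ := volume)).aestronglyMeasurable
    · rw [Real.norm_eq_abs, abs_of_nonneg (integral_nonneg fun _ => norm_nonneg _)]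
      exact hle z
  have hint : Integrable (fun x => mollify ρ f x - f x) := by
    simp_rw [mollify_sub_eq hρ hf]
    exact hprod.integral_prod_left
  refine ⟨hint, ?_⟩
  calc ∫ x, |mollify ρ f x - f x| ≤ ∫ x, ∫ z, |(f (x + z) - f x) * ρ z| := by
        refine integral_mono hint.abs hprod.abs.integral_prod_left fun x => ?_
        dsimp only
        rw [mollify_sub_eq hρ hf]
        exact abs_integral_le_integral_abs
    _ = ∫ z, ∫ x, |(f (x + z) - f x) * ρ z| :=
        integral_integral_swap (f := fun x z => |(f (x + z) - f x) * ρ z|) hprod.abs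
    _ ≤ ∫ z, ε * ρ z := integral_mono hprod.abs.integral_prod_right
        (hρ.bddIntegrable.integrable.const_mul ε) hle
    _ = ε := by rw [integral_const_mul, hρ.integral_eq_one, mul_one]

theorem abs_mollify_sub_mollify_le {ℓ : ℝ≥0} (hℓ : LipschitzWith ℓ ρ) (hρ : BddIntegrable ρ)
    (hf : BddIntegrable f) {A : ℝ} (hA : ∫ x, |f x| ≤ A) (x y : E N) :
    |mollify ρ f x - mollify ρ f y| ≤ ℓ * dist x y * A := by
  obtain ⟨B, hB⟩ := hρ.bounded
  have i : ∀ x, Integrable fun z => f z * ρ (z - x) := fun x =>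
    hf.mul_bdd (hρ.measurable.comp (measurable_id.sub_const x)) (fun z => hB _)
  have h0 : (0 : ℝ) ≤ ℓ * dist x y := by positivity
  rw [mollify, mollify, ← integral_sub (i x) (i y)]
  calc _ ≤ ∫ z, ℓ * dist x y * |f z| := by
        rw [← Real.norm_eq_abs]
        refine norm_integral_le_of_norm_le (hf.integrable.abs.const_mul _)
          (Eventually.of_forall fun z => ?_)
        rw [← mul_sub, Real.norm_eq_abs, abs_mul, mul_comm]
        refine mul_le_mul_of_nonneg_right ?_ (abs_nonneg _)
        have := hℓ.dist_le_mul (z - x) (z - y)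
        rwa [Real.dist_eq, dist_sub_left] at this
    _ ≤ ℓ * dist x y * A := by
        rw [integral_const_mul]
        exact mul_le_mul_of_nonneg_left hA h0

theorem abs_mollify_le {B : ℝ} (hB : ∀ x, |ρ x| ≤ B) (hf : BddIntegrable f) {A : ℝ}
    (hA : ∫ x, |f x| ≤ A) (x : E N) : |mollify ρ f x| ≤ B * A := by
  have hB0 : 0 ≤ B := (abs_nonneg _).trans (hB 0)
  calc |mollify ρ f x| ≤ ∫ z, B * |f z| := by
        rw [← Real.norm_eq_abs]
        refine norm_integral_le_of_norm_le (hf.integrable.abs.const_mul _)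
          (Eventually.of_forall fun z => ?_)
        rw [Real.norm_eq_abs, abs_mul, mul_comm]
        exact mul_le_mul_of_nonneg_right (hB _) (abs_nonneg _)
    _ ≤ B * A := by
        rw [integral_const_mul]
        exact mul_le_mul_of_nonneg_left hA hB0

/-- Reduces closeness in `L¹` to uniform closeness of mollifications on a ball: inside the ball the
triangle inequality passes through the mollifications, outside it the tails are added. It serves
both the Riesz–Kolmogorov criterion and equicontinuity in time. -/
theorem integral_abs_sub_le_of_mollify (hρ : IsMollifier δ ρ) (hf : BddIntegrable f)
    (hg : BddIntegrable g) {ε₁ ε₂ s R : ℝ}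
    (hf₁ : ∀ ξ, ‖ξ‖ ≤ δ → ∫ x, |f (x + ξ) - f x| ≤ ε₁)
    (hg₁ : ∀ ξ, ‖ξ‖ ≤ δ → ∫ x, |g (x + ξ) - g x| ≤ ε₁)
    (hf₂ : ∫ x in (Metric.closedBall 0 R)ᶜ, |f x| ≤ ε₂)
    (hg₂ : ∫ x in (Metric.closedBall 0 R)ᶜ, |g x| ≤ ε₂)
    (hs : ∀ x, ‖x‖ ≤ R → |mollify ρ f x - mollify ρ g x| ≤ s) :
    ∫ x, |f x - g x|
      ≤ 2 * ε₁ + 2 * ε₂ + s * volume.real (Metric.closedBall (0 : E N) R) := by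
  obtain ⟨fi, fb⟩ := integral_abs_mollify_sub_le hρ hf hf₁
  obtain ⟨gi, gb⟩ := integral_abs_mollify_sub_le hρ hg hg₁
  have hd := (hf.sub hg).integrable.abs
  rw [← integral_add_compl (Metric.isClosed_closedBall (x := (0 : E N)) (ε := R)).measurableSet hd]
  have h2 : ∫ x in (Metric.closedBall 0 R)ᶜ, |f x - g x| ≤ 2 * ε₂ := by
    calc _ ≤ ∫ x in (Metric.closedBall 0 R)ᶜ, (|f x| + |g x|) :=
          integral_mono hd.integrableOn (hf.integrable.abs.add hg.integrable.abs).integrableOn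
            fun x => abs_sub _ _
      _ ≤ 2 * ε₂ := by
          rw [integral_add hf.integrable.abs.integrableOn hg.integrable.abs.integrableOn]
          linarith
  have hfin : volume (Metric.closedBall (0 : E N) R) ≠ ∞ := measure_closedBall_lt_top.ne
  have ic : IntegrableOn (fun _ : E N => s) (Metric.closedBall 0 R) :=
    integrableOn_const hfin
  have h1 : ∫ x in Metric.closedBall 0 R, |f x - g x|
      ≤ 2 * ε₁ + s * volume.real (Metric.closedBall (0 : E N) R) := by
    calc ∫ x in Metric.closedBall 0 R, |f x - g x|
        ≤ ∫ x in Metric.closedBall 0 R,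
            ((|mollify ρ f x - f x| + |mollify ρ g x - g x|) + s) := by
          refine setIntegral_mono_on hd.integrableOn
            ((fi.abs.add gi.abs).integrableOn.add ic) Metric.isClosed_closedBall.measurableSet
            fun x hx => ?_
          have a := hs x (by simpa using hx)
          have e : f x - g x = (mollify ρ f x - mollify ρ g x) + (mollify ρ g x - g x)
            - (mollify ρ f x - f x) := by ring
          rw [e]
          have b := abs_sub ((mollify ρ f x - mollify ρ g x) + (mollify ρ g x - g x))
            (mollify ρ f x - f x)
          have c := abs_add_le (mollify ρ f x - mollify ρ g x) (mollify ρ g x - g x)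
          linarith
      _ = (∫ x in Metric.closedBall 0 R, (|mollify ρ f x - f x| + |mollify ρ g x - g x|))
            + s * volume.real (Metric.closedBall (0 : E N) R) := by
          rw [integral_add (f := fun x => |mollify ρ f x - f x| + |mollify ρ g x - g x|)
            (fi.abs.add gi.abs).integrableOn ic]
          simp [mul_comm]
      _ ≤ _ := by
          have := setIntegral_le_integral (s := Metric.closedBall (0 : E N) R)
            (fi.abs.add gi.abs) (Eventually.of_forall fun x => add_nonneg (abs_nonneg _)
              (abs_nonneg _))
          have e := integral_add fi.abs gi.abs
          simp only [Pi.add_apply] at this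
          linarith
  linarith

end Mollify

theorem norm_toL1_sub {f g : E N → ℝ} (hf : BddIntegrable f) (hg : BddIntegrable g) :
    dist (hf.integrable.toL1 f) (hg.integrable.toL1 g) = ∫ x, |f x - g x| := by
  rw [dist_eq_norm, ← Integrable.toL1_sub, L1.norm_of_fun_eq_integral_norm]
  rfl

/-- The Riesz–Kolmogorov criterion in `L¹`. -/
theorem totallyBounded_toL1 {𝓕 : Set (E N → ℝ)} (hBI : ∀ f ∈ 𝓕, BddIntegrable f) {A : ℝ}
    (hA : ∀ f ∈ 𝓕, ∫ x, |f x| ≤ A)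
    (htight : ∀ ε > 0, ∃ R, ∀ f ∈ 𝓕, ∫ x in (Metric.closedBall 0 R)ᶜ, |f x| ≤ ε)
    (htrans : ∀ ε > 0, ∃ δ > 0, ∀ f ∈ 𝓕, ∀ ξ, ‖ξ‖ ≤ δ → ∫ x, |f (x + ξ) - f x| ≤ ε) :
    TotallyBounded {F : E N →₁[volume] ℝ | ∃ f, ∃ hf : f ∈ 𝓕, F = (hBI f hf).integrable.toL1 f} := by
  refine Metric.totallyBounded_of_finite_discretization fun ε hε => ?_
  obtain ⟨R, hR⟩ := htight (ε / 8) (by positivity)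
  obtain ⟨δ, hδ, hδ'⟩ := htrans (ε / 8) (by positivity)
  obtain ⟨ρ, hρ⟩ := exists_isMollifier (N := N) hδ
  obtain ⟨ℓ, hℓ⟩ := hρ.contDiff.lipschitzWith_of_hasCompactSupport hρ.hasCompactSupport (by simp)
  obtain ⟨B, hB⟩ := hρ.bddIntegrable.bounded
  set v := volume.real (Metric.closedBall (0 : E N) R) with hv
  have hv0 : 0 ≤ v := measureReal_nonneg
  -- `θ` is the quantization step for values of mollifications and `η` the mesh on which the
  -- Lipschitz bound changes them by at most `θ`. The final budget is `2ε/8 + 2ε/8 + 3ε/8 < ε`; the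
  -- added ones keep the denominators positive.
  set θ : ℝ := ε / (8 * (v + 1)) with hθ
  have hθ0 : 0 < θ := by positivity
  set η : ℝ := θ / ((ℓ + 1) * (|A| + 1)) with hη
  have hη0 : 0 < η := by positivity
  obtain ⟨S, -, hSfin, hcov⟩ :=
    finite_cover_balls_of_compact (isCompact_closedBall (0 : E N) R) hη0
  have : Fintype S := hSfin.fintype
  set m : ℤ := ⌈B * |A| / θ⌉ + 1
  have hcode : ∀ F : {F : E N →₁[volume] ℝ | ∃ f, ∃ hf : f ∈ 𝓕,
      F = (hBI f hf).integrable.toL1 f}, ∃ f, ∃ hf : f ∈ 𝓕,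
      F = (hBI f hf).integrable.toL1 f := fun F => F.2
  choose rep hrep hrepF using hcode
  have hbound : ∀ F, ∀ x, ⌊mollify ρ (rep F) x / θ⌋ ∈ Finset.Icc (-m) m := by
    intro F x
    have h := abs_mollify_le hB (hBI _ (hrep F)) ((hA _ (hrep F)).trans (le_abs_self A)) x
    have h' : |mollify ρ (rep F) x / θ| ≤ B * |A| / θ := by
      rw [abs_div, abs_of_pos hθ0]; gcongr
    have hc := Int.le_ceil (B * |A| / θ)
    rw [abs_le] at h'
    rw [Finset.mem_Icc]
    constructor
    · rw [Int.le_floor]; push_cast [m]; linarith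
    · have := Int.floor_le (mollify ρ (rep F) x / θ)
      have : (⌊mollify ρ (rep F) x / θ⌋ : ℝ) ≤ m := by push_cast [m]; linarith
      exact_mod_cast this
  -- The finite code of a function is its mollification, rounded to multiples of `θ`, at the points
  -- of the net. Equal codes give a distance of at most `3 * θ` on the ball: two moves to a net
  -- point and one rounding.
  refine ⟨S → Finset.Icc (-m) m, inferInstance, fun F s =>
    ⟨⌊mollify ρ (rep F) s / θ⌋, hbound F s⟩, fun F G hFG => ?_⟩
  rw [hrepF F, hrepF G, norm_toL1_sub (hBI _ (hrep F)) (hBI _ (hrep G))]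
  set f := rep F
  set g := rep G
  have hf := hrep F
  have hg := hrep G
  have hs : ∀ x, ‖x‖ ≤ R → |mollify ρ f x - mollify ρ g x| ≤ 3 * θ := by
    intro x hx
    obtain ⟨s, hs, hxs⟩ := mem_iUnion₂.1 (hcov (mem_closedBall_zero_iff.2 hx))
    have hd : ℓ * dist x s * |A| ≤ θ := by
      have h1 : (ℓ : ℝ) * dist x s * |A| ≤ (ℓ + 1) * η * (|A| + 1) := by
        have := (Metric.mem_ball.1 hxs).le
        gcongr <;> linarith
      have h2 : (ℓ + 1) * η * (|A| + 1) = θ := by rw [hη]; field_simp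
      linarith
    have a := abs_mollify_sub_mollify_le hℓ hρ.bddIntegrable (hBI f hf)
      ((hA f hf).trans (le_abs_self A)) x s
    have b := abs_mollify_sub_mollify_le hℓ hρ.bddIntegrable (hBI g hg)
      ((hA g hg).trans (le_abs_self A)) x s
    have c : |mollify ρ f s - mollify ρ g s| ≤ θ := by
      have h1 : ⌊mollify ρ f s / θ⌋ = ⌊mollify ρ g s / θ⌋ :=
        congrArg Subtype.val (congrFun hFG ⟨s, hs⟩)
      have := Int.abs_sub_lt_one_of_floor_eq_floor h1
      rw [← sub_div, abs_div, abs_of_pos hθ0, div_lt_one hθ0] at this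
      exact this.le
    rw [abs_le] at a b c ⊢
    constructor <;> linarith
  have key := integral_abs_sub_le_of_mollify hρ (hBI f hf) (hBI g hg) (hδ' f hf) (hδ' g hg)
    (hR f hf) (hR g hg) hs
  have : 3 * θ * v ≤ 3 * (ε / 8) := by
    have : θ * v ≤ ε / 8 := by
      rw [hθ, div_mul_eq_mul_div, div_le_div_iff₀ (by positivity) (by norm_num)]
      nlinarith
    linarith
  rw [← hv] at key
  linarith

end GPME

end

/-! ### Smooth functions: second-difference bounds, scaling, translations in `L¹`. -/

noncomputable section

namespace GPME

section SmoothBounds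

/-- The derivative is globally Lipschitz by compact support, and the mean value inequality is
applied on the segment from `x` to `x + z`. The space is left general so that it can also be
space-time, giving constants uniform in `t`. -/
theorem exists_taylor_bound {W : Type*} [NormedAddCommGroup W] [NormedSpace ℝ W] {f : W → ℝ}
    (hf : ContDiff ℝ ((⊤ : ℕ∞) : WithTop ℕ∞) f) (hc : HasCompactSupport f) :
    ∃ K, 0 ≤ K ∧ ∀ x z, |f (x + z) - f x - fderiv ℝ f x z| ≤ K * ‖z‖ ^ 2 := by
  have h1 : ContDiff ℝ 1 (fderiv ℝ f) := hf.fderiv_right (by norm_cast)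
  obtain ⟨K, hK⟩ := h1.lipschitzWith_of_hasCompactSupport (hc.fderiv ℝ) one_ne_zero
  refine ⟨K, K.2, fun x z => ?_⟩
  have := (convex_segment x (x + z)).norm_image_sub_le_of_norm_fderiv_le' (𝕜 := ℝ) (f := f)
    (φ := fderiv ℝ f x) (C := K * ‖z‖) (x := x) (y := x + z)
    (fun y _ => hf.contDiffAt.differentiableAt (by simp)) (fun y hy => ?_)
    (left_mem_segment ℝ _ _) (right_mem_segment ℝ _ _)
  · rw [add_sub_cancel_left, Real.norm_eq_abs] at this
    calc _ ≤ _ := this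
      _ = _ := by ring
  · have h2 := hK.dist_le_mul y x
    rw [dist_eq_norm, dist_eq_norm] at h2
    refine h2.trans (mul_le_mul_of_nonneg_left ?_ K.2)
    obtain ⟨θ, ⟨h0, h1⟩, rfl⟩ := (segment_eq_image' ℝ x (x + z)).subset hy
    simp only [add_sub_cancel_left, norm_smul, Real.norm_eq_abs, abs_of_nonneg h0]
    exact mul_le_of_le_one_left (norm_nonneg _) h1

theorem exists_symm_diff_bound {W : Type*} [NormedAddCommGroup W] [NormedSpace ℝ W] {f : W → ℝ}
    (hf : ContDiff ℝ ((⊤ : ℕ∞) : WithTop ℕ∞) f) (hc : HasCompactSupport f) :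
    ∃ K, 0 ≤ K ∧ ∀ x z, |f (x + z) + f (x - z) - 2 * f x| ≤ K * ‖z‖ ^ 2 := by
  obtain ⟨K, hK0, hK⟩ := exists_taylor_bound hf hc
  refine ⟨2 * K, by positivity, fun x z => ?_⟩
  have a := hK x z
  have b := hK x (-z)
  rw [norm_neg, map_neg, ← sub_eq_add_neg] at b
  have e : f (x + z) + f (x - z) - 2 * f x
      = (f (x + z) - f x - fderiv ℝ f x z) + (f (x - z) - f x - -(fderiv ℝ f x z)) := by ring
  rw [e]
  refine (abs_add_le _ _).trans ?_
  linarith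

end SmoothBounds

variable {N : ℕ}

/-- Uniform and integrated bounds for the second differences of `η`. -/
structure HasSecondDiffBound (K S : ℝ) (η : E N → ℝ) : Prop where
  bddIntegrable : BddIntegrable η
  abs_le : ∀ z x, |secondDiff η z x| ≤ K * min (‖z‖ ^ 2) 1
  integral_le : ∀ z, ∫ x, |secondDiff η z x| ≤ S * min (‖z‖ ^ 2) 1

theorem abs_secondDiff_le {η : E N → ℝ} {K : ℝ} (hK : ∀ x, |η x| ≤ K) (z x : E N) :
    |secondDiff η z x| ≤ 4 * K := by
  have a := hK (x + z)
  have b := hK (x - z)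
  have c := hK x
  rw [_root_.abs_le] at *
  unfold secondDiff
  constructor <;> linarith

theorem integral_abs_le_of_eq_zero {f : E N → ℝ} {K r : ℝ} (hK : ∀ x, |f x| ≤ K)
    (hf : ∀ x, r < ‖x‖ → f x = 0) :
    ∫ x, |f x| ≤ K * volume.real (Metric.closedBall (0 : E N) r) := by
  rw [← setIntegral_eq_integral_of_forall_compl_eq_zero (s := Metric.closedBall (0 : E N) r)
    fun x hx => by rw [hf x (by simpa using hx), abs_zero]]
  have := norm_setIntegral_le_of_norm_le_const (μ := volume) (f := fun x : E N => |f x|)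
    (s := Metric.closedBall (0 : E N) r) (C := K) measure_closedBall_lt_top
    (fun x _ => by simpa using hK x)
  exact (le_abs_self _).trans this

/-- For `|z| ≤ 1` the second difference is quadratic in `z` and supported in the ball of radius `r +
1`. For larger `z` its `L¹` norm is at most four times that of `η`. -/
theorem HasSecondDiffBound.of_support {η : E N → ℝ} (hη : BddIntegrable η) {K r : ℝ}
    (hK : ∀ x, |η x| ≤ K) (hK2 : ∀ z x, |secondDiff η z x| ≤ K * ‖z‖ ^ 2)
    (hr : ∀ x, r < ‖x‖ → η x = 0) :
    HasSecondDiffBound (4 * K) (4 * K * volume.real (Metric.closedBall (0 : E N) (r + 1))) η := by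
  have hK0 : 0 ≤ K := (abs_nonneg _).trans (hK 0)
  refine ⟨hη, fun z x => ?_, fun z => ?_⟩
  · rcases min_choice (‖z‖ ^ 2) 1 with h | h <;> rw [h]
    · have := hK2 z x
      have : 0 ≤ K * ‖z‖ ^ 2 := by positivity
      linarith
    · simpa using abs_secondDiff_le hK z x
  · rcases le_or_gt ‖z‖ 1 with h | h
    · rw [min_eq_left (by nlinarith [norm_nonneg z])]
      have := integral_abs_le_of_eq_zero (r := r + 1) (hK2 z) fun x hx => by
        have a : ‖x‖ ≤ ‖x + z‖ + ‖z‖ := by simpa using norm_sub_le (x + z) z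
        have b : ‖x‖ ≤ ‖x - z‖ + ‖z‖ := by simpa using norm_add_le (x - z) z
        simp [secondDiff, hr (x + z) (by linarith), hr (x - z) (by linarith), hr x (by linarith)]
      have h0 : 0 ≤ volume.real (Metric.closedBall (0 : E N) (r + 1)) := measureReal_nonneg
      have : 0 ≤ K * ‖z‖ ^ 2 * volume.real (Metric.closedBall (0 : E N) (r + 1)) := by positivity
      linarith
    · rw [min_eq_right (by nlinarith), mul_one]
      have h1 := integral_abs_le_of_eq_zero hK hr
      have h2 : volume.real (Metric.closedBall (0 : E N) r)
          ≤ volume.real (Metric.closedBall (0 : E N) (r + 1)) :=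
        measureReal_mono (Metric.closedBall_subset_closedBall (by linarith))
          measure_closedBall_lt_top.ne
      have i1 := (hη.integrable.comp_add_right z).abs
      have i2 : Integrable fun x => |η (x - z)| := (hη.integrable.comp_sub_right z).abs
      have i3 := hη.integrable.abs.const_mul 2
      calc ∫ x, |secondDiff η z x| ≤ ∫ x, ((|η (x + z)| + |η (x - z)|) + 2 * |η x|) := by
            refine integral_mono (integrable_secondDiff hη.integrable z).abs
              ((i1.add i2).add i3) fun x => ?_
            refine (abs_sub _ _).trans ?_
            rw [abs_mul, abs_two]
            exact add_le_add_left (abs_add_le _ _) _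
        _ = 4 * ∫ x, |η x| := by
            rw [integral_add (f := fun x => |η (x + z)| + |η (x - z)|) (i1.add i2) i3,
              integral_add i1 i2, integral_const_mul,
              integral_add_right_eq_self (fun x => |η x|) z,
              integral_sub_right_eq_self (fun x => |η x|) z]
            ring
        _ ≤ _ := by nlinarith

theorem HasSecondDiffBound.of_contDiff {η : E N → ℝ}
    (hf : ContDiff ℝ ((⊤ : ℕ∞) : WithTop ℕ∞) η) (hc : HasCompactSupport η) :
    ∃ K S, HasSecondDiffBound K S η := by
  obtain ⟨K₁, hK₁, h₁⟩ := exists_symm_diff_bound hf hc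
  have hη := bddIntegrable_of_continuous hf.continuous hc
  obtain ⟨K₂, h₂⟩ := hη.bounded
  obtain ⟨r, hr⟩ := hc.isCompact.isBounded.subset_closedBall (0 : E N)
  refine ⟨_, _, .of_support hη (K := max K₁ K₂) (r := r) (fun x => (h₂ x).trans (le_max_right _ _))
    (fun z x => (h₁ x z).trans (mul_le_mul_of_nonneg_right (le_max_left _ _) (by positivity)))
    fun x hx => image_eq_zero_of_notMem_tsupport fun h => ?_⟩
  have := hr h
  rw [mem_closedBall_zero_iff] at this
  linarith

namespace HasSecondDiffBound

variable {η : E N → ℝ} {K S : ℝ}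

theorem nonneg_left (h : HasSecondDiffBound K S η) (hN : 0 < N) : 0 ≤ K := by
  have : Nonempty (Fin N) := ⟨⟨0, hN⟩⟩
  obtain ⟨z, hz⟩ := exists_ne (0 : E N)
  have := (abs_nonneg _).trans (h.abs_le z 0)
  exact nonneg_of_mul_nonneg_left this (lt_min (by positivity) one_pos)

theorem nonneg_right (h : HasSecondDiffBound K S η) (hN : 0 < N) : 0 ≤ S := by
  have : Nonempty (Fin N) := ⟨⟨0, hN⟩⟩
  obtain ⟨z, hz⟩ := exists_ne (0 : E N)
  have := (integral_nonneg fun x => abs_nonneg _).trans (h.integral_le z)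
  exact nonneg_of_mul_nonneg_left this (lt_min (by positivity) one_pos)

variable (ν : Measure (E N)) [IsFiniteMeasure ν] [ν.IsNegInvariant]

theorem abs_jumpOp_le (h : HasSecondDiffBound K S η) (x : E N) :
    |jumpOp ν η x| ≤ K * truncMoment ν 1 / 2 := by
  obtain ⟨M, hM⟩ := h.bddIntegrable.bounded
  exact abs_jumpOp_le_truncMoment ν h.bddIntegrable.measurable hM
    (fun z x => by simpa using h.abs_le z x) x

theorem integral_abs_jumpOp_le (h : HasSecondDiffBound K S η) :
    ∫ x, |jumpOp ν η x| ≤ S * truncMoment ν 1 / 2 :=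
  integral_abs_jumpOp_le_truncMoment ν h.bddIntegrable (fun z => by simpa using h.integral_le z)

omit [IsFiniteMeasure ν] [ν.IsNegInvariant] in
theorem bddIntegrable_comp_smul (h : HasSecondDiffBound K S η) {R : ℝ} (hR : 0 < R) :
    BddIntegrable fun x => η (R⁻¹ • x) := by
  obtain ⟨M, hM⟩ := h.bddIntegrable.bounded
  exact ⟨h.bddIntegrable.measurable.comp (measurable_const_smul _),
    h.bddIntegrable.integrable.comp_smul (inv_ne_zero hR.ne'), M, fun x => hM _⟩

omit [IsFiniteMeasure ν] [ν.IsNegInvariant] in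
theorem secondDiff_comp_smul (R : ℝ) (z x : E N) :
    secondDiff (fun x => η (R⁻¹ • x)) z x = secondDiff η (R⁻¹ • z) (R⁻¹ • x) := by
  simp [secondDiff, smul_add, smul_sub]

omit [IsFiniteMeasure ν] [ν.IsNegInvariant] in
theorem norm_inv_smul_sq {R : ℝ} (hR : 0 < R) (z : E N) : ‖R⁻¹ • z‖ ^ 2 = ‖z‖ ^ 2 / R ^ 2 := by
  rw [norm_smul, norm_inv, Real.norm_eq_abs, abs_of_pos hR]
  field_simp

theorem abs_jumpOp_comp_smul_le (h : HasSecondDiffBound K S η) {R : ℝ} (hR : 0 < R) (x : E N) :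
    |jumpOp ν (fun x => η (R⁻¹ • x)) x| ≤ K * truncMoment ν R / 2 := by
  obtain ⟨M, hM⟩ := h.bddIntegrable.bounded
  refine abs_jumpOp_le_truncMoment ν (h.bddIntegrable_comp_smul hR).measurable (fun x => hM _)
    (fun z x => ?_) x
  rw [secondDiff_comp_smul, ← norm_inv_smul_sq hR]
  exact h.abs_le _ _

/-- Dilating by `R` replaces `min (|z|²) 1` by `min (|z|²/R²) 1`, which brings in the moment at
scale `R`. The factor `R ^ N` is the Jacobian and is absent from the sup bound; this discrepancy is
what the exponent `κ` has to beat. -/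
theorem integral_abs_jumpOp_comp_smul_le (h : HasSecondDiffBound K S η) {R : ℝ} (hR : 0 < R) :
    ∫ x, |jumpOp ν (fun x => η (R⁻¹ • x)) x| ≤ R ^ N * S * truncMoment ν R / 2 := by
  refine integral_abs_jumpOp_le_truncMoment ν (h.bddIntegrable_comp_smul hR) fun z => ?_
  simp_rw [secondDiff_comp_smul]
  rw [Measure.integral_comp_inv_smul_of_nonneg volume (fun x => |secondDiff η (R⁻¹ • z) x|) hR.le,
    ← norm_inv_smul_sq hR, finrank_euclideanSpace_fin, smul_eq_mul, mul_assoc]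
  exact mul_le_mul_of_nonneg_left (h.integral_le _) (by positivity)

end HasSecondDiffBound

/-- Continuity of translations in `L¹`. -/
theorem exists_integral_translate_le {W : Type*} [NormedAddCommGroup W] [NormedSpace ℝ W]
    [FiniteDimensional ℝ W] [MeasurableSpace W] [BorelSpace W] (μ : Measure W) [μ.IsAddHaarMeasure]
    {f : W → ℝ} (hf : Integrable f μ) {ε : ℝ} (hε : 0 < ε) :
    ∃ δ > 0, ∀ ξ, ‖ξ‖ ≤ δ → ∫ x, |f (x + ξ) - f x| ∂μ ≤ ε := by
  -- Budget: the error `f - g` occurs twice, once translated, at cost `ε/4` each; the continuous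
  -- compactly supported `g` is moved at cost `ε/2` by dominated convergence.
  obtain ⟨g, hgc, hgε, hg, hgi⟩ :=
    hf.exists_hasCompactSupport_integral_sub_le (ε := ε / 4) (by positivity)
  have hlim : Tendsto (fun ξ => ∫ x, |g (x + ξ) - g x| ∂μ) (𝓝 0) (𝓝 (∫ _, (0 : ℝ) ∂μ)) := by
    obtain ⟨C, hC⟩ := hgc.exists_bound_of_continuous hg
    obtain ⟨r, hr⟩ := hgc.isCompact.isBounded.subset_closedBall (0 : W)
    refine tendsto_integral_filter_of_dominated_convergence
      ((Metric.closedBall (0 : W) (r + 1)).indicator fun _ => 2 * C) ?_ ?_ ?_ ?_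
    · exact Eventually.of_forall fun ξ => by fun_prop
    · filter_upwards [Metric.closedBall_mem_nhds (0 : W) one_pos] with ξ hξ
      refine Eventually.of_forall fun x => ?_
      rw [mem_closedBall_zero_iff] at hξ
      by_cases hx : x ∈ Metric.closedBall (0 : W) (r + 1)
      · rw [indicator_of_mem hx]
        have a := hC (x + ξ)
        have b := hC x
        simp only [Real.norm_eq_abs, abs_abs] at *
        exact (abs_sub _ _).trans (by linarith)
      · rw [indicator_of_notMem hx]
        rw [mem_closedBall_zero_iff, not_le] at hx
        have hz : ∀ y, r < ‖y‖ → g y = 0 := fun y hy =>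
          image_eq_zero_of_notMem_tsupport fun h => by
            have := hr h
            rw [mem_closedBall_zero_iff] at this
            linarith
        have : ‖x‖ ≤ ‖x + ξ‖ + ‖ξ‖ := by simpa using norm_sub_le (x + ξ) ξ
        rw [hz x (by linarith), hz (x + ξ) (by linarith)]
        simp
    · exact (integrable_indicator_iff Metric.isClosed_closedBall.measurableSet).2
        (integrableOn_const measure_closedBall_lt_top.ne)
    · refine Eventually.of_forall fun x => ?_
      have : Continuous fun ξ => |g (x + ξ) - g x| := by fun_prop
      simpa using this.tendsto 0
  rw [integral_zero] at hlim
  obtain ⟨δ, hδ, h⟩ := Metric.eventually_nhds_iff_ball.1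
    (hlim.eventually (gt_mem_nhds (show (0 : ℝ) < ε / 2 by positivity)))
  refine ⟨δ / 2, half_pos hδ, fun ξ hξ => ?_⟩
  have h1 := h ξ (by rw [mem_ball_zero_iff]; linarith)
  have i1 := (hf.sub hgi).abs
  have i2 := (hgi.comp_add_right ξ |>.sub hgi).abs
  have i3 := i1.comp_add_right ξ
  have i0 := ((hf.comp_add_right ξ).sub hf).abs
  have := integral_mono i0 ((i3.add i2).add i1) fun x => by
    simp only [Pi.sub_apply, Pi.add_apply]
    have e : f (x + ξ) - f x = (f (x + ξ) - g (x + ξ)) + (g (x + ξ) - g x) - (f x - g x) := by ring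
    rw [e]
    refine (abs_sub _ _).trans (add_le_add_left (abs_add_le _ _) _)
  rw [integral_add' (i3.add i2) i1, integral_add' i3 i2] at this
  simp only [Pi.sub_apply, Real.norm_eq_abs] at this hgε
  rw [integral_add_right_eq_self (fun x => |f x - g x|) ξ] at this
  linarith

end GPME

end

/-! ### Source increments and spatial estimates uniform along the family of schemes. -/

noncomputable section

namespace GPME

variable {N : ℕ}

/-- Allows continuity of translations in `L¹` to be applied to the source on space-time. -/
instance instIsAddHaarMeasureSpaceTime : (volume : Measure (E N × ℝ)).IsAddHaarMeasure := by
  rw [Measure.volume_eq_prod]; infer_instance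

/-- A globally defined source: jointly measurable, integrable in space-time, and bounded in space by
an integrable function of time. -/
structure IsRegularSource (b : ℝ → ℝ) (g : E N × ℝ → ℝ) : Prop where
  measurable : Measurable g
  integrable : Integrable g
  integrable_bound : Integrable b
  abs_le : ∀ x t, |g (x, t)| ≤ b t

/-- The increment of the source over the `j`-th time step. -/
def sourceIncr (g : E N × ℝ → ℝ) (τ : ℝ) (j : ℕ) (x : E N) : ℝ :=
  ∫ t in (j * τ)..((j + 1 : ℕ) * τ), g (x, t)

section Source

variable {b : ℝ → ℝ} {g : E N × ℝ → ℝ} {τ : ℝ}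

theorem step_le (hτ : 0 ≤ τ) {i j : ℕ} (h : i ≤ j) : (i : ℝ) * τ ≤ j * τ :=
  mul_le_mul_of_nonneg_right (by exact_mod_cast h) hτ

theorem sourceIncr_eq (hτ : 0 ≤ τ) (j : ℕ) (x : E N) :
    sourceIncr g τ j x = ∫ t in Ioc (j * τ) ((j + 1 : ℕ) * τ), g (x, t) :=
  intervalIntegral.integral_of_le (step_le hτ j.le_succ)

theorem integrable_restrict_time (hg : Integrable g) (s : Set ℝ) :
    Integrable g ((volume : Measure (E N)).prod (volume.restrict s)) := by
  have e : (volume : Measure (E N)).prod (volume.restrict s)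
      = (volume : Measure (E N × ℝ)).restrict (univ ×ˢ s) := by
    rw [Measure.volume_eq_prod, ← Measure.prod_restrict, Measure.restrict_univ]
  rw [e]
  exact hg.restrict

theorem integrable_slice_norm (hg : Integrable g) : Integrable fun t => ∫ x, |g (x, t)| := by
  rw [Measure.volume_eq_prod] at hg
  exact hg.abs.integral_prod_right

theorem integral_abs_sourceIncr_le (hg : Integrable g) (hτ : 0 ≤ τ) (j : ℕ) :
    Integrable (sourceIncr g τ j) ∧
    ∫ x, |sourceIncr g τ j x| ≤ ∫ t in (j * τ)..((j + 1 : ℕ) * τ), ∫ x, |g (x, t)| := by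
  have hr := integrable_restrict_time hg (Ioc (j * τ) ((j + 1 : ℕ) * τ))
  have hi : Integrable (sourceIncr g τ j) := by
    simp_rw [funext (sourceIncr_eq (g := g) hτ j)]
    exact hr.integral_prod_left
  refine ⟨hi, ?_⟩
  rw [intervalIntegral.integral_of_le (step_le hτ j.le_succ),
    ← integral_integral_swap (f := fun x t => |g (x, t)|) hr.abs]
  refine integral_mono hi.abs hr.abs.integral_prod_left fun x => ?_
  dsimp only
  rw [sourceIncr_eq hτ]
  exact abs_integral_le_integral_abs

theorem IsRegularSource.bddIntegrable (h : IsRegularSource b g) (hτ : 0 ≤ τ) (j : ℕ) :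
    BddIntegrable (sourceIncr g τ j) ∧
      ∀ x, |sourceIncr g τ j x| ≤ ∫ t in (j * τ)..((j + 1 : ℕ) * τ), b t := by
  have hb : ∀ x, |sourceIncr g τ j x| ≤ ∫ t in (j * τ)..((j + 1 : ℕ) * τ), b t := fun x => by
    rw [sourceIncr_eq hτ, intervalIntegral.integral_of_le (step_le hτ j.le_succ),
      ← Real.norm_eq_abs]
    exact norm_integral_le_of_norm_le h.integrable_bound.restrict
      (Eventually.of_forall fun t => h.abs_le x t)
  refine ⟨⟨?_, (integral_abs_sourceIncr_le h.integrable hτ j).1, _, hb⟩, hb⟩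
  simp_rw [funext (sourceIncr_eq (g := g) hτ j)]
  exact (h.measurable.stronglyMeasurable.integral_prod_right').measurable

theorem sum_integral_steps {f : ℝ → ℝ} (hf : Integrable f) {m n : ℕ} (h : m ≤ n) :
    ∑ i ∈ Finset.Ico m n, (∫ t in (i * τ)..((i + 1 : ℕ) * τ), f t)
      = ∫ t in (m * τ)..(n * τ), f t :=
  intervalIntegral.sum_integral_adjacent_intervals_Ico (a := fun i : ℕ => (i : ℝ) * τ) h
    fun _ _ => hf.intervalIntegrable

theorem integral_steps_le {f : ℝ → ℝ} (hf : Integrable f) (hf0 : ∀ t, 0 ≤ f t) (hτ : 0 ≤ τ)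
    (n : ℕ) : ∑ i ∈ Finset.range n, (∫ t in (i * τ)..((i + 1 : ℕ) * τ), f t) ≤ ∫ t, f t := by
  rw [Finset.range_eq_Ico, sum_integral_steps hf n.zero_le,
    intervalIntegral.integral_of_le (step_le hτ n.zero_le)]
  exact setIntegral_le_integral hf (Eventually.of_forall hf0)

/-- The time steps are adjacent, so the masses of the increments add up to at most the space-time
mass of `g`, independently of `τ`. -/
theorem sum_integral_abs_sourceIncr_le (hg : Integrable g) (hτ : 0 ≤ τ) (n : ℕ) :
    ∑ i ∈ Finset.range n, (∫ x, |sourceIncr g τ i x|) ≤ ∫ p, |g p| := by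
  refine (Finset.sum_le_sum fun i _ => (integral_abs_sourceIncr_le hg hτ i).2).trans
    ((integral_steps_le (integrable_slice_norm hg)
      (fun t => integral_nonneg fun _ => abs_nonneg _) hτ n).trans (le_of_eq ?_))
  rw [Measure.volume_eq_prod] at hg ⊢
  exact (integral_prod_symm (fun p => |g p|) hg.abs).symm

end Source

/-- A sequence of stable explicit Euler schemes with Hölder nonlinearities and jump measures whose
truncated second moments decay uniformly. -/
structure IsSchemeFamily (κ β C T : ℝ) (ν : ℕ → Measure (E N)) (φ : ℕ → ℝ → ℝ) (τ : ℕ → ℝ) :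
    Prop where
  dim_pos : 0 < N
  exponent_pos : 0 < κ
  exponent_le_one : κ ≤ 1
  -- Here `β` is the decay rate in `moment`; the inequality makes the tail error `R ^ (N * (1 - κ) -
  -- β)` vanish as `R` grows.
  exponent_lt : N * (1 - κ) < β
  const_nonneg : 0 ≤ C
  time_pos : 0 < T
  finite : ∀ k, IsFiniteMeasure (ν k)
  symm : ∀ k, (ν k).IsNegInvariant
  stable : ∀ k, IsStable (ν k) (φ k) (τ k)
  step_pos : ∀ k, 0 < τ k
  step_tendsto : Tendsto τ atTop (𝓝 0)
  holder : ∀ k s, |φ k s| ≤ C * |s| ^ κ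
  bounded : ∀ k s, |φ k s| ≤ C
  moment : ∀ k R, 1 ≤ R → truncMoment (ν k) R ≤ C * R ^ (-β)

/-- The discrete solution with index `k` at step `j`. -/
def approx (ν : ℕ → Measure (E N)) (φ : ℕ → ℝ → ℝ) (τ : ℕ → ℝ) (u₀ : E N → ℝ)
    (g : E N × ℝ → ℝ) (k j : ℕ) : E N → ℝ :=
  euler (ν k) (φ k) (τ k) u₀ (sourceIncr g (τ k)) j

namespace IsSchemeFamily

variable {κ β C T : ℝ} {ν : ℕ → Measure (E N)} {φ : ℕ → ℝ → ℝ} {τ : ℕ → ℝ} {u₀ : E N → ℝ}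
  {b : ℝ → ℝ} {g : E N × ℝ → ℝ}

theorem bddIntegrable (h : IsSchemeFamily κ β C T ν φ τ) (hu : BddIntegrable u₀)
    (hg : IsRegularSource b g) (k j : ℕ) : BddIntegrable (approx ν φ τ u₀ g k j) := by
  have := h.finite k
  exact (h.stable k).euler hu (fun i => (hg.bddIntegrable (h.step_pos k).le i).1) j

theorem abs_approx_le (h : IsSchemeFamily κ β C T ν φ τ) (hu : BddIntegrable u₀)
    (hg : IsRegularSource b g) {M : ℝ} (hM : ∀ x, |u₀ x| ≤ M) (k j : ℕ) (x : E N) :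
    |approx ν φ τ u₀ g k j x| ≤ M + ∫ t, b t := by
  have := h.finite k
  refine ((h.stable k).abs_euler_le hu (fun i => (hg.bddIntegrable (h.step_pos k).le i).1) hM
    (fun i => (hg.bddIntegrable (h.step_pos k).le i).2) j x).trans (add_le_add_right ?_ M)
  exact integral_steps_le hg.integrable_bound
    (fun t => (abs_nonneg _).trans (hg.abs_le 0 t)) (h.step_pos k).le j

theorem integral_abs_approx_le (h : IsSchemeFamily κ β C T ν φ τ) (hu : BddIntegrable u₀)
    (hg : IsRegularSource b g) (k j : ℕ) :
    ∫ x, |approx ν φ τ u₀ g k j x| ≤ (∫ x, |u₀ x|) + ∫ p, |g p| := by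
  have := h.finite k
  have := h.symm k
  exact ((h.stable k).integral_abs_euler_le hu
    (fun i => (hg.bddIntegrable (h.step_pos k).le i).1) j).trans
    (add_le_add_right (sum_integral_abs_sourceIncr_le hg.integrable (h.step_pos k).le j) _)

/-- A translate of the discrete solution is the discrete solution for translated data, so `L¹`
contraction applies to the pair. -/
theorem integral_abs_translate_sub_le (h : IsSchemeFamily κ β C T ν φ τ) (hu : BddIntegrable u₀)
    (hg : IsRegularSource b g) (k j : ℕ) (ξ : E N) :
    ∫ x, |approx ν φ τ u₀ g k j (x + ξ) - approx ν φ τ u₀ g k j x|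
      ≤ (∫ x, |u₀ (x + ξ) - u₀ x|) + ∫ p, |g (p + (ξ, 0)) - g p| := by
  have := h.finite k
  have := h.symm k
  have hG := fun i => (hg.bddIntegrable (h.step_pos k).le i).1
  have key := (h.stable k).integral_abs_euler_sub_le (hu.translate ξ) hu
    (fun i => (hG i).translate ξ) hG j
  simp_rw [euler_translate] at key
  refine key.trans (add_le_add_right ?_ _)
  have e : ∀ i x, sourceIncr g (τ k) i (x + ξ) - sourceIncr g (τ k) i x
      = sourceIncr (fun p => g (p + (ξ, 0)) - g p) (τ k) i x := fun i x => by
    have hi : ∀ y, Integrable fun t => g (y, t) := fun y =>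
      hg.integrable_bound.mono' (hg.measurable.comp measurable_prodMk_left).aestronglyMeasurable
        (Eventually.of_forall fun t => hg.abs_le y t)
    simp only [sourceIncr, Prod.mk_add_mk, add_zero]
    rw [intervalIntegral.integral_sub (hi _).intervalIntegrable (hi _).intervalIntegrable]
  simp_rw [e]
  exact sum_integral_abs_sourceIncr_le
    ((hg.integrable.comp_add_right (ξ, (0 : ℝ))).sub hg.integrable) (h.step_pos k).le j

/-- Uniform spatial equicontinuity in `L¹`. -/
theorem exists_translate_le (h : IsSchemeFamily κ β C T ν φ τ) (hu : BddIntegrable u₀)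
    (hg : IsRegularSource b g) {ε : ℝ} (hε : 0 < ε) :
    ∃ δ > 0, ∀ k j ξ, ‖ξ‖ ≤ δ →
      ∫ x, |approx ν φ τ u₀ g k j (x + ξ) - approx ν φ τ u₀ g k j x| ≤ ε := by
  obtain ⟨δ₁, hδ₁, h₁⟩ := exists_integral_translate_le volume hu.integrable (half_pos hε)
  obtain ⟨δ₂, hδ₂, h₂⟩ := exists_integral_translate_le volume hg.integrable (half_pos hε)
  refine ⟨min δ₁ δ₂, lt_min hδ₁ hδ₂, fun k j ξ hξ => ?_⟩
  have a := h₁ ξ (hξ.trans (min_le_left _ _))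
  have b := h₂ (ξ, 0) (by simpa [Prod.norm_def] using hξ.trans (min_le_right _ _))
  linarith [h.integral_abs_translate_sub_le hu hg k j ξ]

/-- Uniform tightness. -/
theorem exists_tail_le (h : IsSchemeFamily κ β C T ν φ τ) (hu : BddIntegrable u₀)
    (hg : IsRegularSource b g) {ε : ℝ} (hε : 0 < ε) :
    ∃ R, ∀ k (j : ℕ), j * τ k ≤ T →
      ∫ x in (Metric.closedBall 0 R)ᶜ, |approx ν φ τ u₀ g k j x| ≤ ε := by
  -- The dilated cutoff vanishes outside the ball of radius `R` and tends to 1 pointwise. So `1 -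
  -- η(x/R)` dominates the indicator of the exterior, while its integrals against the data tend to
  -- 0.
  let η : ContDiffBump (0 : E N) := ⟨1 / 2, 1, by norm_num, by norm_num⟩
  obtain ⟨K, S, hη⟩ := HasSecondDiffBound.of_contDiff η.contDiff η.hasCompactSupport
  have hK0 := hη.nonneg_left h.dim_pos
  have hS0 := hη.nonneg_right h.dim_pos
  set A := (∫ x, |u₀ x|) + ∫ p, |g p| with hA
  have hA0 : 0 ≤ A := add_nonneg (integral_nonneg fun _ => abs_nonneg _)
    (integral_nonneg fun _ => abs_nonneg _)
  have hC := h.const_nonneg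
  have hcut : ∀ x : E N, Tendsto (fun R : ℝ => 1 - η (R⁻¹ • x)) atTop (𝓝 0) := fun x => by
    have h1 : Tendsto (fun R : ℝ => R⁻¹ • x) atTop (𝓝 ((0 : ℝ) • x)) :=
      tendsto_inv_atTop_zero.smul_const x
    rw [zero_smul] at h1
    have h2 := (η.continuous.tendsto 0).comp h1
    rw [η.one_of_mem_closedBall (by simp [η])] at h2
    simpa using h2.const_sub 1
  have hbd : ∀ y : E N, |1 - η y| ≤ 1 := fun y => by
    rw [abs_le]; constructor <;> linarith [η.nonneg' y, η.le_one (x := y)]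
  have lim1 : Tendsto (fun R : ℝ => ∫ x, |u₀ x| * (1 - η (R⁻¹ • x))) atTop (𝓝 0) := by
    have := tendsto_integral_filter_of_dominated_convergence (μ := volume) (l := atTop)
      (F := fun (R : ℝ) x => |u₀ x| * (1 - η (R⁻¹ • x))) (f := fun _ => (0 : ℝ)) (fun x => |u₀ x|)
      (Eventually.of_forall fun R => (hu.measurable.abs.mul (measurable_const.sub
        (η.continuous.measurable.comp (measurable_const_smul _)))).aestronglyMeasurable)
      (Eventually.of_forall fun R => Eventually.of_forall fun x => by
        rw [norm_mul, Real.norm_eq_abs, abs_abs]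
        exact mul_le_of_le_one_right (abs_nonneg _) (hbd _))
      hu.integrable.abs (Eventually.of_forall fun x => by
        simpa using (hcut x).const_mul (|u₀ x|))
    simpa using this
  have hmeas : ∀ R : ℝ, Measurable fun p : E N × ℝ => g p * (1 - η (R⁻¹ • p.1)) := fun R =>
    hg.measurable.mul (measurable_const.sub
      (η.continuous.measurable.comp ((measurable_const_smul _).comp measurable_fst)))
  have lim2 : Tendsto (fun R : ℝ => ∫ p : E N × ℝ, |g p * (1 - η (R⁻¹ • p.1))|) atTop (𝓝 0) := by
    have := tendsto_integral_filter_of_dominated_convergence (μ := volume) (l := atTop)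
      (F := fun (R : ℝ) (p : E N × ℝ) => |g p * (1 - η (R⁻¹ • p.1))|) (f := fun _ => (0 : ℝ))
      (fun p => |g p|)
      (Eventually.of_forall fun R => (hmeas R).abs.aestronglyMeasurable)
      (Eventually.of_forall fun R => Eventually.of_forall fun p => by
        rw [Real.norm_eq_abs, abs_abs, abs_mul]
        exact mul_le_of_le_one_right (abs_nonneg _) (hbd _))
      hg.integrable.abs (Eventually.of_forall fun p => by
        simpa using ((hcut p.1).const_mul (g p)).abs)
    simpa using this
  set D := T * (C * (S * C / 2 + A * (K * C / 2))) with hD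
  have lim3 : Tendsto (fun R : ℝ => D * R ^ (-(β - N * (1 - κ)))) atTop (𝓝 0) := by
    simpa using (tendsto_rpow_neg_atTop (sub_pos.2 h.exponent_lt)).const_mul D
  have lim := (lim1.add lim2).add lim3
  simp only [add_zero] at lim
  obtain ⟨R, hRε, hR1⟩ := ((lim.eventually (gt_mem_nhds hε)).and (eventually_ge_atTop 1)).exists
  refine ⟨R, fun k j hj => ?_⟩
  have hR : 0 < R := by linarith
  have := h.finite k
  have := h.symm k
  have hU := h.bddIntegrable hu hg k j
  have hm := h.moment k R hR1
  have hηR := hη.bddIntegrable_comp_smul hR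
  have hG := fun i => (hg.bddIntegrable (h.step_pos k).le i).1
  -- The level `l = R^{-N}` balances the two error terms: `l^κ R^{N-β}` and `l^{κ-1} R^{-β}` both
  -- equal `R^{N(1-κ)-β}`.
  have key := (h.stable k).integral_abs_euler_mul_le hu hG hηR
    (fun x => η.nonneg' _) (fun x => η.le_one) h.exponent_pos h.exponent_le_one
    (l := R ^ (-(N : ℝ))) (by positivity) hC (h.holder k)
    (h.integral_abs_approx_le hu hg k)
    (S := R ^ N * S * (C * R ^ (-β)) / 2) (K := K * (C * R ^ (-β)) / 2)
    ((hη.integral_abs_jumpOp_comp_smul_le (ν k) hR).trans (by gcongr))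
    (fun x => (hη.abs_jumpOp_comp_smul_le (ν k) hR x).trans (by gcongr)) j
  have htail : ∫ x in (Metric.closedBall 0 R)ᶜ, |approx ν φ τ u₀ g k j x|
      ≤ ∫ x, |approx ν φ τ u₀ g k j x| * (1 - η (R⁻¹ • x)) := by
    have hint := hU.abs.mul_bdd (measurable_const.sub hηR.measurable)
      (fun x => hbd (R⁻¹ • x))
    refine le_trans (le_of_eq ?_) (setIntegral_le_integral (s := (Metric.closedBall 0 R)ᶜ) hint
      (Eventually.of_forall fun x => mul_nonneg (abs_nonneg _) (by linarith [η.le_one (x := R⁻¹ • x)])))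
    refine setIntegral_congr_fun Metric.isClosed_closedBall.measurableSet.compl fun x hx => ?_
    have : η (R⁻¹ • x) = 0 := by
      refine η.zero_of_le_dist ?_
      have hx' : R < ‖x‖ := by simpa using hx
      rw [dist_zero_right, norm_smul, norm_inv, Real.norm_eq_abs, abs_of_pos hR,
        inv_mul_eq_div, le_div_iff₀ hR]
      simpa [η] using hx'.le
    simp [this]
  have hsrc : ∑ i ∈ Finset.range j, (∫ x, |sourceIncr g (τ k) i x| * (1 - η (R⁻¹ • x)))
      ≤ ∫ p : E N × ℝ, |g p * (1 - η (R⁻¹ • p.1))| := by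
    have hgi : Integrable fun p : E N × ℝ => g p * (1 - η (R⁻¹ • p.1)) := by
      refine hg.integrable.mul_bdd (c := 1) ?_ (Eventually.of_forall fun p => hbd _)
      exact (measurable_const.sub (η.continuous.measurable.comp
        ((measurable_const_smul _).comp measurable_fst))).aestronglyMeasurable
    refine le_trans (le_of_eq ?_) (sum_integral_abs_sourceIncr_le hgi (h.step_pos k).le j)
    refine Finset.sum_congr rfl fun i _ => ?_
    congr 1; funext x
    rw [sourceIncr, sourceIncr]
    dsimp only
    rw [intervalIntegral.integral_mul_const, abs_mul,
      abs_of_nonneg (a := 1 - η (R⁻¹ • x)) (by linarith [η.le_one (x := R⁻¹ • x)])]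
  have hlast : j * τ k * (C * ((R ^ (-(N : ℝ))) ^ κ * (R ^ N * S * (C * R ^ (-β)) / 2)
      + (R ^ (-(N : ℝ))) ^ (κ - 1) * A * (K * (C * R ^ (-β)) / 2)))
      ≤ D * R ^ (-(β - N * (1 - κ))) := by
    have e1 : (R ^ (-(N : ℝ))) ^ κ * (R ^ N * R ^ (-β)) = R ^ (-(β - N * (1 - κ))) := by
      rw [← Real.rpow_mul hR.le, ← Real.rpow_natCast R N, ← Real.rpow_add hR, ← Real.rpow_add hR]
      congr 1; ring
    have e2 : (R ^ (-(N : ℝ))) ^ (κ - 1) * R ^ (-β) = R ^ (-(β - N * (1 - κ))) := by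
      rw [← Real.rpow_mul hR.le, ← Real.rpow_add hR]
      congr 1; ring
    have e3 : C * ((R ^ (-(N : ℝ))) ^ κ * (R ^ N * S * (C * R ^ (-β)) / 2)
        + (R ^ (-(N : ℝ))) ^ (κ - 1) * A * (K * (C * R ^ (-β)) / 2))
        = C * (S * C / 2 + A * (K * C / 2)) * R ^ (-(β - N * (1 - κ))) := by
      linear_combination (C * (S * C / 2)) * e1 + (C * (A * (K * C / 2))) * e2
    rw [e3, hD, mul_assoc T]
    exact mul_le_mul_of_nonneg_right hj (by positivity)
  refine htail.trans (key.trans ?_)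
  linarith

end IsSchemeFamily

end GPME

end

/-! ### Equicontinuity in time and extraction of the limit. -/

noncomputable section

namespace GPME

variable {N : ℕ}

theorem exists_interval_integral_le {f : ℝ → ℝ} (hf : Integrable f) (T : ℝ) {ε : ℝ} (hε : 0 < ε) :
    ∃ δ > 0, ∀ a ∈ Icc 0 T, ∀ b ∈ Icc 0 T, |b - a| ≤ δ → ∫ t in a..b, f t ≤ ε := by
  have hc : Continuous fun x => ∫ t in (0 : ℝ)..x, f t :=
    intervalIntegral.continuous_primitive (fun _ _ => hf.intervalIntegrable) 0
  obtain ⟨δ, hδ, h⟩ := Metric.uniformContinuousOn_iff.1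
    (isCompact_Icc.uniformContinuousOn_of_continuous (hc.continuousOn (s := Icc 0 T))) ε hε
  refine ⟨δ / 2, half_pos hδ, fun a ha b hb hab => ?_⟩
  have := h b hb a ha (by rw [Real.dist_eq]; linarith)
  rw [Real.dist_eq, intervalIntegral.integral_interval_sub_left hf.intervalIntegrable
    hf.intervalIntegrable] at this
  exact (le_abs_self _).trans this.le

/-- The errors are summable in `L¹`, so by Tonelli their pointwise sum is finite almost everywhere.
The rate gives almost everywhere convergence of the whole sequence, which is essential since one
sequence must work for every time. -/
theorem ae_tendsto_of_integral_abs_sub_le {f : ℕ → E N → ℝ} {u : E N → ℝ}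
    (hf : ∀ i, Integrable (f i)) (hu : Integrable u)
    (h : ∀ i, ∫ x, |f i x - u x| ≤ (1 / 2 : ℝ) ^ i) :
    ∀ᵐ x, Tendsto (fun i => f i x) atTop (𝓝 (u x)) := by
  have hsum : ∫⁻ x, ∑' i, ‖f i x - u x‖ₑ ≠ ∞ := by
    rw [lintegral_tsum (f := fun i x => ‖f i x - u x‖ₑ)
      fun i => ((hf i).sub hu).aestronglyMeasurable.enorm]
    have hle : ∀ i, ∫⁻ x, ‖f i x - u x‖ₑ ≤ ENNReal.ofReal ((1 / 2 : ℝ) ^ i) := fun i => by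
      have := ofReal_integral_norm_eq_lintegral_enorm ((hf i).sub hu)
      simp only [Pi.sub_apply] at this
      rw [← this]
      exact ENNReal.ofReal_le_ofReal (h i)
    refine ne_top_of_le_ne_top ?_ (ENNReal.tsum_le_tsum hle)
    rw [← ENNReal.ofReal_tsum_of_nonneg (fun i => by positivity) summable_geometric_two]
    exact ENNReal.ofReal_ne_top
  have hm : AEMeasurable fun x => ∑' i, ‖f i x - u x‖ₑ :=
    AEMeasurable.tsum fun i => ((hf i).sub hu).aestronglyMeasurable.enorm
  filter_upwards [ae_lt_top' hm hsum] with x hx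
  have := ENNReal.tendsto_atTop_zero_of_tsum_ne_top hx.ne
  rw [tendsto_iff_edist_tendsto_0]
  simpa [edist_eq_enorm_sub] using this

namespace IsSchemeFamily

variable {κ β C T : ℝ} {ν : ℕ → Measure (E N)} {φ : ℕ → ℝ → ℝ} {τ : ℕ → ℝ} {u₀ : E N → ℝ}
  {b : ℝ → ℝ} {g : E N × ℝ → ℝ}

theorem truncMoment_one_le (h : IsSchemeFamily κ β C T ν φ τ) (k : ℕ) :
    truncMoment (ν k) 1 ≤ C := by
  simpa using h.moment k 1 le_rfl

/-- Testing one step with a translated kernel moves the jump operator onto `ρ`, whose image is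
bounded in `L¹` uniformly in the scheme; the nonlinearity contributes only its sup bound `C`. -/
theorem abs_mollify_step_le (h : IsSchemeFamily κ β C T ν φ τ) (hu : BddIntegrable u₀)
    (hg : IsRegularSource b g) {ρ : E N → ℝ} {K S B : ℝ} (hρ : HasSecondDiffBound K S ρ)
    (hB : ∀ x, |ρ x| ≤ B) (k j : ℕ) (x : E N) :
    |mollify ρ (approx ν φ τ u₀ g k (j + 1)) x - mollify ρ (approx ν φ τ u₀ g k j) x|
      ≤ τ k * (C * (S * C / 2)) + B * ∫ y, |sourceIncr g (τ k) j y| := by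
  have := h.finite k
  have := h.symm k
  have hS0 := hρ.nonneg_right h.dim_pos
  have hU := h.bddIntegrable hu hg k j
  have hG := (hg.bddIntegrable (h.step_pos k).le j).1
  have hφU := (h.stable k).bddIntegrable hU
  set U := approx ν φ τ u₀ g k j with hUdef
  have hmρ : Measurable fun y => ρ (y - x) :=
    hρ.bddIntegrable.measurable.comp (measurable_id.sub_const x)
  have hBρ : ∀ y, |ρ (y - x)| ≤ B := fun y => hB _
  have i1 := hU.mul_bdd hmρ hBρ
  have i2 := ((hφU.jumpOp (ν k)).mul_bdd hmρ hBρ).const_mul (τ k)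
  have i3 := hG.mul_bdd hmρ hBρ
  have e : mollify ρ (approx ν φ τ u₀ g k (j + 1)) x - mollify ρ U x
      = τ k * (∫ y, jumpOp (ν k) (fun y => φ k (U y)) y * ρ (y - x))
        + mollify ρ (sourceIncr g (τ k) j) x := by
    have : ∀ y, approx ν φ τ u₀ g k (j + 1) y * ρ (y - x)
        = U y * ρ (y - x) + (τ k * (jumpOp (ν k) (fun y => φ k (U y)) y * ρ (y - x))
          + sourceIncr g (τ k) j y * ρ (y - x)) := fun y => by
      simp only [hUdef, approx, euler, eulerStep]; ring
    simp only [mollify, this]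
    rw [integral_add (g := fun y => τ k * (jumpOp (ν k) (fun y => φ k (U y)) y * ρ (y - x))
          + sourceIncr g (τ k) j y * ρ (y - x)) i1 (i2.add i3), integral_add i2 i3,
      integral_const_mul]
    ring
  have bd : |∫ y, jumpOp (ν k) (fun y => φ k (U y)) y * ρ (y - x)| ≤ C * (S * C / 2) := by
    rw [integral_jumpOp_mul (ν k) hφU hmρ hBρ, ← Real.norm_eq_abs]
    have hL : ∀ y, jumpOp (ν k) (fun y => ρ (y - x)) y = jumpOp (ν k) ρ (y - x) := fun y => by
      simpa [sub_eq_add_neg] using jumpOp_translate (ν k) (f := ρ) (-x) y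
    have i4 : Integrable fun y => C * |jumpOp (ν k) ρ (y - x)| :=
      (((hρ.bddIntegrable.jumpOp (ν k)).integrable.comp_sub_right x).abs).const_mul C
    refine (norm_integral_le_of_norm_le i4 (Eventually.of_forall fun y => ?_)).trans ?_
    · rw [norm_mul, hL]
      exact mul_le_mul_of_nonneg_right (h.bounded k _) (abs_nonneg _)
    · rw [integral_const_mul,
        integral_sub_right_eq_self (fun y => |jumpOp (ν k) ρ y|) x]
      refine mul_le_mul_of_nonneg_left ((hρ.integral_abs_jumpOp_le (ν k)).trans ?_) h.const_nonneg
      have := mul_le_mul_of_nonneg_left (h.truncMoment_one_le k) hS0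
      linarith
  rw [e]
  refine (abs_add_le _ _).trans (add_le_add ?_ (abs_mollify_le hB hG le_rfl x))
  rw [abs_mul, abs_of_pos (h.step_pos k)]
  exact mul_le_mul_of_nonneg_left bd (h.step_pos k).le

theorem abs_mollify_sub_le (h : IsSchemeFamily κ β C T ν φ τ) (hu : BddIntegrable u₀)
    (hg : IsRegularSource b g) {ρ : E N → ℝ} {K S B : ℝ} (hρ : HasSecondDiffBound K S ρ)
    (hB : ∀ x, |ρ x| ≤ B) (k : ℕ) {i j : ℕ} (hij : i ≤ j) (x : E N) :
    |mollify ρ (approx ν φ τ u₀ g k j) x - mollify ρ (approx ν φ τ u₀ g k i) x|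
      ≤ (j * τ k - i * τ k) * (C * (S * C / 2))
        + B * ∫ t in (i * τ k)..(j * τ k), ∫ y, |g (y, t)| := by
  have hB0 : 0 ≤ B := (abs_nonneg _).trans (hB 0)
  have hi : ∀ a b, IntervalIntegrable (fun t => ∫ y, |g (y, t)|) volume a b := fun a b =>
    (integrable_slice_norm hg.integrable).intervalIntegrable
  induction j, hij using Nat.le_induction with
  | base => simp
  | succ j hij ih =>
    have a := h.abs_mollify_step_le hu hg hρ hB k j x
    have c := mul_le_mul_of_nonneg_left
      (integral_abs_sourceIncr_le hg.integrable (h.step_pos k).le j).2 hB0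
    rw [← intervalIntegral.integral_add_adjacent_intervals (hi (i * τ k) (j * τ k)) (hi _ _)]
    have e : mollify ρ (approx ν φ τ u₀ g k (j + 1)) x - mollify ρ (approx ν φ τ u₀ g k i) x
      = (mollify ρ (approx ν φ τ u₀ g k (j + 1)) x - mollify ρ (approx ν φ τ u₀ g k j) x)
        + (mollify ρ (approx ν φ τ u₀ g k j) x - mollify ρ (approx ν φ τ u₀ g k i) x) := by ring
    rw [e]
    refine (abs_add_le _ _).trans ((add_le_add a ih).trans ?_)
    push_cast at c ⊢
    linarith

/-- Uniform equicontinuity in time, with values in `L¹`. -/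
theorem exists_time_le (h : IsSchemeFamily κ β C T ν φ τ) (hu : BddIntegrable u₀)
    (hg : IsRegularSource b g) {ε : ℝ} (hε : 0 < ε) :
    ∃ δ > 0, ∀ k (i j : ℕ), i ≤ j → j * τ k ≤ T → j * τ k - i * τ k ≤ δ →
      ∫ x, |approx ν φ τ u₀ g k j x - approx ν φ τ u₀ g k i x| ≤ ε := by
  -- Tightness and spatial equicontinuity pay for removing the mollification (four terms of size
  -- `ε/8`). With `ρ` and `R` now fixed, the time interval is chosen so short that diffusion and
  -- source change the mollified scheme by at most `ε/8` each after multiplication by the volume of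
  -- the ball.
  obtain ⟨R, hR⟩ := h.exists_tail_le hu hg (show 0 < ε / 8 by positivity)
  obtain ⟨δ₀, hδ₀, htr⟩ := h.exists_translate_le hu hg (show 0 < ε / 8 by positivity)
  obtain ⟨ρ, hρ⟩ := exists_isMollifier (N := N) hδ₀
  obtain ⟨K, S, hρS⟩ := HasSecondDiffBound.of_contDiff hρ.contDiff hρ.hasCompactSupport
  obtain ⟨B, hB⟩ := hρ.bddIntegrable.bounded
  have hB0 : 0 ≤ B := (abs_nonneg _).trans (hB 0)
  have hS0 := hρS.nonneg_right h.dim_pos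
  have hC := h.const_nonneg
  set v := volume.real (Metric.closedBall (0 : E N) R) with hv
  have hv0 : 0 ≤ v := measureReal_nonneg
  set D := C * (S * C / 2) with hDdef
  have hD : 0 ≤ D := by positivity
  obtain ⟨δ₁, hδ₁, hsrc⟩ := exists_interval_integral_le (integrable_slice_norm hg.integrable) T
    (show 0 < ε / (8 * ((B + 1) * (v + 1))) by positivity)
  refine ⟨min δ₁ (ε / (8 * ((D + 1) * (v + 1)))), by positivity, fun k i j hij hj hd => ?_⟩
  have hτ := (h.step_pos k).le
  have hij' := step_le hτ hij
  have hi0 : 0 ≤ (i : ℝ) * τ k := by positivity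
  have hs := hsrc _ ⟨hi0, hij'.trans hj⟩ _ ⟨hi0.trans hij', hj⟩ (by
    rw [abs_of_nonneg (by linarith)]; exact hd.trans (min_le_left _ _))
  have key := integral_abs_sub_le_of_mollify hρ (h.bddIntegrable hu hg k j)
    (h.bddIntegrable hu hg k i) (htr k j) (htr k i) (hR k j hj) (hR k i (hij'.trans hj))
    (fun x _ => h.abs_mollify_sub_le hu hg hρS hB k hij x)
  refine key.trans ?_
  rw [← hv, ← hDdef]
  have b1 : (j * τ k - i * τ k) * D * v ≤ ε / 8 := by
    calc (j * τ k - i * τ k) * D * v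
        ≤ ε / (8 * ((D + 1) * (v + 1))) * (D + 1) * (v + 1) := by
          have := hd.trans (min_le_right _ _)
          gcongr <;> linarith
      _ = ε / 8 := by field_simp
  have b2 : B * (∫ t in (i * τ k)..(j * τ k), ∫ y, |g (y, t)|) * v ≤ ε / 8 := by
    calc B * (∫ t in (i * τ k)..(j * τ k), ∫ y, |g (y, t)|) * v
        ≤ (B + 1) * (ε / (8 * ((B + 1) * (v + 1)))) * (v + 1) := by
          have h0 : 0 ≤ ∫ t in (i * τ k)..(j * τ k), ∫ y, |g (y, t)| :=
            intervalIntegral.integral_nonneg hij' fun t _ => integral_nonneg fun _ => abs_nonneg _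
          gcongr <;> linarith
      _ = ε / 8 := by field_simp
  rw [add_mul]
  linarith

/-- Compactness: a subsequence converges uniformly in time with values in `L¹` to a jointly
measurable bounded function. -/
theorem exists_limit (h : IsSchemeFamily κ β C T ν φ τ) (hu : BddIntegrable u₀)
    (hg : IsRegularSource b g) {M : ℝ} (hM : ∀ x, |u₀ x| ≤ M) :
    ∃ u : E N × ℝ → ℝ, Measurable u ∧ (∀ p, |u p| ≤ M + ∫ t, b t) ∧
      (∀ t ∈ Icc 0 T, Integrable fun x => u (x, t)) ∧
      (∀ t ∈ Icc 0 T, Tendsto (fun s => ∫ x, |u (x, s) - u (x, t)|) (𝓝[Icc 0 T] t) (𝓝 0)) ∧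
      ∃ θ : ℕ → ℕ, StrictMono θ ∧ ∀ i, ∀ t ∈ Icc 0 T,
        ∫ x, |approx ν φ τ u₀ g (θ i) ⌊t / τ (θ i)⌋₊ x - u (x, t)| ≤ (1 / 2 : ℝ) ^ i := by
  have hBI := h.bddIntegrable hu hg
  set 𝓕 : Set (E N → ℝ) := {f | ∃ k, ∃ j : ℕ, j * τ k ≤ T ∧ f = approx ν φ τ u₀ g k j}
  have hF : ∀ f ∈ 𝓕, BddIntegrable f := by
    rintro _ ⟨k, j, -, rfl⟩; exact hBI k j
  have htb := totallyBounded_toL1 hF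
    (A := (∫ x, |u₀ x|) + ∫ p, |g p|)
    (by rintro _ ⟨k, j, -, rfl⟩; exact h.integral_abs_approx_le hu hg k j)
    (fun ε hε => by
      obtain ⟨R, hR⟩ := h.exists_tail_le hu hg hε
      exact ⟨R, by rintro _ ⟨k, j, hj, rfl⟩; exact hR k j hj⟩)
    (fun ε hε => by
      obtain ⟨δ, hδ, h'⟩ := h.exists_translate_le hu hg hε
      exact ⟨δ, hδ, by rintro _ ⟨k, j, -, rfl⟩; exact h' k j⟩)
  have hfloor : ∀ k, ∀ t ∈ Icc 0 T, (⌊t / τ k⌋₊ : ℝ) * τ k ≤ t := fun k t ht => by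
    have := Nat.floor_le (div_nonneg ht.1 (h.step_pos k).le)
    rwa [le_div_iff₀ (h.step_pos k)] at this
  have hfloor' : ∀ k t, t < (⌊t / τ k⌋₊ : ℝ) * τ k + τ k := fun k t => by
    have := Nat.lt_floor_add_one (t / τ k)
    rw [div_lt_iff₀ (h.step_pos k)] at this
    linarith
  obtain ⟨f, hf, θ, hθ, hconv⟩ := exists_subseq_uniform_limit (X := E N →₁[volume] ℝ)
    (htb.closure.isCompact_of_isClosed isClosed_closure) (T := T)
    (fun k t => (hBI k ⌊t / τ k⌋₊).integrable.toL1 _)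
    (fun k t ht => subset_closure
      ⟨_, ⟨k, ⌊t / τ k⌋₊, (hfloor k t ht).trans ht.2, rfl⟩, rfl⟩)
    (fun ε hε => by
      -- Rounding down to the grid can enlarge a time gap by up to `τ k`. The piecewise constant
      -- curves are therefore equicontinuous only asymptotically, once `τ k ≤ δ / 2`.
      obtain ⟨δ, hδ, h'⟩ := h.exists_time_le hu hg hε
      obtain ⟨k₀, hk₀⟩ := eventually_atTop.1
        (h.step_tendsto.eventually (ge_mem_nhds (half_pos hδ)))
      have mono : ∀ k ≥ k₀, ∀ s ∈ Icc 0 T, ∀ t ∈ Icc 0 T, |s - t| ≤ δ / 2 → s ≤ t →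
          ∫ x, |approx ν φ τ u₀ g k ⌊t / τ k⌋₊ x - approx ν φ τ u₀ g k ⌊s / τ k⌋₊ x| ≤ ε := by
        intro k hk s hs t ht hst hle
        refine h' k _ _ (Nat.floor_mono (div_le_div_of_nonneg_right hle (h.step_pos k).le))
          ((hfloor k t ht).trans ht.2) ?_
        have := hk₀ k hk
        have := hfloor k t ht
        have := hfloor' k s
        rw [abs_le] at hst
        linarith
      refine ⟨δ / 2, half_pos hδ, k₀, fun k hk s hs t ht hst => ?_⟩
      rcases le_total s t with hle | hle
      · rw [dist_comm, norm_toL1_sub (hBI _ _) (hBI _ _)]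
        exact mono k hk s hs t ht hst hle
      · rw [norm_toL1_sub (hBI _ _) (hBI _ _)]
        exact mono k hk t ht s hs (by rwa [abs_sub_comm]) hle)
  have hbd : ∀ k j x, |approx ν φ τ u₀ g k j x| ≤ M + ∫ t, b t := h.abs_approx_le hu hg hM
  -- The limit curve `f` consists of equivalence classes. The pointwise limsup selects a jointly
  -- measurable representative that is bounded everywhere and agrees with `f t` almost everywhere
  -- for each `t`.
  set u : E N × ℝ → ℝ := fun p =>
    limsup (fun i => approx ν φ τ u₀ g (θ i) ⌊p.2 / τ (θ i)⌋₊ p.1) atTop with hu_def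
  have hum : Measurable u := by
    refine Measurable.limsup fun i => ?_
    have h1 : Measurable fun q : E N × ℕ => approx ν φ τ u₀ g (θ i) q.2 q.1 :=
      measurable_from_prod_countable_left fun j => (hBI (θ i) j).measurable
    exact h1.comp (measurable_fst.prodMk
      (Nat.measurable_floor.comp (measurable_snd.div_const (τ (θ i)))))
  have hae : ∀ t ∈ Icc 0 T, (fun x => u (x, t)) =ᵐ[volume] f t := fun t ht => by
    have := ae_tendsto_of_integral_abs_sub_le
      (f := fun i => approx ν φ τ u₀ g (θ i) ⌊t / τ (θ i)⌋₊) (u := f t)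
      (fun i => (hBI _ _).integrable) (L1.integrable_coeFn (f t)) fun i => by
        have := hconv i t ht
        rw [dist_eq_norm, L1.norm_eq_integral_norm] at this
        refine le_trans (le_of_eq (integral_congr_ae ?_)) this
        filter_upwards [Lp.coeFn_sub ((hBI (θ i) ⌊t / τ (θ i)⌋₊).integrable.toL1 _) (f t),
          (hBI (θ i) ⌊t / τ (θ i)⌋₊).integrable.coeFn_toL1] with x hx hx'
        rw [hx, Pi.sub_apply, hx', Real.norm_eq_abs]
    filter_upwards [this] with x hx
    exact hx.limsup_eq
  have hint : ∀ t ∈ Icc 0 T, Integrable fun x => u (x, t) := fun t ht =>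
    (L1.integrable_coeFn (f t)).congr (hae t ht).symm
  refine ⟨u, hum, fun p => ?_, hint, fun t ht => ?_, θ, hθ, fun i t ht => ?_⟩
  · have hb1 : ∀ i, approx ν φ τ u₀ g (θ i) ⌊p.2 / τ (θ i)⌋₊ p.1 ≤ M + ∫ t, b t :=
      fun i => le_of_abs_le (hbd _ _ _)
    have hb2 : ∀ i, -(M + ∫ t, b t) ≤ approx ν φ τ u₀ g (θ i) ⌊p.2 / τ (θ i)⌋₊ p.1 :=
      fun i => neg_le_of_abs_le (hbd _ _ _)
    rw [abs_le]
    refine ⟨le_limsup_of_frequently_le (Eventually.of_forall hb2).frequently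
      (isBoundedUnder_of ⟨_, hb1⟩), limsup_le_of_le ?_ (Eventually.of_forall hb1)⟩
    exact (isBoundedUnder_of ⟨_, hb2⟩ : IsBoundedUnder (· ≥ ·) atTop _).isCoboundedUnder_le
  · have hlim : Tendsto (fun s => dist (f s) (f t)) (𝓝[Icc 0 T] t) (𝓝 0) :=
      tendsto_iff_dist_tendsto_zero.1 (hf t ht)
    refine hlim.congr' ?_
    filter_upwards [self_mem_nhdsWithin] with s hs
    rw [dist_eq_norm, L1.norm_eq_integral_norm]
    refine integral_congr_ae ?_
    filter_upwards [Lp.coeFn_sub (f s) (f t), hae s hs, hae t ht] with x h1 h2 h3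
    rw [h1, Pi.sub_apply, h2, h3, Real.norm_eq_abs]
  · have := hconv i t ht
    rw [dist_eq_norm, L1.norm_eq_integral_norm] at this
    refine le_trans (le_of_eq (integral_congr_ae ?_)) this
    filter_upwards [Lp.coeFn_sub ((hBI (θ i) ⌊t / τ (θ i)⌋₊).integrable.toL1 _) (f t),
      (hBI (θ i) ⌊t / τ (θ i)⌋₊).integrable.coeFn_toL1, hae t ht] with x h1 h2 h3
    rw [h1, Pi.sub_apply, h2, h3, Real.norm_eq_abs]

end IsSchemeFamily

end GPME

end

/-! ### Test functions in space-time and continuity of the limit operator. -/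

noncomputable section

namespace GPME

variable {N : ℕ}

section TestFunction

variable {ψ : E N × ℝ → ℝ}

/-- The time derivative, as a function on space-time. -/
def timeDeriv (ψ : E N × ℝ → ℝ) (p : E N × ℝ) : ℝ := fderiv ℝ ψ p (0, 1)

theorem contDiff_timeDeriv (hψ : ContDiff ℝ ((⊤ : ℕ∞) : WithTop ℕ∞) ψ) :
    ContDiff ℝ ((⊤ : ℕ∞) : WithTop ℕ∞) (timeDeriv ψ) :=
  (hψ.fderiv_right (m := ((⊤ : ℕ∞) : WithTop ℕ∞)) (by simp)).clm_apply contDiff_const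

theorem hasCompactSupport_timeDeriv (hc : HasCompactSupport ψ) :
    HasCompactSupport (timeDeriv ψ) :=
  hc.fderiv_apply ℝ _

theorem hasDerivAt_time (hψ : ContDiff ℝ ((⊤ : ℕ∞) : WithTop ℕ∞) ψ) (x : E N) (t : ℝ) :
    HasDerivAt (fun s => ψ (x, s)) (timeDeriv ψ (x, t)) t := by
  have h1 : HasFDerivAt ψ (fderiv ℝ ψ (x, t)) (x, t) :=
    (hψ.differentiable (by simp)).differentiableAt.hasFDerivAt
  exact h1.comp_hasDerivAt t ((hasDerivAt_const t x).prodMk (hasDerivAt_id t))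

theorem exists_slice_bounds (hψ : ContDiff ℝ ((⊤ : ℕ∞) : WithTop ℕ∞) ψ)
    (hc : HasCompactSupport ψ) :
    ∃ K r, 0 ≤ K ∧ (∀ p, |ψ p| ≤ K) ∧
      (∀ t z x, |secondDiff (fun y => ψ (y, t)) z x| ≤ K * ‖z‖ ^ 2) ∧
      ∀ x t, r < ‖x‖ → ψ (x, t) = 0 := by
  obtain ⟨K₁, hK₁, h₁⟩ := exists_symm_diff_bound hψ hc
  obtain ⟨K₂, h₂⟩ := hc.exists_bound_of_continuous hψ.continuous
  obtain ⟨r, hr⟩ := hc.isCompact.isBounded.subset_closedBall (0 : E N × ℝ)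
  refine ⟨max K₁ K₂, r, hK₁.trans (le_max_left _ _), fun p => (h₂ p).trans (le_max_right _ _),
    fun t z x => ?_, fun x t hx => image_eq_zero_of_notMem_tsupport fun h => ?_⟩
  · have := h₁ (x, t) (z, 0)
    simp only [Prod.mk_add_mk, Prod.mk_sub_mk, add_zero, sub_zero, Prod.norm_mk, norm_zero,
      max_eq_left (norm_nonneg z)] at this
    exact this.trans (mul_le_mul_of_nonneg_right (le_max_left _ _) (by positivity))
  · have := hr h
    rw [mem_closedBall_zero_iff, Prod.norm_mk, max_le_iff] at this
    linarith [this.1]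

theorem hasCompactSupport_slice (hc : HasCompactSupport ψ) (t : ℝ) :
    HasCompactSupport fun x => ψ (x, t) :=
  HasCompactSupport.intro (hc.isCompact.image continuous_fst) fun _ hx =>
    image_eq_zero_of_notMem_tsupport fun h => hx ⟨_, h, rfl⟩

theorem bddIntegrable_slice (hψ : ContDiff ℝ ((⊤ : ℕ∞) : WithTop ℕ∞) ψ)
    (hc : HasCompactSupport ψ) (t : ℝ) : BddIntegrable fun x => ψ (x, t) := by
  refine bddIntegrable_of_continuous (hψ.continuous.comp (by fun_prop)) ?_
  exact hasCompactSupport_slice hc t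

theorem contDiff_slice (hψ : ContDiff ℝ ((⊤ : ℕ∞) : WithTop ℕ∞) ψ) (t : ℝ) :
    ContDiff ℝ ((⊤ : ℕ∞) : WithTop ℕ∞) fun x => ψ (x, t) :=
  hψ.comp (contDiff_id.prodMk contDiff_const)

/-- Second difference bounds of a test function, uniform in time and Lipschitz in time. -/
theorem exists_uniform_secondDiffBound (hψ : ContDiff ℝ ((⊤ : ℕ∞) : WithTop ℕ∞) ψ)
    (hc : HasCompactSupport ψ) :
    ∃ K S, 0 ≤ K ∧ 0 ≤ S ∧ (∀ t, HasSecondDiffBound K S fun x => ψ (x, t)) ∧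
      (∀ s t, HasSecondDiffBound (K * |t - s|) (S * |t - s|) fun x => ψ (x, t) - ψ (x, s)) ∧
      (∀ p, |ψ p| ≤ K) ∧ ∀ s t x, |ψ (x, t) - ψ (x, s)| ≤ K * |t - s| := by
  obtain ⟨A, r, hA0, hA, hA2, hr⟩ := exists_slice_bounds hψ hc
  obtain ⟨B, -, hB0, hB, hB2, -⟩ :=
    exists_slice_bounds (contDiff_timeDeriv hψ) (hasCompactSupport_timeDeriv hc)
  set M := max A B
  have hM0 : 0 ≤ M := hA0.trans (le_max_left _ _)
  have lip : ∀ s t x, |ψ (x, t) - ψ (x, s)| ≤ M * |t - s| := fun s t x =>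
    convex_univ.norm_image_sub_le_of_norm_hasDerivWithin_le
      (fun t _ => (hasDerivAt_time hψ x t).hasDerivWithinAt)
      (fun t _ => (hB (x, t)).trans (le_max_right _ _)) (mem_univ s) (mem_univ t)
  -- The time derivative of a spatial second difference of `ψ` is the same second difference of
  -- `timeDeriv ψ`, so the mean value inequality in `t` keeps the factor `‖z‖ ^ 2`.
  have lip2 : ∀ s t z x, |secondDiff (fun y => ψ (y, t) - ψ (y, s)) z x|
      ≤ M * |t - s| * ‖z‖ ^ 2 := fun s t z x => by
    have := convex_univ.norm_image_sub_le_of_norm_hasDerivWithin_le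
      (f := fun t => secondDiff (fun y => ψ (y, t)) z x)
      (f' := fun t => secondDiff (fun y => timeDeriv ψ (y, t)) z x) (C := M * ‖z‖ ^ 2)
      (fun t _ => (((hasDerivAt_time hψ (x + z) t).add (hasDerivAt_time hψ (x - z) t)).sub
        ((hasDerivAt_time hψ x t).const_mul 2)).hasDerivWithinAt)
      (fun t _ => (hB2 t z x).trans
        (mul_le_mul_of_nonneg_right (le_max_right _ _) (by positivity))) (mem_univ s) (mem_univ t)
    have e : secondDiff (fun y => ψ (y, t) - ψ (y, s)) z x
      = secondDiff (fun y => ψ (y, t)) z x - secondDiff (fun y => ψ (y, s)) z x := by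
      simp only [secondDiff]; ring
    rw [e]
    calc _ ≤ _ := this
      _ = _ := by rw [Real.norm_eq_abs]; ring
  set v := volume.real (Metric.closedBall (0 : E N) (r + 1))
  have hv : 0 ≤ v := measureReal_nonneg
  refine ⟨4 * M, 4 * M * v, by positivity, by positivity, fun t => ?_, fun s t => ?_, fun p => ?_,
    fun s t x => ?_⟩
  · exact .of_support (bddIntegrable_slice hψ hc t) (fun x => (hA _).trans (le_max_left _ _))
      (fun z x => (hA2 t z x).trans
        (mul_le_mul_of_nonneg_right (le_max_left _ _) (by positivity))) (fun x hx => hr x t hx)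
  · have := HasSecondDiffBound.of_support
      ((bddIntegrable_slice hψ hc t).sub (bddIntegrable_slice hψ hc s)) (lip s t) (lip2 s t)
      (r := r) (fun x hx => by rw [hr x t hx, hr x s hx, sub_zero])
    convert this using 1 <;> ring
  · linarith [(hA p).trans (le_max_left A B)]
  · have : 0 ≤ M * |t - s| := by positivity
    linarith [lip s t x]

end TestFunction

section Levy

variable {μ : Measure (E N)} {ψ : E N × ℝ → ℝ}

theorem fderiv_slice (hψ : ContDiff ℝ ((⊤ : ℕ∞) : WithTop ℕ∞) ψ) (x z : E N) (t : ℝ) :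
    fderiv ℝ (fun y => ψ (y, t)) x z = fderiv ℝ ψ (x, t) (z, 0) := by
  have h1 : HasFDerivAt ψ (fderiv ℝ ψ (x, t)) (x, t) :=
    (hψ.differentiable (by simp)).differentiableAt.hasFDerivAt
  have h2 : HasFDerivAt (fun y : E N => (y, t)) (ContinuousLinearMap.inl ℝ (E N) ℝ) x :=
    hasFDerivAt_prodMk_left x t
  have := (h1.comp x h2).fderiv
  change fderiv ℝ (ψ ∘ fun y => (y, t)) x z = _
  rw [this]
  rfl

/-- Dominated convergence: the integrand is at most `K‖z‖²` on the unit ball, by the space-time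
Taylor bound in the direction `(z, 0)`, and at most `2M` outside. Joint continuity in `(x, t)`
supplies the measurability needed later. -/
theorem continuous_levyOp (hμ : IsSymmetricLevy μ) (hψ : ContDiff ℝ ((⊤ : ℕ∞) : WithTop ℕ∞) ψ)
    (hc : HasCompactSupport ψ) :
    Continuous fun p : E N × ℝ => levyOp μ (fun y => ψ (y, p.2)) p.1 := by
  obtain ⟨K, hK0, hK⟩ := exists_taylor_bound hψ hc
  obtain ⟨M, hM⟩ := hc.exists_bound_of_continuous hψ.continuous
  have hM0 : 0 ≤ M := (norm_nonneg _).trans (hM 0)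
  set A : Set (E N) := {z | 0 < ‖z‖ ∧ ‖z‖ ≤ 1}
  set B : Set (E N) := {z | 1 < ‖z‖}
  have hA : MeasurableSet A :=
    (measurableSet_lt measurable_const measurable_norm).inter
      (measurableSet_le measurable_norm measurable_const)
  have hB : MeasurableSet B := measurableSet_lt measurable_const measurable_norm
  have hball : MeasurableSet {y : E N | ‖y‖ ≤ 1} :=
    measurableSet_le measurable_norm measurable_const
  have hlt := hμ.lintegral_lt_top
  rw [ENNReal.add_lt_top] at hlt
  have iA : IntegrableOn (fun z : E N => K * ‖z‖ ^ 2) A μ := by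
    refine Integrable.const_mul ⟨by fun_prop, ?_⟩ K
    rw [hasFiniteIntegral_iff_ofReal (Eventually.of_forall fun z => by positivity)]
    exact hlt.1
  have iB : IntegrableOn (fun _ : E N => 2 * M) B μ := integrableOn_const hlt.2.ne
  have hunion : ({0}ᶜ : Set (E N)) ⊆ A ∪ B := fun z hz => by
    have : 0 < ‖z‖ := norm_pos_iff.2 hz
    rcases le_or_gt ‖z‖ 1 with h | h
    · exact Or.inl ⟨this, h⟩
    · exact Or.inr h
  have ibound : IntegrableOn (fun z : E N => A.indicator (fun z => K * ‖z‖ ^ 2) z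
      + B.indicator (fun _ => 2 * M) z) {0}ᶜ μ :=
    ((integrable_indicator_iff hA).2 iA |>.add ((integrable_indicator_iff hB).2 iB)).integrableOn
  unfold levyOp
  refine continuous_of_dominated (fun p => ?_) (fun p => ?_) ibound ?_
  · have : Measurable fun z => ψ (p.1 + z, p.2) - ψ (p.1, p.2)
        - {y : E N | ‖y‖ ≤ 1}.indicator (fun y => fderiv ℝ (fun y => ψ (y, p.2)) p.1 y) z := by
      refine Measurable.sub (Measurable.sub_const ?_ _) ?_
      · exact hψ.continuous.measurable.comp
          ((measurable_id.const_add p.1).prodMk measurable_const)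
      · exact (fderiv ℝ (fun y => ψ (y, p.2)) p.1).continuous.measurable.indicator hball
    exact this.aestronglyMeasurable
  · refine (ae_restrict_mem (measurableSet_singleton (0 : E N)).compl).mono fun z hz => ?_
    rw [Real.norm_eq_abs]
    rcases hunion hz with h | h
    · have h' : z ∉ B := fun hb => not_lt.2 h.2 hb
      rw [indicator_of_mem (show z ∈ {y : E N | ‖y‖ ≤ 1} from h.2), indicator_of_mem h,
        indicator_of_notMem h', add_zero, fderiv_slice hψ]
      have := hK p (z, 0)
      simpa [Prod.norm_mk, Prod.add_def] using this
    · have h' : z ∉ A := fun ha => not_lt.2 ha.2 h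
      rw [indicator_of_notMem (show z ∉ {y : E N | ‖y‖ ≤ 1} from fun h' => not_le.2 h (show ‖z‖ ≤ 1 from h')),
        indicator_of_notMem h', indicator_of_mem h, zero_add, sub_zero]
      have a := hM (p.1 + z, p.2)
      have b := hM (p.1, p.2)
      rw [Real.norm_eq_abs] at a b
      exact (abs_sub _ _).trans (by linarith)
  · refine Eventually.of_forall fun z => ?_
    by_cases hz : ‖z‖ ≤ 1
    · simp only [indicator_of_mem (show z ∈ {y : E N | ‖y‖ ≤ 1} from hz), fderiv_slice hψ]
      have h1 : Continuous (fderiv ℝ ψ) := hψ.continuous_fderiv (by simp)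
      have h2 := hψ.continuous
      fun_prop
    · simp only [indicator_of_notMem (show z ∉ {y : E N | ‖y‖ ≤ 1} from hz)]
      have h2 := hψ.continuous
      fun_prop

/-- Second derivatives of a slice are second derivatives of `ψ` in the directions `(v, 0)`, hence
continuous jointly in space and time. -/
theorem continuous_laplacian_slice (hψ : ContDiff ℝ ((⊤ : ℕ∞) : WithTop ℕ∞) ψ) :
    Continuous fun p : E N × ℝ => Laplacian.laplacian (fun y => ψ (y, p.2)) p.1 := by
  have e : ∀ (p : E N × ℝ) (v : E N), iteratedFDeriv ℝ 2 (fun y => ψ (y, p.2)) p.1 ![v, v]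
      = iteratedFDeriv ℝ 2 ψ p ![(v, 0), (v, 0)] := by
    intro p v
    have h1 : (fun y => ψ (y, p.2)) = (fun q => ψ (q + (0, p.2))) ∘
        (ContinuousLinearMap.inl ℝ (E N) ℝ) := by
      funext y; simp
    have h2 : ContDiff ℝ 2 fun q => ψ (q + (0, p.2)) :=
      (hψ.of_le (by norm_cast)).comp (contDiff_id.add contDiff_const)
    rw [h1, ContinuousLinearMap.iteratedFDeriv_comp_right _ h2 _ le_rfl,
      ContinuousMultilinearMap.compContinuousLinearMap_apply, iteratedFDeriv_comp_add_right]
    congr 1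
    · simp
    · funext i
      fin_cases i <;> rfl
  simp_rw [InnerProductSpace.laplacian_eq_iteratedFDeriv_stdOrthonormalBasis, e]
  refine continuous_finsetSum _ fun i _ => ?_
  have h3 : Continuous (iteratedFDeriv ℝ 2 ψ) := hψ.continuous_iteratedFDeriv (by norm_cast)
  exact (ContinuousMultilinearMap.apply ℝ (fun _ : Fin 2 => E N × ℝ) ℝ
    ![(stdOrthonormalBasis ℝ (E N) i, 0), (stdOrthonormalBasis ℝ (E N) i, 0)]).continuous.comp h3

theorem continuous_diffusionOp (c : ℝ) (hμ : IsSymmetricLevy μ)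
    (hψ : ContDiff ℝ ((⊤ : ℕ∞) : WithTop ℕ∞) ψ) (hc : HasCompactSupport ψ) :
    Continuous fun p : E N × ℝ => diffusionOp c μ (fun y => ψ (y, p.2)) p.1 :=
  ((continuous_laplacian_slice hψ).const_mul c).add (continuous_levyOp hμ hψ hc)

end Levy

end GPME

end

/-! ### The discrete very weak formulation. -/

noncomputable section

namespace GPME

variable {N : ℕ}

theorem restrict_QT (T : ℝ) : (volume : Measure (E N × ℝ)).restrict (QT N T)
    = (volume : Measure (E N)).prod (volume.restrict (Ioo 0 T)) := by
  rw [QT, Measure.volume_eq_prod, ← Measure.prod_restrict, Measure.restrict_univ]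

theorem integrable_QT_of_slice {F : E N × ℝ → ℝ} (hF : Measurable F) {T A : ℝ} (hT : 0 ≤ T)
    (hi : ∀ t ∈ Ioo 0 T, Integrable fun x => F (x, t))
    (hA : ∀ t ∈ Ioo 0 T, ∫ x, |F (x, t)| ≤ A) :
    IntegrableOn F (QT N T) ∧ ∫ p in QT N T, |F p| ≤ A * T := by
  have hI : IntegrableOn F (QT N T) := by
    rw [IntegrableOn, restrict_QT, integrable_prod_iff' hF.aestronglyMeasurable]
    refine ⟨(ae_restrict_mem measurableSet_Ioo).mono hi, ?_⟩
    refine Integrable.mono' (integrable_const A)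
      (hF.norm.stronglyMeasurable.integral_prod_left (μ := volume)).aestronglyMeasurable
      ((ae_restrict_mem measurableSet_Ioo).mono fun t ht => ?_)
    rw [Real.norm_eq_abs, abs_of_nonneg (integral_nonneg fun _ => norm_nonneg _)]
    exact hA t ht
  refine ⟨hI, ?_⟩
  rw [IntegrableOn, restrict_QT] at hI
  rw [restrict_QT, integral_prod_symm _ hI.abs]
  refine (integral_mono_ae hI.abs.integral_prod_right (integrable_const A)
    ((ae_restrict_mem measurableSet_Ioo).mono hA)).trans (le_of_eq ?_)
  simp [hT, mul_comm]

theorem measurable_stepFun {W : ℕ → E N → ℝ} (hW : ∀ j, Measurable (W j)) (τ : ℝ) :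
    Measurable fun p : E N × ℝ => W ⌊p.2 / τ⌋₊ p.1 := by
  have h1 : Measurable fun q : E N × ℕ => W q.2 q.1 := measurable_from_prod_countable_left hW
  exact h1.comp (measurable_fst.prodMk
    (Nat.measurable_floor.comp (measurable_snd.div_const τ)))

theorem IsRegularSource.integrable_time {b : ℝ → ℝ} {g : E N × ℝ → ℝ} (hg : IsRegularSource b g)
    (x : E N) : Integrable fun t => g (x, t) :=
  hg.integrable_bound.mono' (hg.measurable.comp measurable_prodMk_left).aestronglyMeasurable
    (Eventually.of_forall fun t => hg.abs_le x t)

/-- Within one step everything but the source and `timeDeriv ψ` is frozen, so Fubini and the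
fundamental theorem of calculus evaluate the time integral exactly. -/
theorem integral_time_step {b : ℝ → ℝ} {g ψ : E N × ℝ → ℝ} (hg : IsRegularSource b g)
    (hψ : ContDiff ℝ ((⊤ : ℕ∞) : WithTop ℕ∞) ψ) (hc : HasCompactSupport ψ)
    {U V χ : E N → ℝ} (hU : BddIntegrable U) (hV : Integrable V) (hχ : BddIntegrable χ)
    {s t : ℝ} (hst : s ≤ t) :
    ∫ r in s..t, (∫ x, (U x * timeDeriv ψ (x, r) + V x + g (x, r) * χ x))
      = ∫ x, (U x * (ψ (x, t) - ψ (x, s)) + (t - s) * V x + (∫ r in s..t, g (x, r)) * χ x) := by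
  obtain ⟨D, hD⟩ := (hasCompactSupport_timeDeriv hc).exists_bound_of_continuous
    (contDiff_timeDeriv hψ).continuous
  obtain ⟨X, hX⟩ := hχ.bounded
  have hψc := (contDiff_timeDeriv hψ).continuous
  have i1 : Integrable (fun p : E N × ℝ => U p.1 * timeDeriv ψ p)
      (volume.prod (volume.restrict (Ioc s t))) :=
    (hU.integrable.comp_fst _).mul_bdd hψc.aestronglyMeasurable (Eventually.of_forall hD)
  have i2 : Integrable (fun p : E N × ℝ => V p.1) (volume.prod (volume.restrict (Ioc s t))) :=
    hV.comp_fst _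
  have i3 : Integrable (fun p : E N × ℝ => g p * χ p.1)
      (volume.prod (volume.restrict (Ioc s t))) :=
    (integrable_restrict_time hg.integrable _).mul_bdd
      (hχ.measurable.comp measurable_fst).aestronglyMeasurable
      (Eventually.of_forall fun p => hX p.1)
  rw [intervalIntegral.integral_of_le hst,
    ← integral_integral_swap (f := fun x r => U x * timeDeriv ψ (x, r) + V x + g (x, r) * χ x)
      ((i1.add i2).add i3)]
  congr 1
  funext x
  rw [← intervalIntegral.integral_of_le hst]
  have c1 : Continuous fun r => timeDeriv ψ (x, r) := hψc.comp (by fun_prop)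
  have j1 : IntervalIntegrable (fun r => U x * timeDeriv ψ (x, r)) volume s t :=
    (c1.const_mul _).intervalIntegrable _ _
  have j2 : IntervalIntegrable (fun _ : ℝ => V x) volume s t := intervalIntegrable_const
  have j3 : IntervalIntegrable (fun r => g (x, r) * χ x) volume s t :=
    ((hg.integrable_time x).mul_const _).intervalIntegrable
  rw [intervalIntegral.integral_add (j1.add j2) j3, intervalIntegral.integral_add j1 j2,
    intervalIntegral.integral_const_mul, intervalIntegral.integral_mul_const,
    intervalIntegral.integral_eq_sub_of_hasDerivAt (fun r _ => hasDerivAt_time hψ x r)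
      (c1.intervalIntegrable _ _)]
  simp

/-- The integrand of the discrete weak formulation. -/
def discreteIntegrand (ν : Measure (E N)) (φ : ℝ → ℝ) (τ : ℝ) (U : ℕ → E N → ℝ)
    (g ψ : E N × ℝ → ℝ) (p : E N × ℝ) : ℝ :=
  U ⌊p.2 / τ⌋₊ p.1 * timeDeriv ψ p
    + φ (U ⌊p.2 / τ⌋₊ p.1) * jumpOp ν (fun y => ψ (y, (⌊p.2 / τ⌋₊ + 1 : ℕ) * τ)) p.1
    + g p * ψ (p.1, (⌊p.2 / τ⌋₊ + 1 : ℕ) * τ)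

namespace IsSchemeFamily

variable {κ β C T : ℝ} {ν : ℕ → Measure (E N)} {φ : ℕ → ℝ → ℝ} {τ : ℕ → ℝ} {u₀ : E N → ℝ}
  {b : ℝ → ℝ} {g ψ : E N × ℝ → ℝ}

theorem integrable_discreteIntegrand (h : IsSchemeFamily κ β C T ν φ τ) (hu : BddIntegrable u₀)
    (hg : IsRegularSource b g) (hψ : ContDiff ℝ ((⊤ : ℕ∞) : WithTop ℕ∞) ψ)
    (hc : HasCompactSupport ψ) (k : ℕ) :
    IntegrableOn (discreteIntegrand (ν k) (φ k) (τ k) (approx ν φ τ u₀ g k) g ψ) (QT N T) := by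
  have := h.finite k
  have := h.symm k
  obtain ⟨D, hD⟩ := (hasCompactSupport_timeDeriv hc).exists_bound_of_continuous
    (contDiff_timeDeriv hψ).continuous
  have hψc := (contDiff_timeDeriv hψ).continuous
  obtain ⟨K, S, hK0, hS0, hslice, -, hK, -⟩ := exists_uniform_secondDiffBound hψ hc
  have hU := h.bddIntegrable hu hg k
  have hφU := fun j => (h.stable k).bddIntegrable (hU j)
  have hχ := fun t => bddIntegrable_slice hψ hc t
  refine Integrable.add (Integrable.add ?_ ?_) ?_
  · have := (integrable_QT_of_slice (measurable_stepFun (fun j => (hU j).measurable) (τ k))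
      h.time_pos.le (fun t _ => (hU ⌊t / τ k⌋₊).integrable)
      (fun t _ => h.integral_abs_approx_le hu hg k ⌊t / τ k⌋₊)).1
    exact this.mul_bdd hψc.aestronglyMeasurable (Eventually.of_forall hD)
  · have hJm := fun t => measurable_jumpOp (ν k) (hχ t).measurable
    refine (integrable_QT_of_slice (A := C * (S * truncMoment (ν k) 1 / 2))
      (measurable_stepFun (W := fun j x => φ k (approx ν φ τ u₀ g k j x)
        * jumpOp (ν k) (fun y => ψ (y, (j + 1 : ℕ) * τ k)) x)
        (fun j => (hφU j).measurable.mul (hJm _)) (τ k)) h.time_pos.le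
      (fun t _ => ?_) (fun t _ => ?_)).1
    · exact (hφU ⌊t / τ k⌋₊).mul_bdd (hJm ((⌊t / τ k⌋₊ + 1 : ℕ) * τ k))
        ((hslice ((⌊t / τ k⌋₊ + 1 : ℕ) * τ k)).abs_jumpOp_le (ν k))
    · have hJ := ((hχ ((⌊t / τ k⌋₊ + 1 : ℕ) * τ k)).jumpOp (ν k)).integrable.abs
      refine (integral_mono_of_nonneg (Eventually.of_forall fun _ => abs_nonneg _)
        (hJ.const_mul C) (Eventually.of_forall fun x => ?_)).trans ?_
      · dsimp only
        rw [abs_mul]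
        exact mul_le_mul_of_nonneg_right (h.bounded k _) (abs_nonneg _)
      · rw [integral_const_mul]
        exact mul_le_mul_of_nonneg_left ((hslice _).integral_abs_jumpOp_le (ν k)) h.const_nonneg
  · refine hg.integrable.integrableOn.mul_bdd (c := K) ?_ (Eventually.of_forall fun p => hK _)
    exact (measurable_stepFun (W := fun j x => ψ (x, (j + 1 : ℕ) * τ k))
      (fun j => (hχ _).measurable) (τ k)).aestronglyMeasurable

/-- The discrete very weak formulation. -/
theorem discrete_weak_eq (h : IsSchemeFamily κ β C T ν φ τ) (hu : BddIntegrable u₀)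
    (hg : IsRegularSource b g) (hψ : ContDiff ℝ ((⊤ : ℕ∞) : WithTop ℕ∞) ψ)
    (hc : HasCompactSupport ψ) (hψT : ∀ x, ψ (x, T) = 0) (k : ℕ) {n : ℕ} (hn : n * τ k = T) :
    (∫ p in QT N T, discreteIntegrand (ν k) (φ k) (τ k) (approx ν φ τ u₀ g k) g ψ p)
      + ∫ x, u₀ x * ψ (x, 0) = 0 := by
  have := h.finite k
  have := h.symm k
  have hτ := h.step_pos k
  have hU := h.bddIntegrable hu hg k
  have hφU := fun j => (h.stable k).bddIntegrable (hU j)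
  have hχ := fun t => bddIntegrable_slice hψ hc t
  have hI := h.integrable_discreteIntegrand hu hg hψ hc k
  set F := discreteIntegrand (ν k) (φ k) (τ k) (approx ν φ τ u₀ g k) g ψ with hF
  set U := approx ν φ τ u₀ g k with hUdef
  rw [IntegrableOn, restrict_QT] at hI
  have hH : IntervalIntegrable (fun t => ∫ x, F (x, t)) volume 0 T := by
    rw [intervalIntegrable_iff_integrableOn_Ioo_of_le h.time_pos.le]
    exact hI.integral_prod_right
  have hsub : ∀ j < n, IntervalIntegrable (fun t => ∫ x, F (x, t)) volume
      (j * τ k) ((j + 1 : ℕ) * τ k) := fun j hj => by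
    refine hH.mono_set ?_
    rw [uIcc_of_le (step_le hτ.le j.le_succ), uIcc_of_le h.time_pos.le, ← hn]
    exact Icc_subset_Icc (by positivity) (step_le hτ.le hj)
  -- Abel summation `U_{j+1}ψ_{j+1} - U_jψ_j = U_j(ψ_{j+1} - ψ_j) + (U_{j+1} - U_j)ψ_{j+1}`. This is
  -- why the operator and source terms use the test function at the end of the step, and makes the
  -- identity exact.
  have hstep : ∀ j : ℕ, ∫ t in (j * τ k)..((j + 1 : ℕ) * τ k), (∫ x, F (x, t))
      = (∫ x, U (j + 1) x * ψ (x, (j + 1 : ℕ) * τ k)) - ∫ x, U j x * ψ (x, j * τ k) := by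
    intro j
    obtain ⟨X, hX⟩ := (hχ ((j + 1 : ℕ) * τ k)).bounded
    obtain ⟨Y, hY⟩ := (hχ (j * τ k)).bounded
    have hχm := (hχ ((j + 1 : ℕ) * τ k)).measurable
    have hV : Integrable fun x => φ k (U j x) * jumpOp (ν k) (fun y => ψ (y, (j + 1 : ℕ) * τ k)) x :=
      (hφU j).mul_bdd (measurable_jumpOp _ hχm) (abs_jumpOp_le (ν k) hX)
    have hG := (hg.bddIntegrable hτ.le j).1
    have e1 : ∫ t in (j * τ k)..((j + 1 : ℕ) * τ k), (∫ x, F (x, t))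
        = ∫ t in (j * τ k)..((j + 1 : ℕ) * τ k), (∫ x, (U j x * timeDeriv ψ (x, t)
          + φ k (U j x) * jumpOp (ν k) (fun y => ψ (y, (j + 1 : ℕ) * τ k)) x
          + g (x, t) * ψ (x, (j + 1 : ℕ) * τ k))) := by
      rw [intervalIntegral.integral_of_le (step_le hτ.le j.le_succ),
        intervalIntegral.integral_of_le (step_le hτ.le j.le_succ),
        integral_Ioc_eq_integral_Ioo, integral_Ioc_eq_integral_Ioo]
      refine setIntegral_congr_fun measurableSet_Ioo fun t ht => ?_
      have hfl : ⌊t / τ k⌋₊ = j := by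
        have ht0 : 0 ≤ t / τ k := div_nonneg
          ((by positivity : (0 : ℝ) ≤ j * τ k).trans ht.1.le) hτ.le
        rw [Nat.floor_eq_iff ht0, le_div_iff₀ hτ, div_lt_iff₀ hτ]
        exact ⟨ht.1.le, by simpa using ht.2⟩
      simp only [hF, discreteIntegrand, hfl]
    rw [e1, integral_time_step hg hψ hc (hU j) hV (hχ _) (step_le hτ.le j.le_succ)]
    have i1 := (hU j).mul_bdd hχm hX
    have i2 := (hU j).mul_bdd (hχ (j * τ k)).measurable hY
    have i3 := (((hφU j).jumpOp (ν k)).mul_bdd hχm hX).const_mul (τ k)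
    have i4 := hG.mul_bdd hχm hX
    have e2 : ∫ x, U (j + 1) x * ψ (x, (j + 1 : ℕ) * τ k)
        = (∫ x, U j x * ψ (x, (j + 1 : ℕ) * τ k))
          + (τ k * (∫ x, φ k (U j x) * jumpOp (ν k) (fun y => ψ (y, (j + 1 : ℕ) * τ k)) x)
          + ∫ x, sourceIncr g (τ k) j x * ψ (x, (j + 1 : ℕ) * τ k)) := by
      rw [← integral_jumpOp_mul (ν k) (hφU j) hχm hX, ← integral_const_mul, ← integral_add i3 i4,
        ← integral_add (g := fun x => τ k * (jumpOp (ν k) (fun y => φ k (U j y)) x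
          * ψ (x, (j + 1 : ℕ) * τ k)) + sourceIncr g (τ k) j x * ψ (x, (j + 1 : ℕ) * τ k))
          i1 (i3.add i4)]
      congr 1
      funext x
      simp only [hUdef, approx, euler, eulerStep]
      ring
    have e3 : ∫ x, (U j x * (ψ (x, (j + 1 : ℕ) * τ k) - ψ (x, j * τ k))
          + ((j + 1 : ℕ) * τ k - j * τ k)
            * (φ k (U j x) * jumpOp (ν k) (fun y => ψ (y, (j + 1 : ℕ) * τ k)) x)
          + (∫ r in (j * τ k)..((j + 1 : ℕ) * τ k), g (x, r)) * ψ (x, (j + 1 : ℕ) * τ k))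
        = ∫ x, ((U j x * ψ (x, (j + 1 : ℕ) * τ k) - U j x * ψ (x, j * τ k))
          + (τ k * (φ k (U j x) * jumpOp (ν k) (fun y => ψ (y, (j + 1 : ℕ) * τ k)) x)
            + sourceIncr g (τ k) j x * ψ (x, (j + 1 : ℕ) * τ k))) := by
      congr 1
      funext x
      rw [sourceIncr]
      push_cast
      ring
    rw [e3, integral_add (f := fun x => U j x * ψ (x, (j + 1 : ℕ) * τ k) - U j x * ψ (x, j * τ k))
      (g := fun x => τ k * (φ k (U j x) * jumpOp (ν k) (fun y => ψ (y, (j + 1 : ℕ) * τ k)) x)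
        + sourceIncr g (τ k) j x * ψ (x, (j + 1 : ℕ) * τ k))
      (i1.sub i2) ((hV.const_mul _).add i4), integral_sub i1 i2,
      integral_add (hV.const_mul _) i4, integral_const_mul, e2]
    ring
  -- The steps telescope. The last level is exactly `T`, where `ψ` vanishes, so only the initial
  -- term survives.
  have htel := intervalIntegral.sum_integral_adjacent_intervals (n := n)
    (a := fun j : ℕ => (j : ℝ) * τ k) hsub
  have hsum : ∑ j ∈ Finset.range n, (∫ t in (j * τ k)..((j + 1 : ℕ) * τ k), (∫ x, F (x, t)))
      = (∫ x, U n x * ψ (x, n * τ k)) - ∫ x, U 0 x * ψ (x, (0 : ℕ) * τ k) := by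
    rw [Finset.sum_congr rfl fun j _ => hstep j]
    exact Finset.sum_range_sub (fun j => ∫ x, U j x * ψ (x, j * τ k)) n
  rw [hsum, hn] at htel
  rw [restrict_QT, integral_prod_symm _ hI, ← integral_Ioc_eq_integral_Ioo,
    ← intervalIntegral.integral_of_le h.time_pos.le]
  simp only [hψT, Nat.cast_zero, zero_mul, mul_zero, integral_zero, zero_sub] at htel
  rw [← htel]
  simp [hUdef, approx, euler]

end IsSchemeFamily

end GPME

end

/-! ### Passage to the limit. -/

noncomputable section

namespace GPME

variable {N : ℕ}

theorem tendsto_integral_abs_of_eLpNorm {f : ℕ → E N → ℝ} (hf : ∀ k, AEStronglyMeasurable (f k))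
    (h : Tendsto (fun k => eLpNorm (f k) 1 volume) atTop (𝓝 0)) :
    Tendsto (fun k => ∫ x, |f k x|) atTop (𝓝 0) := by
  have := (ENNReal.tendsto_toReal ENNReal.zero_ne_top).comp h
  refine this.congr fun k => ?_
  rw [Function.comp_apply, eLpNorm_one_eq_lintegral_enorm,
    ← integral_norm_eq_lintegral_enorm (hf k)]
  rfl

theorem integral_add_five {α : Type*} [MeasurableSpace α] {μ : Measure α} {f₁ f₂ f₃ f₄ f₅ : α → ℝ}
    (h₁ : Integrable f₁ μ) (h₂ : Integrable f₂ μ) (h₃ : Integrable f₃ μ) (h₄ : Integrable f₄ μ)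
    (h₅ : Integrable f₅ μ) :
    ∫ x, (f₁ x + f₂ x + f₃ x + f₄ x + f₅ x) ∂μ
      = (∫ x, f₁ x ∂μ) + (∫ x, f₂ x ∂μ) + (∫ x, f₃ x ∂μ) + (∫ x, f₄ x ∂μ) + ∫ x, f₅ x ∂μ := by
  rw [← integral_add' h₁ h₂, ← integral_add' (h₁.add h₂) h₃, ← integral_add' ((h₁.add h₂).add h₃) h₄,
    ← integral_add' (((h₁.add h₂).add h₃).add h₄) h₅]
  rfl

namespace IsSchemeFamily

variable {κ β C T : ℝ} {ν : ℕ → Measure (E N)} {φ : ℕ → ℝ → ℝ} {τ : ℕ → ℝ} {u₀ : E N → ℝ}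
  {b : ℝ → ℝ} {g ψ L u : E N × ℝ → ℝ}

/-- The limit operator inherits the uniform `L¹` bounds, and the discrete operators converge to it
in `L¹(Q_T)`. -/
theorem limit_operator (h : IsSchemeFamily κ β C T ν φ τ) {K S : ℝ} (hS0 : 0 ≤ S)
    (hψ : Continuous ψ) (hslice : ∀ t, HasSecondDiffBound K S fun x => ψ (x, t))
    (hL : Continuous L)
    (hcons : ∀ t, Tendsto (fun k => eLpNorm
      (fun x => jumpOp (ν k) (fun y => ψ (y, t)) x - L (x, t)) 1 volume) atTop (𝓝 0)) :
    (∀ t, Integrable fun x => L (x, t)) ∧ IntegrableOn L (QT N T) ∧ (∀ t, ∫ x, L (x, t) = 0) ∧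
    ∀ k, IntegrableOn (fun p => jumpOp (ν k) (fun y => ψ (y, p.2)) p.1) (QT N T) ∧
    Tendsto (fun k => ∫ p in QT N T, |jumpOp (ν k) (fun y => ψ (y, p.2)) p.1 - L p|) atTop
      (𝓝 0) := by
  have hLm : ∀ t, Measurable fun x => L (x, t) := fun t =>
    hL.measurable.comp measurable_prodMk_right
  have hJi : ∀ k t, BddIntegrable (jumpOp (ν k) fun y => ψ (y, t)) := fun k t => by
    have := h.finite k
    exact (hslice t).bddIntegrable.jumpOp (ν k)
  have hJb : ∀ k t, ∫ x, |jumpOp (ν k) (fun y => ψ (y, t)) x| ≤ S * C / 2 := fun k t => by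
    have := h.finite k
    have := h.symm k
    refine ((hslice t).integral_abs_jumpOp_le (ν k)).trans ?_
    have := mul_le_mul_of_nonneg_left (h.truncMoment_one_le k) hS0
    linarith
  have hJ0 : ∀ k t, ∫ x, jumpOp (ν k) (fun y => ψ (y, t)) x = 0 := fun k t => by
    have := h.finite k
    have := h.symm k
    have := integral_jumpOp_mul (ν k) (hslice t).bddIntegrable (w := fun _ => 1) measurable_const
      (B := 1) (by simp)
    simpa [jumpOp] using this
  have hJm : ∀ k, Measurable fun p : E N × ℝ => jumpOp (ν k) (fun y => ψ (y, p.2)) p.1 :=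
    fun k => by
      have := h.finite k
      have : StronglyMeasurable fun q : (E N × ℝ) × E N =>
          ψ (q.1.1 + q.2, q.1.2) - ψ (q.1.1, q.1.2) := by
        have : Continuous fun q : (E N × ℝ) × E N =>
          ψ (q.1.1 + q.2, q.1.2) - ψ (q.1.1, q.1.2) := by fun_prop
        exact this.stronglyMeasurable
      exact this.integral_prod_right.measurable
  have hmeas : ∀ t k, AEStronglyMeasurable
      fun x => jumpOp (ν k) (fun y => ψ (y, t)) x - L (x, t) := fun t k =>
    ((hJi k t).measurable.sub (hLm t)).aestronglyMeasurable
  -- Consistency makes the difference finite in `L¹` for some `k`, and the discrete operator is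
  -- integrable; subtract.
  have hLi : ∀ t, Integrable fun x => L (x, t) := fun t => by
    obtain ⟨k, hk⟩ := ((hcons t).eventually (gt_mem_nhds ENNReal.zero_lt_top)).exists
    have : Integrable fun x => jumpOp (ν k) (fun y => ψ (y, t)) x - L (x, t) :=
      memLp_one_iff_integrable.1 ⟨hmeas t k, hk⟩
    refine ((hJi k t).integrable.sub this).congr (Eventually.of_forall fun x => ?_)
    simp
  have hconv : ∀ t, Tendsto (fun k => ∫ x, |jumpOp (ν k) (fun y => ψ (y, t)) x - L (x, t)|)
      atTop (𝓝 0) := fun t => tendsto_integral_abs_of_eLpNorm (hmeas t) (hcons t)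
  have hLb : ∀ t, ∫ x, |L (x, t)| ≤ S * C / 2 := fun t => by
    have hlim := (hconv t).const_add (S * C / 2)
    rw [add_zero] at hlim
    refine ge_of_tendsto' hlim fun k => ?_
    have i1 := (hJi k t).integrable
    have := integral_mono (hLi t).abs (i1.abs.add (i1.sub (hLi t)).abs) fun x => by
      simp only [Pi.add_apply, Pi.sub_apply]
      have := abs_sub (jumpOp (ν k) (fun y => ψ (y, t)) x)
        (jumpOp (ν k) (fun y => ψ (y, t)) x - L (x, t))
      rwa [sub_sub_cancel] at this
    rw [integral_add' i1.abs (i1.sub (hLi t)).abs] at this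
    refine this.trans (add_le_add_left (hJb k t) _)
  have hL0 : ∀ t, ∫ x, L (x, t) = 0 := fun t => by
    have : |∫ x, L (x, t)| ≤ 0 := ge_of_tendsto' (hconv t) fun k => by
      have e : ∫ x, L (x, t) = -∫ x, (jumpOp (ν k) (fun y => ψ (y, t)) x - L (x, t)) := by
        rw [integral_sub (hJi k t).integrable (hLi t), hJ0]; ring
      rw [e, abs_neg]
      exact abs_integral_le_integral_abs
    exact abs_nonpos_iff.1 this
  have hLQ := (integrable_QT_of_slice hL.measurable h.time_pos.le (fun t _ => hLi t)
    (fun t _ => hLb t)).1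
  have hJQ : ∀ k, IntegrableOn (fun p => jumpOp (ν k) (fun y => ψ (y, p.2)) p.1) (QT N T) :=
    fun k => (integrable_QT_of_slice (hJm k) h.time_pos.le (fun t _ => (hJi k t).integrable)
      (fun t _ => hJb k t)).1
  refine ⟨hLi, hLQ, hL0, fun k => ⟨hJQ k, ?_⟩⟩
  have e : ∀ k, ∫ p in QT N T, |jumpOp (ν k) (fun y => ψ (y, p.2)) p.1 - L p|
      = ∫ t in Ioo 0 T, ∫ x, |jumpOp (ν k) (fun y => ψ (y, t)) x - L (x, t)| := fun k => by
    have hI := ((hJQ k).sub hLQ).abs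
    rw [restrict_QT] at hI ⊢
    exact integral_prod_symm _ hI
  simp_rw [e]
  -- Consistency is only known slice by slice; the `L¹` bounds, uniform in `k` and `t`, dominate the
  -- integration in time.
  have hdct := tendsto_integral_of_dominated_convergence (μ := volume.restrict (Ioo 0 T))
    (F := fun k t => ∫ x, |jumpOp (ν k) (fun y => ψ (y, t)) x - L (x, t)|)
    (f := fun _ => (0 : ℝ)) (fun _ => S * C / 2 + S * C / 2)
    (fun k => (((hJm k).sub hL.measurable).abs.stronglyMeasurable.integral_prod_left
      (μ := volume)).aestronglyMeasurable)
    (integrable_const _)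
    (fun k => Eventually.of_forall fun t => by
      rw [Real.norm_eq_abs, abs_of_nonneg (integral_nonneg fun _ => abs_nonneg _)]
      have i1 := (hJi k t).integrable
      have := integral_mono (i1.sub (hLi t)).abs (i1.abs.add (hLi t).abs) fun x => abs_sub _ _
      rw [integral_add' i1.abs (hLi t).abs] at this
      exact this.trans (add_le_add (hJb k t) (hLb t)))
    (Eventually.of_forall fun t => hconv t)
  simpa using hdct

/-- Passage to the limit in the discrete very weak formulation. -/
theorem weak_limit (h : IsSchemeFamily κ β C T ν φ τ) (hu : BddIntegrable u₀)
    (hg : IsRegularSource b g) (hT : ∀ k, ∃ n : ℕ, n * τ k = T)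
    {f : ℝ → ℝ} (hf : Continuous f) (hf1 : ∀ s, |f s| ≤ C)
    (hf2 : ∀ r s, |f r - f s| ≤ C * |r - s| ^ κ)
    {e : ℕ → ℝ} (he : Tendsto e atTop (𝓝 0)) (hfe : ∀ k s, |φ k s - f s| ≤ e k)
    (hum : Measurable u) (hui : ∀ t ∈ Icc 0 T, Integrable fun x => u (x, t))
    (hconv : ∀ k, ∀ t ∈ Icc 0 T,
      ∫ x, |approx ν φ τ u₀ g k ⌊t / τ k⌋₊ x - u (x, t)| ≤ (1 / 2 : ℝ) ^ k)
    (hψ : ContDiff ℝ ((⊤ : ℕ∞) : WithTop ℕ∞) ψ) (hc : HasCompactSupport ψ)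
    (hψT : ∀ x, ψ (x, T) = 0) (hL : Continuous L)
    (hcons : ∀ t, Tendsto (fun k => eLpNorm
      (fun x => jumpOp (ν k) (fun y => ψ (y, t)) x - L (x, t)) 1 volume) atTop (𝓝 0)) :
    IntegrableOn (fun p => f (u p) * L p) (QT N T) ∧
    IntegrableOn L (QT N T) ∧ (∀ t, ∫ x, L (x, t) = 0) ∧
    (∫ p in QT N T, (u p * timeDeriv ψ p + f (u p) * L p + g p * ψ p))
      + ∫ x, u₀ x * ψ (x, 0) = 0 := by
  obtain ⟨K, S, hK0, hS0, hslice, hdiff, hK, hlip⟩ := exists_uniform_secondDiffBound hψ hc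
  obtain ⟨D, hD⟩ := (hasCompactSupport_timeDeriv hc).exists_bound_of_continuous
    (contDiff_timeDeriv hψ).continuous
  have hD0 : 0 ≤ D := (norm_nonneg _).trans (hD 0)
  have hψc := (contDiff_timeDeriv hψ).continuous
  obtain ⟨-, hLQ, hL0, hJ⟩ := h.limit_operator hS0 hψ.continuous hslice hL hcons
  have hC := h.const_nonneg
  have hT0 := h.time_pos
  have hU := h.bddIntegrable hu hg
  have hχ := fun t => bddIntegrable_slice hψ hc t
  have hfm : Measurable fun p => f (u p) := hf.measurable.comp hum
  have hfL : IntegrableOn (fun p => f (u p) * L p) (QT N T) :=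
    hLQ.bdd_mul hfm.aestronglyMeasurable (Eventually.of_forall fun p => hf1 _)
  have hUm : ∀ k, Measurable fun p : E N × ℝ => approx ν φ τ u₀ g k ⌊p.2 / τ k⌋₊ p.1 := fun k =>
    measurable_stepFun (fun j => (hU k j).measurable) (τ k)
  have hdU : ∀ k, IntegrableOn
      (fun p : E N × ℝ => approx ν φ τ u₀ g k ⌊p.2 / τ k⌋₊ p.1 - u p) (QT N T) ∧
      ∫ p in QT N T, |approx ν φ τ u₀ g k ⌊p.2 / τ k⌋₊ p.1 - u p| ≤ (1 / 2 : ℝ) ^ k * T :=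
    fun k => integrable_QT_of_slice ((hUm k).sub hum) hT0.le
      (fun t ht => (hU k ⌊t / τ k⌋₊).integrable.sub (hui t (Ioo_subset_Icc_self ht)))
      (fun t ht => hconv k t (Ioo_subset_Icc_self ht))
  have hUQ : ∀ k, IntegrableOn
      (fun p : E N × ℝ => approx ν φ τ u₀ g k ⌊p.2 / τ k⌋₊ p.1) (QT N T) := fun k =>
    (integrable_QT_of_slice (hUm k) hT0.le (fun t _ => (hU k ⌊t / τ k⌋₊).integrable)
      (fun t _ => h.integral_abs_approx_le hu hg k ⌊t / τ k⌋₊)).1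
  have huQ : IntegrableOn u (QT N T) := by
    refine ((hUQ 0).sub (hdU 0).1).congr (Eventually.of_forall fun p => ?_)
    simp
  have hF : IntegrableOn (fun p => u p * timeDeriv ψ p + f (u p) * L p + g p * ψ p) (QT N T) :=
    ((huQ.mul_bdd hψc.aestronglyMeasurable (Eventually.of_forall hD)).add hfL).add
      (hg.integrable.integrableOn.mul_bdd hψ.continuous.aestronglyMeasurable
        (Eventually.of_forall hK))
  set J' : ℕ → E N × ℝ → ℝ := fun k p =>
    jumpOp (ν k) (fun y => ψ (y, (⌊p.2 / τ k⌋₊ + 1 : ℕ) * τ k)) p.1 with hJ'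
  set J : ℕ → E N × ℝ → ℝ := fun k p => jumpOp (ν k) (fun y => ψ (y, p.2)) p.1 with hJdef
  have hnext : ∀ k, ∀ t ∈ Ioo 0 T, |((⌊t / τ k⌋₊ + 1 : ℕ) : ℝ) * τ k - t| ≤ τ k := by
    intro k t ht
    have hτ := h.step_pos k
    have h1 := Nat.floor_le (div_nonneg ht.1.le hτ.le)
    have h2 := Nat.lt_floor_add_one (t / τ k)
    rw [le_div_iff₀ hτ] at h1
    rw [div_lt_iff₀ hτ] at h2
    rw [abs_le]
    push_cast
    constructor <;> linarith
  have hJ'm : ∀ k, Measurable (J' k) := fun k => by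
    have := h.finite k
    exact measurable_stepFun
      (W := fun j => jumpOp (ν k) (fun y => ψ (y, (j + 1 : ℕ) * τ k)))
      (fun j => measurable_jumpOp (ν k) (hχ _).measurable) (τ k)
  have hJ'b : ∀ k p, |J' k p| ≤ K * C / 2 := fun k p => by
    have := h.finite k
    have := h.symm k
    refine ((hslice _).abs_jumpOp_le (ν k) p.1).trans ?_
    have := mul_le_mul_of_nonneg_left (h.truncMoment_one_le k) hK0
    linarith
  have hJ'Q : ∀ k, IntegrableOn (J' k) (QT N T) ∧
      ∫ p in QT N T, |J' k p| ≤ S * C / 2 * T := fun k => by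
    have := h.finite k
    have := h.symm k
    refine integrable_QT_of_slice (hJ'm k) hT0.le
      (fun t _ => ((hχ ((⌊t / τ k⌋₊ + 1 : ℕ) * τ k)).jumpOp (ν k)).integrable) (fun t _ => ?_)
    refine ((hslice ((⌊t / τ k⌋₊ + 1 : ℕ) * τ k)).integral_abs_jumpOp_le (ν k)).trans ?_
    have := mul_le_mul_of_nonneg_left (h.truncMoment_one_le k) hS0
    linarith
  -- `J'` uses the test function at the next grid time, at most `τ k` away. The second-difference
  -- bounds are Lipschitz in time, so the cost is `O(τ k)` uniformly in the jump measure.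
  have hJJ' : ∀ k, ∫ p in QT N T, |J' k p - J k p| ≤ S * τ k * C / 2 * T := fun k => by
    have := h.finite k
    have := h.symm k
    have hτ := h.step_pos k
    have hdint := (hJ'Q k).1.sub (hJ k).1
    rw [restrict_QT, integral_prod_symm _ (by rw [IntegrableOn, restrict_QT] at hdint; exact hdint.abs)]
    have hle : ∀ t ∈ Ioo 0 T, ∫ x, |J' k (x, t) - J k (x, t)| ≤ S * τ k * C / 2 := fun t ht => by
      have b := (hdiff t ((⌊t / τ k⌋₊ + 1 : ℕ) * τ k)).integral_abs_jumpOp_le (ν k)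
      obtain ⟨A, hA⟩ := (hχ ((⌊t / τ k⌋₊ + 1 : ℕ) * τ k)).bounded
      obtain ⟨B, hB⟩ := (hχ t).bounded
      have e1 : ∀ x, J' k (x, t) - J k (x, t) = jumpOp (ν k)
          (fun y => ψ (y, (⌊t / τ k⌋₊ + 1 : ℕ) * τ k) - ψ (y, t)) x := fun x =>
        (jumpOp_sub (ν k) (hχ _).measurable hA (hχ t).measurable hB x).symm
      simp_rw [e1]
      refine b.trans ?_
      have := mul_le_mul (mul_le_mul_of_nonneg_left (hnext k t ht) hS0) (h.truncMoment_one_le k)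
        (truncMoment_nonneg _ _) (by positivity)
      linarith
    rw [IntegrableOn, restrict_QT] at hdint
    refine (integral_mono_ae hdint.abs.integral_prod_right (integrable_const (S * τ k * C / 2))
      ((ae_restrict_mem measurableSet_Ioo).mono hle)).trans (le_of_eq ?_)
    simp [hT0.le, mul_comm]
  set I := (∫ p in QT N T, (u p * timeDeriv ψ p + f (u p) * L p + g p * ψ p))
      + ∫ x, u₀ x * ψ (x, 0) with hI
  -- The errors come from the solution, the nonlinearity, the time shift of the test function in the
  -- operator, consistency, and that time shift in the source. The Hölder difference is split at
  -- level `l`: `l ^ κ` goes with the `L¹` bound of `J'`, the linear part with its sup bound and the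
  -- `L¹` distance to `u`.
  have main : ∀ l > 0, ∀ k, |I| ≤ (D + C * (l ^ (κ - 1) * (K * C / 2))) * ((1 / 2 : ℝ) ^ k * T)
      + (e k + C * l ^ κ) * (S * C / 2 * T) + C * (S * τ k * C / 2 * T)
      + C * (∫ p in QT N T, |J k p - L p|) + K * τ k * ∫ p, |g p| := by
    intro l hl k
    obtain ⟨n, hn⟩ := hT k
    have hτ := h.step_pos k
    have hek : 0 ≤ e k := (abs_nonneg _).trans (hfe k 0)
    have hd := h.discrete_weak_eq hu hg hψ hc hψT k hn
    have hFk := h.integrable_discreteIntegrand hu hg hψ hc k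
    set Fk := discreteIntegrand (ν k) (φ k) (τ k) (approx ν φ τ u₀ g k) g ψ with hFkdef
    have e1 : I = ∫ p in QT N T, ((u p * timeDeriv ψ p + f (u p) * L p + g p * ψ p) - Fk p) := by
      rw [integral_sub hF hFk, hI]
      linarith
    have a1 := ((hdU k).1.abs).const_mul (D + C * (l ^ (κ - 1) * (K * C / 2)))
    have a2 := ((hJ'Q k).1.abs).const_mul (e k + C * l ^ κ)
    have a3 : IntegrableOn (fun p => C * |J' k p - J k p|) (QT N T) :=
      (((hJ'Q k).1.sub (hJ k).1).abs).const_mul C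
    have a4 : IntegrableOn (fun p => C * |J k p - L p|) (QT N T) :=
      (((hJ k).1.sub hLQ).abs).const_mul C
    have a5 := (hg.integrable.integrableOn (s := QT N T)).abs.const_mul (K * τ k)
    have hQTm : MeasurableSet (QT N T) := MeasurableSet.univ.prod measurableSet_Ioo
    have hle : |I| ≤ ∫ p in QT N T,
        ((((D + C * (l ^ (κ - 1) * (K * C / 2)))
            * |approx ν φ τ u₀ g k ⌊p.2 / τ k⌋₊ p.1 - u p|
          + (e k + C * l ^ κ) * |J' k p|) + C * |J' k p - J k p|) + C * |J k p - L p|)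
          + K * τ k * |g p| := by
      rw [e1, ← Real.norm_eq_abs]
      refine norm_integral_le_of_norm_le ((((a1.add a2).add a3).add a4).add a5) ?_
      refine (ae_restrict_mem hQTm).mono fun p hp => ?_
      set v := approx ν φ τ u₀ g k ⌊p.2 / τ k⌋₊ p.1 with hv
      have hnx := hnext k p.2 hp.2
      have eq : (u p * timeDeriv ψ p + f (u p) * L p + g p * ψ p) - Fk p
          = -((v - u p) * timeDeriv ψ p)
            - ((φ k v - f v) + (f v - f (u p))) * J' k p
            - f (u p) * (J' k p - J k p) - f (u p) * (J k p - L p)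
            - g p * (ψ (p.1, (⌊p.2 / τ k⌋₊ + 1 : ℕ) * τ k) - ψ p) := by
        simp only [hFkdef, discreteIntegrand, hJ', ← hv]
        ring
      have b1 : |(v - u p) * timeDeriv ψ p| ≤ D * |v - u p| := by
        rw [abs_mul, mul_comm]
        exact mul_le_mul_of_nonneg_right (hD p) (abs_nonneg _)
      have b2 : |((φ k v - f v) + (f v - f (u p))) * J' k p|
          ≤ (e k + C * l ^ κ) * |J' k p| + C * (l ^ (κ - 1) * (K * C / 2)) * |v - u p| := by
        rw [abs_mul]
        have c1 := hf2 v (u p)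
        have c2 := mul_le_mul_of_nonneg_left
          (rpow_le_add_mul h.exponent_pos h.exponent_le_one hl (abs_nonneg (v - u p))) hC
        have c3 : |(φ k v - f v) + (f v - f (u p))|
            ≤ (e k + C * l ^ κ) + C * l ^ (κ - 1) * |v - u p| := by
          refine (abs_add_le _ _).trans ?_
          linarith [hfe k v]
        have c4 : C * l ^ (κ - 1) * |v - u p| * |J' k p|
            ≤ C * l ^ (κ - 1) * |v - u p| * (K * C / 2) :=
          mul_le_mul_of_nonneg_left (hJ'b k p) (by positivity)
        have c5 := mul_le_mul_of_nonneg_right c3 (abs_nonneg (J' k p))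
        linarith
      have b3 : |f (u p) * (J' k p - J k p)| ≤ C * |J' k p - J k p| := by
        rw [abs_mul]
        exact mul_le_mul_of_nonneg_right (hf1 _) (abs_nonneg _)
      have b4 : |f (u p) * (J k p - L p)| ≤ C * |J k p - L p| := by
        rw [abs_mul]
        exact mul_le_mul_of_nonneg_right (hf1 _) (abs_nonneg _)
      have b5 : |g p * (ψ (p.1, (⌊p.2 / τ k⌋₊ + 1 : ℕ) * τ k) - ψ p)| ≤ K * τ k * |g p| := by
        rw [abs_mul, mul_comm]
        exact mul_le_mul_of_nonneg_right ((hlip p.2 _ p.1).trans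
          (mul_le_mul_of_nonneg_left hnx hK0)) (abs_nonneg _)
      rw [eq, Real.norm_eq_abs]
      rw [abs_le] at b1 b2 b3 b4 b5 ⊢
      constructor <;> linarith
    refine hle.trans ((integral_add_five a1 a2 a3 a4 a5).le.trans ?_)
    simp only [integral_const_mul]
    have hl0 : 0 ≤ D + C * (l ^ (κ - 1) * (K * C / 2)) := by positivity
    have hl1 : 0 ≤ e k + C * l ^ κ := by positivity
    have hgs : ∫ p in QT N T, |g p| ≤ ∫ p, |g p| :=
      setIntegral_le_integral hg.integrable.abs (Eventually.of_forall fun _ => abs_nonneg _)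
    have t1 := mul_le_mul_of_nonneg_left (hdU k).2 hl0
    have t2 := mul_le_mul_of_nonneg_left (hJ'Q k).2 hl1
    have t3 := mul_le_mul_of_nonneg_left (hJJ' k) hC
    have t5 := mul_le_mul_of_nonneg_left hgs (mul_nonneg hK0 hτ.le)
    linarith
  -- First `k → ∞` at fixed `l`, since the factor `l ^ (κ - 1)` need not stay bounded; afterwards `l
  -- → 0`.
  have hlim : ∀ l > 0, |I| ≤ C * l ^ κ * (S * C / 2 * T) := by
    intro l hl
    have p0 : Tendsto (fun k : ℕ => (1 / 2 : ℝ) ^ k) atTop (𝓝 0) :=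
      tendsto_pow_atTop_nhds_zero_of_lt_one (by norm_num) (by norm_num)
    have l1 := (p0.mul_const T).const_mul (D + C * (l ^ (κ - 1) * (K * C / 2)))
    have l2 := (he.add_const (C * l ^ κ)).mul_const (S * C / 2 * T)
    have l3 := ((((h.step_tendsto.const_mul S).mul_const C).div_const 2).mul_const T).const_mul C
    have l4 := ((hJ 0).2).const_mul C
    have l5 := (h.step_tendsto.const_mul K).mul_const (∫ p, |g p|)
    have := ge_of_tendsto' ((((l1.add l2).add l3).add l4).add l5) (main l hl)
    simpa using this
  have hI0 : |I| ≤ 0 := by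
    have hc : Tendsto (fun l : ℝ => C * l ^ κ * (S * C / 2 * T)) (𝓝[>] 0) (𝓝 0) := by
      have := (((Real.continuousAt_rpow_const 0 κ (Or.inr h.exponent_pos.le)).tendsto.const_mul
        C).mul_const (S * C / 2 * T)).mono_left (nhdsWithin_le_nhds (s := Ioi 0))
      simpa [Real.zero_rpow h.exponent_pos.ne'] using this
    refine ge_of_tendsto hc ?_
    filter_upwards [self_mem_nhdsWithin] with l hl using hlim l hl
  exact ⟨hfL, hLQ, hL0, abs_nonpos_iff.1 hI0⟩

end IsSchemeFamily

end GPME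

end

/-! ### Regularized nonlinearities, jump measures and decay of truncated moments. -/

noncomputable section

namespace GPME

section Nonlinearity

/-- Steklov averages of `f`, normalized to vanish at the origin. -/
def steklov (f : ℝ → ℝ) (δ : ℝ) (v : ℝ) : ℝ := δ⁻¹ * ∫ s in (0 : ℝ)..δ, (f (v + s) - f s)

variable {f : ℝ → ℝ} {δ C κ : ℝ}

theorem steklov_integrable (hf : Continuous f) (v a b : ℝ) :
    IntervalIntegrable (fun s => f (v + s) - f s) volume a b :=
  (by fun_prop : Continuous fun s => f (v + s) - f s).intervalIntegrable a b

theorem steklov_monotone (hf : Continuous f) (hm : Monotone f) (hδ : 0 < δ) :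
    Monotone (steklov f δ) := fun v w hvw => by
  refine mul_le_mul_of_nonneg_left (intervalIntegral.integral_mono_on hδ.le
    (steklov_integrable hf v 0 δ) (steklov_integrable hf w 0 δ) fun s _ => ?_) (by positivity)
  linarith [hm (add_le_add_left hvw s)]

theorem steklov_zero : steklov f δ 0 = 0 := by simp [steklov]

/-- Normalizing by subtracting `f s` under the integral leaves an average of increments over the
distance `v`. The bound `C * |v| ^ κ` therefore survives with the same constant, uniformly in `δ`.
-/
theorem abs_steklov_le (hδ : 0 < δ) {A : ℝ} (v : ℝ) (hA : ∀ s, |f (v + s) - f s| ≤ A) :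
    |steklov f δ v| ≤ A := by
  have := intervalIntegral.norm_integral_le_of_norm_le_const (a := 0) (b := δ)
    (f := fun s => f (v + s) - f s) (C := A) fun s _ => hA s
  rw [steklov, abs_mul, abs_of_pos (inv_pos.2 hδ), inv_mul_le_iff₀ hδ]
  rw [sub_zero, abs_of_pos hδ, Real.norm_eq_abs] at this
  linarith

/-- Moving the averaging window from `w` to `v` changes the integral only on two end intervals of
length `|v - w|`; hence the constant `2B/δ`. -/
theorem steklov_lipschitz (hf : Continuous f) (hδ : 0 < δ) {B : ℝ} (hB : ∀ s, |f s| ≤ B) :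
    ∃ ℓ : ℝ≥0, LipschitzWith ℓ (steklov f δ) := by
  have hB0 : 0 ≤ B := (abs_nonneg _).trans (hB 0)
  refine ⟨⟨δ⁻¹ * (2 * B), by positivity⟩, LipschitzWith.of_dist_le_mul fun v w => ?_⟩
  have hi : ∀ a b, IntervalIntegrable f volume a b := fun a b => hf.intervalIntegrable a b
  have e : steklov f δ v - steklov f δ w
      = δ⁻¹ * ((∫ s in (w + δ)..(v + δ), f s) - ∫ s in w..v, f s) := by
    have h1 : ∀ v, steklov f δ v = δ⁻¹ * ((∫ s in v..(v + δ), f s) - ∫ s in (0 : ℝ)..δ, f s) := by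
      intro v
      rw [steklov, intervalIntegral.integral_sub
        ((by fun_prop : Continuous fun s => f (v + s)).intervalIntegrable _ _) (hi _ _)]
      simp
    rw [h1, h1, ← mul_sub]
    congr 1
    have a := intervalIntegral.integral_add_adjacent_intervals (hi w v) (hi v (v + δ))
    have b := intervalIntegral.integral_add_adjacent_intervals (hi w (w + δ)) (hi (w + δ) (v + δ))
    linarith
  have n1 := intervalIntegral.norm_integral_le_of_norm_le_const (a := w + δ) (b := v + δ)
    (f := f) (C := B) fun s _ => hB s
  have n2 := intervalIntegral.norm_integral_le_of_norm_le_const (a := w) (b := v)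
    (f := f) (C := B) fun s _ => hB s
  rw [add_sub_add_right_eq_sub, Real.norm_eq_abs] at n1
  rw [Real.norm_eq_abs] at n2
  rw [Real.dist_eq, Real.dist_eq, e, abs_mul, abs_of_pos (inv_pos.2 hδ)]
  change _ ≤ δ⁻¹ * (2 * B) * |v - w|
  rw [mul_assoc]
  refine mul_le_mul_of_nonneg_left ((abs_sub _ _).trans ?_) (by positivity)
  linarith

theorem abs_steklov_sub_le (hf : Continuous f) (hδ : 0 < δ) (hC : 0 ≤ C) (hκ : 0 ≤ κ)
    (h0 : f 0 = 0) (hh : ∀ r s, |f r - f s| ≤ C * |r - s| ^ κ) (v : ℝ) :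
    |steklov f δ v - f v| ≤ 2 * C * δ ^ κ := by
  have e : steklov f δ v - f v = δ⁻¹ * ∫ s in (0 : ℝ)..δ, ((f (v + s) - f s) - f v) := by
    rw [intervalIntegral.integral_sub (steklov_integrable hf v 0 δ) intervalIntegrable_const,
      steklov, mul_sub, intervalIntegral.integral_const]
    simp only [sub_zero, smul_eq_mul]
    field_simp
  have := intervalIntegral.norm_integral_le_of_norm_le_const (a := 0) (b := δ)
    (f := fun s => (f (v + s) - f s) - f v) (C := 2 * C * δ ^ κ) fun s hs => by
      rw [uIoc_of_le hδ.le] at hs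
      have hsδ : C * |s| ^ κ ≤ C * δ ^ κ := by
        rw [abs_of_pos hs.1]
        exact mul_le_mul_of_nonneg_left (Real.rpow_le_rpow hs.1.le hs.2 hκ) hC
      have a := hh (v + s) v
      have b := hh s 0
      rw [add_sub_cancel_left] at a
      rw [sub_zero, h0, sub_zero] at b
      rw [Real.norm_eq_abs, show f (v + s) - f s - f v = (f (v + s) - f v) - f s by ring]
      refine (abs_sub _ _).trans ?_
      linarith
  rw [e, abs_mul, abs_of_pos (inv_pos.2 hδ), inv_mul_le_iff₀ hδ]
  rw [sub_zero, abs_of_pos hδ, Real.norm_eq_abs] at this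
  linarith

/-- A nonlinearity coincides, up to a constant and on a bounded interval, with a globally bounded
and globally Hölder continuous one. -/
theorem IsNonlinearity.exists_truncation {κ : ℝ≥0} {φ : ℝ → ℝ} (hφ : IsNonlinearity κ φ) {M : ℝ}
    (hM : 0 ≤ M) : ∃ (f : ℝ → ℝ) (C : ℝ), 0 ≤ C ∧ Continuous f ∧ Monotone f ∧ f 0 = 0 ∧
      (∀ s, |f s| ≤ C) ∧ (∀ r s, |f r - f s| ≤ C * |r - s| ^ (κ : ℝ)) ∧
      ∀ s, |s| ≤ M → f s = φ s - φ 0 := by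
  obtain ⟨C, hC⟩ := hφ.locHolder (Icc (-M) M) isCompact_Icc
  have hκ : (0 : ℝ) < κ := by exact_mod_cast hφ.exponent_pos
  have hMM : -M ≤ M := by linarith
  -- Composition with the nonexpansive, monotone projection onto `[-M, M]` makes the local Hölder
  -- bound global and keeps monotonicity.
  set p : ℝ → ℝ := fun s => projIcc (-M) M hMM s with hp
  have hp1 : ∀ r s, |p r - p s| ≤ |r - s| := fun r s => by
    have := (LipschitzWith.projIcc hMM).dist_le_mul r s
    simpa [Real.dist_eq, Subtype.dist_eq] using this
  have hpm : ∀ s, p s ∈ Icc (-M) M := fun s => (projIcc (-M) M hMM s).2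
  have hp_id : ∀ s, |s| ≤ M → p s = s := fun s hs => by
    simp [hp, projIcc_of_mem hMM (abs_le.1 hs)]
  have hhol : ∀ r s, |φ (p r) - φ (p s)| ≤ C * |r - s| ^ (κ : ℝ) := fun r s => by
    have h1 := hC.dist_le (hpm r) (hpm s)
    rw [Real.dist_eq, Real.dist_eq] at h1
    exact h1.trans (mul_le_mul_of_nonneg_left
      (Real.rpow_le_rpow (abs_nonneg _) (hp1 r s) hκ.le) C.2)
  have hp0 : p 0 = 0 := hp_id 0 (by simpa using hM)
  have hCD : (C : ℝ) ≤ max (C : ℝ) (C * M ^ (κ : ℝ)) := le_max_left _ _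
  refine ⟨fun s => φ (p s) - φ 0, max (C : ℝ) (C * M ^ (κ : ℝ)), C.2.trans hCD, ?_, ?_, ?_, ?_, ?_, ?_⟩
  · refine Continuous.sub ?_ continuous_const
    have hcont : ContinuousOn φ (Icc (-M) M) := hC.continuousOn hφ.exponent_pos
    exact hcont.comp_continuous (continuous_subtype_val.comp continuous_projIcc) hpm
  · exact fun r s hrs => sub_le_sub_right
      (hφ.monotone (Subtype.coe_le_coe.2 (monotone_projIcc hMM hrs))) _
  · simp [hp0]
  · intro s
    have h1 := hC.dist_le (hpm s) (hpm 0)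
    rw [Real.dist_eq, Real.dist_eq, hp0, sub_zero] at h1
    refine h1.trans (le_trans ?_ (le_max_right _ _))
    exact mul_le_mul_of_nonneg_left
      (Real.rpow_le_rpow (abs_nonneg _) (abs_le.2 (hpm s)) hκ.le) C.2
  · intro r s
    rw [sub_sub_sub_cancel_right]
    exact (hhol r s).trans (mul_le_mul_of_nonneg_right hCD (by positivity))
  · intro s hs
    simp only [hp_id s hs]

end Nonlinearity

/-- For a Lipschitz nonlinearity, all sufficiently small uniform time steps are stable. -/
theorem exists_stable_step {N : ℕ} {ν : Measure (E N)} {f : ℝ → ℝ} (hm : Monotone f)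
    {ℓ : ℝ≥0} (hl : LipschitzWith ℓ f) (h0 : f 0 = 0) {T ε : ℝ} (hT : 0 < T) (hε : 0 < ε) :
    ∃ τ, 0 < τ ∧ τ ≤ ε ∧ (∃ n : ℕ, n * τ = T) ∧ IsStable ν f τ := by
  -- With `τ = T / n`, the first lower bound on `n` gives `τ ≤ ε` and the second gives the stability
  -- condition.
  obtain ⟨n, hn⟩ := exists_nat_gt (max (T / ε) (T * ν.real univ * ℓ))
  have hn1 : T / ε < n := (le_max_left _ _).trans_lt hn
  have hn2 : T * ν.real univ * ℓ < n := (le_max_right _ _).trans_lt hn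
  have hn0 : (0 : ℝ) < n := (div_pos hT hε).trans hn1
  refine ⟨T / n, by positivity, ?_, ⟨n, by field_simp⟩, hm, ⟨ℓ, hl⟩, h0, by positivity,
    fun a b hab => ?_⟩
  · rw [div_le_iff₀ hn0]
    rw [div_lt_iff₀ hε] at hn1
    linarith
  · have h1 := hl.dist_le_mul b a
    rw [Real.dist_eq, Real.dist_eq, abs_of_nonneg (sub_nonneg.2 (hm hab)),
      abs_of_nonneg (sub_nonneg.2 hab)] at h1
    have hr : 0 ≤ ν.real univ := measureReal_nonneg
    calc T / n * ν.real univ * (f b - f a) ≤ T / n * ν.real univ * (ℓ * (b - a)) := by gcongr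
      _ = (T * ν.real univ * ℓ) / n * (b - a) := by ring
      _ ≤ 1 * (b - a) := by
          refine mul_le_mul_of_nonneg_right ?_ (sub_nonneg.2 hab)
          rw [div_le_one hn0]; exact hn2.le
      _ = b - a := one_mul _

variable {N : ℕ}

/-- The jump measure `∑_{γ ≠ 0} ω_γ δ_{z_γ}`. -/
def jumpMeasure (z : (Fin N → ℤ) → E N) (ω : (Fin N → ℤ) → ℝ) : Measure (E N) :=
  Measure.sum fun γ : {γ : Fin N → ℤ // γ ≠ 0} => ENNReal.ofReal (ω γ) • Measure.dirac (z γ)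

section JumpMeasure

variable {z : (Fin N → ℤ) → E N} {ω : (Fin N → ℤ) → ℝ}

theorem isFiniteMeasure_jumpMeasure (hω : ∀ γ, γ ≠ 0 → 0 ≤ ω γ)
    (hs : Summable fun γ : {γ : Fin N → ℤ // γ ≠ 0} => ω γ) :
    IsFiniteMeasure (jumpMeasure z ω) := by
  constructor
  rw [jumpMeasure, Measure.sum_apply _ MeasurableSet.univ]
  simp only [Measure.smul_apply, measure_univ, smul_eq_mul, mul_one]
  rw [← ENNReal.ofReal_tsum_of_nonneg (fun γ : {γ : Fin N → ℤ // γ ≠ 0} => hω γ γ.2) hs]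
  exact ENNReal.ofReal_lt_top

/-- Reindexing by `γ ↦ -γ` exchanges the atoms at `z_γ` and `-z_γ`, which carry equal weights. -/
theorem isNegInvariant_jumpMeasure (hz : ∀ γ, γ ≠ 0 → z (-γ) = -z γ)
    (hω : ∀ γ, γ ≠ 0 → ω (-γ) = ω γ) : (jumpMeasure z ω).IsNegInvariant := by
  constructor
  rw [Measure.neg, jumpMeasure]
  refine Measure.ext fun s hs => ?_
  rw [Measure.map_apply measurable_neg hs, Measure.sum_apply _ (measurable_neg hs),
    Measure.sum_apply _ hs]
  let e : {γ : Fin N → ℤ // γ ≠ 0} ≃ {γ : Fin N → ℤ // γ ≠ 0} :=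
    (Equiv.neg _).subtypeEquiv fun γ => by simp
  rw [← e.tsum_eq]
  congr 1
  funext γ
  have e1 : ((e γ : {γ : Fin N → ℤ // γ ≠ 0}) : Fin N → ℤ) = -γ := rfl
  rw [e1, hz γ γ.2, hω γ γ.2]
  simp only [Measure.smul_apply, smul_eq_mul]
  rw [Measure.dirac_apply' _ (measurable_neg hs), Measure.dirac_apply' _ hs]
  have e2 : -z γ ∈ Neg.neg ⁻¹' s ↔ z γ ∈ s := by rw [mem_preimage, neg_neg]
  by_cases hm : z γ ∈ s
  · rw [indicator_of_mem hm, indicator_of_mem (e2.2 hm)]; rfl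
  · rw [indicator_of_notMem hm, indicator_of_notMem (mt e2.1 hm)]

theorem integral_jumpMeasure (hω : ∀ γ, γ ≠ 0 → 0 ≤ ω γ) {f : E N → ℝ}
    (hf : Integrable f (jumpMeasure z ω)) :
    ∫ x, f x ∂(jumpMeasure z ω) = ∑' γ : {γ : Fin N → ℤ // γ ≠ 0}, f (z γ) * ω γ := by
  rw [jumpMeasure, integral_sum_measure hf]
  congr 1
  funext γ
  rw [integral_smul_measure, integral_dirac, ENNReal.toReal_ofReal (hω γ γ.2), smul_eq_mul,
    mul_comm]

theorem jumpOp_jumpMeasure (hω : ∀ γ, γ ≠ 0 → 0 ≤ ω γ)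
    (hs : Summable fun γ : {γ : Fin N → ℤ // γ ≠ 0} => ω γ) {ψ : E N → ℝ} (hψ : Measurable ψ)
    {M : ℝ} (hM : ∀ x, |ψ x| ≤ M) : jumpOp (jumpMeasure z ω) ψ = discreteOp z ω ψ := by
  have := isFiniteMeasure_jumpMeasure (z := z) hω hs
  funext x
  exact integral_jumpMeasure hω ((integrable_shift _ hψ hM x).sub (integrable_const _))

theorem ofReal_truncMoment_jumpMeasure (hω : ∀ γ, γ ≠ 0 → 0 ≤ ω γ)
    (hs : Summable fun γ : {γ : Fin N → ℤ // γ ≠ 0} => ω γ) (R : ℝ) :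
    ENNReal.ofReal (truncMoment (jumpMeasure z ω) R)
      = ∑' γ : {γ : Fin N → ℤ // γ ≠ 0}, ENNReal.ofReal (min (‖z γ‖ ^ 2 / R ^ 2) 1 * ω γ) := by
  have := isFiniteMeasure_jumpMeasure (z := z) hω hs
  have h0 : ∀ x : E N, 0 ≤ min (‖x‖ ^ 2 / R ^ 2) 1 := fun x => le_min (by positivity) zero_le_one
  rw [truncMoment, integral_jumpMeasure hω (integrable_truncMoment _ R),
    ENNReal.ofReal_tsum_of_nonneg
      (fun γ : {γ : Fin N → ℤ // γ ≠ 0} => mul_nonneg (h0 (z γ)) (hω γ γ.2))]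
  refine Summable.of_nonneg_of_le (fun γ => mul_nonneg (h0 _) (hω γ γ.2)) (fun γ => ?_) hs
  exact mul_le_of_le_one_left (hω γ γ.2) (min_le_right _ _)

theorem nodeSum_eq (A : Set ℝ) (f : ℝ → ℝ) : nodeSum z ω A f
    = ∑' γ : {γ : Fin N → ℤ // γ ≠ 0},
      {γ : Fin N → ℤ | ‖z γ‖ ∈ A}.indicator (fun γ => ENNReal.ofReal (f ‖z γ‖ * ω γ)) γ := by
  have h1 := tsum_subtype {γ : Fin N → ℤ | γ ≠ 0 ∧ ‖z γ‖ ∈ A}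
    (fun γ => ENNReal.ofReal (f ‖z γ‖ * ω γ))
  have h2 := tsum_subtype {γ : Fin N → ℤ | γ ≠ 0}
    ({γ : Fin N → ℤ | ‖z γ‖ ∈ A}.indicator fun γ => ENNReal.ofReal (f ‖z γ‖ * ω γ))
  rw [indicator_indicator] at h2
  exact h1.trans h2.symm

/-- Comparison of the truncated second moment with the node sums. -/
theorem truncMoment_le_nodeSum (hω : ∀ γ, γ ≠ 0 → 0 ≤ ω γ)
    (hs : Summable fun γ : {γ : Fin N → ℤ // γ ≠ 0} => ω γ) {h R : ℝ}
    (hgrid : ∀ γ, γ ≠ 0 → z γ = 0 ∨ h ≤ ‖z γ‖) {A B : Set ℝ} (hAB : Ioi 1 ⊆ A ∪ B)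
    {c₁ c₂ c₃ : ℝ} (h₁ : 0 ≤ c₁) (h₂ : 0 ≤ c₂) (h₃ : 0 ≤ c₃) {f₂ f₃ : ℝ → ℝ}
    (b₁ : ∀ s, s ^ 2 / R ^ 2 ≤ c₁ * s ^ 2)
    (b₂ : ∀ s ∈ A, 0 < s → min (s ^ 2 / R ^ 2) 1 ≤ c₂ * f₂ s)
    (b₃ : ∀ s ∈ B, 0 < s → min (s ^ 2 / R ^ 2) 1 ≤ c₃ * f₃ s) :
    ENNReal.ofReal (truncMoment (jumpMeasure z ω) R)
      ≤ ENNReal.ofReal c₁ * nodeSum z ω (Icc h 1) (fun s => s ^ 2)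
        + ENNReal.ofReal c₂ * nodeSum z ω A f₂ + ENNReal.ofReal c₃ * nodeSum z ω B f₃ := by
  rw [ofReal_truncMoment_jumpMeasure hω hs, nodeSum_eq, nodeSum_eq, nodeSum_eq,
    ← ENNReal.tsum_mul_left, ← ENNReal.tsum_mul_left, ← ENNReal.tsum_mul_left,
    ← ENNReal.tsum_add, ← ENNReal.tsum_add]
  refine ENNReal.tsum_le_tsum fun γ => ?_
  have hω' := hω γ γ.2
  -- A node at the origin contributes nothing to the moment; every other node has norm at least `h`,
  -- so the sum over `Icc h 1` misses no small jump.
  rcases hgrid γ γ.2 with h0 | hh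
  · simp [h0]
  rcases eq_or_ne (z γ) 0 with h0 | h0
  · simp [h0]
  have hpos : 0 < ‖z γ‖ := norm_pos_iff.2 h0
  have key : ∀ {c m F : ℝ}, 0 ≤ c → m ≤ c * F →
      ENNReal.ofReal (m * ω γ) ≤ ENNReal.ofReal c * ENNReal.ofReal (F * ω γ) := by
    intro c m F hc hm
    rw [← ENNReal.ofReal_mul hc, ← mul_assoc]
    exact ENNReal.ofReal_le_ofReal (mul_le_mul_of_nonneg_right hm hω')
  rcases le_or_gt ‖z γ‖ 1 with hle | hgt
  · rw [indicator_of_mem (s := {γ : Fin N → ℤ | ‖z γ‖ ∈ Icc h 1}) (show ‖z γ‖ ∈ Icc h 1 from ⟨hh, hle⟩)]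
    exact (key h₁ ((min_le_left _ _).trans (b₁ _))).trans (le_self_add.trans le_self_add)
  · rcases hAB hgt with hA | hB
    · rw [indicator_of_mem (s := {γ : Fin N → ℤ | ‖z γ‖ ∈ A}) (show ‖z γ‖ ∈ A from hA)]
      exact (key h₂ (b₂ _ hA hpos)).trans (le_add_self.trans le_self_add)
    · rw [indicator_of_mem (s := {γ : Fin N → ℤ | ‖z γ‖ ∈ B}) (show ‖z γ‖ ∈ B from hB)]
      exact (key h₃ (b₃ _ hB hpos)).trans le_add_self

end JumpMeasure

theorem norm_grid_ge {h : ℝ} (hh : 0 < h) (β : Fin N → ℤ) :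
    h • WithLp.toLp 2 (fun i => (β i : ℝ)) = (0 : E N)
      ∨ h ≤ ‖(h • WithLp.toLp 2 (fun i => (β i : ℝ)) : E N)‖ := by
  by_cases hβ : ∀ i, β i = 0
  · left
    ext i
    simp [hβ i]
  · right
    push Not at hβ
    obtain ⟨i, hi⟩ := hβ
    have h1 := PiLp.norm_apply_le (h • WithLp.toLp 2 (fun i => (β i : ℝ)) : E N) i
    have h2 : (1 : ℝ) ≤ |(β i : ℝ)| := by exact_mod_cast Int.one_le_abs hi
    rw [PiLp.smul_apply, norm_smul, Real.norm_eq_abs, abs_of_pos hh, Real.norm_eq_abs] at h1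
    nlinarith

section Admissible

variable {z : ℝ → (Fin N → ℤ) → E N} {ω : ℝ → (Fin N → ℤ) → ℝ}

theorem IsDiscretization.norm_node (hzω : IsDiscretization z ω) {h : ℝ} (hh : 0 < h)
    (γ : Fin N → ℤ) (hγ : γ ≠ 0) : z h γ = 0 ∨ h ≤ ‖z h γ‖ := by
  obtain ⟨β, hβ⟩ := hzω.node_mem_grid h hh γ hγ
  rw [hβ]
  exact norm_grid_ge hh β

theorem exists_bound_of_iSup_lt_top {ι : Type*} {s : Set ι} {f : ι → ℝ≥0∞}
    (h : ⨆ i ∈ s, f i < ∞) : ∃ C : ℝ, 0 ≤ C ∧ ∀ i ∈ s, f i ≤ ENNReal.ofReal C :=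
  ⟨(⨆ i ∈ s, f i).toReal, ENNReal.toReal_nonneg, fun i hi => by
    rw [ENNReal.ofReal_toReal h.ne]
    exact le_iSup₂ (f := fun i (_ : i ∈ s) => f i) i hi⟩

theorem min_sq_div_le {s R : ℝ} (hs : 0 < s) (hR : 0 < R) : min (s ^ 2 / R ^ 2) 1 ≤ R⁻¹ * s := by
  rw [← div_pow, ← div_eq_inv_mul]
  have h0 : 0 < s / R := by positivity
  rcases le_total (s / R) 1 with h | h
  · exact (min_le_left _ _).trans (by nlinarith)
  · exact (min_le_right _ _).trans h

/-- Only the operator is prescribed, not its nodes and weights. The moment is the operator applied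
at the origin to the truncated quadratic `min (‖x‖ ^ 2 / R ^ 2) 1`, so it can be read off the
finite-difference formula. -/
theorem truncMoment_discreteLaplacian (hzω : IsDiscretization z ω) {h R : ℝ} (hh : 0 < h)
    (hR : 0 < R) (hd : discreteOp (z h) (ω h) = discreteLaplacian h) :
    truncMoment (jumpMeasure (z h) (ω h)) R ≤ 2 * N * R ^ (-2 : ℝ) := by
  have h0 : ∀ x : E N, 0 ≤ min (‖x‖ ^ 2 / R ^ 2) 1 := fun x => le_min (by positivity) zero_le_one
  have e1 : truncMoment (jumpMeasure (z h) (ω h)) R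
      = jumpOp (jumpMeasure (z h) (ω h)) (fun x => min (‖x‖ ^ 2 / R ^ 2) 1) 0 := by
    simp [truncMoment, jumpOp]
  rw [e1, jumpOp_jumpMeasure (hzω.weight_nonneg h hh) (hzω.weight_summable h hh) (by fun_prop)
    (M := 1) (fun x => by rw [abs_of_nonneg (h0 x)]; exact min_le_right _ _), hd, discreteLaplacian]
  have e2 : ∀ i : Fin N, (min (‖(0 : E N) + h • EuclideanSpace.single i (1 : ℝ)‖ ^ 2 / R ^ 2) 1
      + min (‖(0 : E N) - h • EuclideanSpace.single i (1 : ℝ)‖ ^ 2 / R ^ 2) 1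
      - 2 * min (‖(0 : E N)‖ ^ 2 / R ^ 2) 1) / h ^ 2 ≤ 2 * R ^ (-2 : ℝ) := fun i => by
    have hn : ‖h • EuclideanSpace.single i (1 : ℝ)‖ = h := by
      rw [norm_smul, Real.norm_eq_abs, abs_of_pos hh]; simp
    rw [zero_add, zero_sub, norm_neg, hn, norm_zero, div_le_iff₀ (by positivity),
      Real.rpow_neg hR.le, Real.rpow_two]
    have hz : min ((0 : ℝ) ^ 2 / R ^ 2) 1 = 0 := by simp
    rw [hz]
    have : min (h ^ 2 / R ^ 2) 1 ≤ (R ^ 2)⁻¹ * h ^ 2 :=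
      (min_le_left _ _).trans (le_of_eq (by rw [div_eq_inv_mul]))
    linarith
  refine (Finset.sum_le_sum fun i _ => e2 i).trans (le_of_eq ?_)
  simp
  ring

/-- In all admissible cases the truncated second moments decay at a rate that is compatible with the
Hölder exponent. -/
theorem Admissible.exists_truncMoment_le (hN : 0 < N) {κ : ℝ≥0} (hzω : IsDiscretization z ω)
    (ha : Admissible κ z ω) : ∃ β C : ℝ, N * (1 - (κ : ℝ)) < β ∧ 0 ≤ C ∧
      ∀ h ∈ Ioo (0 : ℝ) 1, ∀ R, 1 ≤ R →
        truncMoment (jumpMeasure (z h) (ω h)) R ≤ C * R ^ (-β) := by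
  have hN' : (0 : ℝ) < N := by exact_mod_cast hN
  have hdim : ∀ β : ℝ, (N - β) / N < κ → N * (1 - (κ : ℝ)) < β := fun β hβ => by
    rw [div_lt_iff₀ hN'] at hβ
    linarith
  rcases ha with ⟨hd, -, hκ⟩ | ⟨hm, hκ⟩ | ⟨α, hα, ⟨hl, hf⟩, hκ⟩
  · refine ⟨2, 2 * N, hdim 2 (lt_of_le_of_lt ?_ hκ), by positivity, fun h hh R hR => ?_⟩
    · exact div_le_div_of_nonneg_right (le_max_left _ _) hN'.le
    · exact truncMoment_discreteLaplacian hzω hh.1 (by linarith) (hd h hh.1)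
  · obtain ⟨C, hC, hb⟩ := exists_bound_of_iSup_lt_top hm
    refine ⟨1, C, hdim 1 hκ, hC, fun h hh R hR => ?_⟩
    have hR0 : 0 < R := by linarith
    -- The rate is `β = 1`: near jumps satisfy `R^{-2} ≤ R^{-1}` because `R ≥ 1`, and far ones `min
    -- (s²/R²) 1 ≤ s/R`, which matches the first moment.
    have key := truncMoment_le_nodeSum (hzω.weight_nonneg h hh.1) (hzω.weight_summable h hh.1)
      (hzω.norm_node hh.1) (R := R) (A := Ioi 1) (B := ∅) (by simp) (c₁ := R⁻¹) (c₂ := R⁻¹)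
      (c₃ := 0) (by positivity) (by positivity) le_rfl (f₂ := fun s => s) (f₃ := fun _ => 0)
      (fun s => by
        rw [div_eq_inv_mul]
        refine mul_le_mul_of_nonneg_right ?_ (by positivity)
        exact inv_anti₀ hR0 (by nlinarith))
      (fun s _ hs => min_sq_div_le hs hR0) (by simp)
    rw [ENNReal.ofReal_zero, zero_mul, add_zero, ← mul_add] at key
    have h2 := key.trans (mul_le_mul_right (hb h hh) _)
    rw [← ENNReal.ofReal_mul (by positivity)] at h2
    rw [Real.rpow_neg_one, mul_comm]
    exact (ENNReal.ofReal_le_ofReal_iff (by positivity)).1 h2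
  · obtain ⟨C₀, hC₀, hb₀⟩ := exists_bound_of_iSup_lt_top hl
    obtain ⟨C₁, hC₁, hb₁⟩ := exists_bound_of_iSup_lt_top hf
    have hb₂ : ∀ R : ℝ, 1 < R → ∀ h ∈ Ioo (0 : ℝ) 1,
        ENNReal.ofReal (R ^ (α - 2)) * nodeSum (z h) (ω h) (Ioc 1 R) (fun s => s ^ 2)
          + ENNReal.ofReal (R ^ α) * nodeSum (z h) (ω h) (Ioi R) (fun _ => 1)
          ≤ ENNReal.ofReal C₁ := fun R hR h hh =>
      le_trans (le_iSup₂ (f := fun h (_ : h ∈ Ioo (0 : ℝ) 1) =>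
        ENNReal.ofReal (R ^ (α - 2)) * nodeSum (z h) (ω h) (Ioc 1 R) (fun s => s ^ 2)
          + ENNReal.ofReal (R ^ α) * nodeSum (z h) (ω h) (Ioi R) (fun _ => 1)) h hh) (hb₁ R hR)
    refine ⟨α, C₀ + C₁, hdim α (lt_of_le_of_lt ?_ hκ), by positivity, fun h hh R hR => ?_⟩
    · exact div_le_div_of_nonneg_right (le_max_left _ _) hN'.le
    have hR0 : 0 < R := by linarith
    -- The fractional tail condition ranges over `R > 1` only; at `R = 1` the basic Lévy condition
    -- suffices.
    rcases hR.eq_or_lt with rfl | hR1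
    · have key := truncMoment_le_nodeSum (hzω.weight_nonneg h hh.1) (hzω.weight_summable h hh.1)
        (hzω.norm_node hh.1) (R := 1) (A := Ioi 1) (B := ∅) (by simp) (c₁ := 1) (c₂ := 1)
        (c₃ := 0) zero_le_one zero_le_one le_rfl (f₂ := fun _ => 1) (f₃ := fun _ => 0)
        (fun s => by simp) (fun s _ _ => by simp) (by simp)
      rw [ENNReal.ofReal_zero, zero_mul, add_zero, ← mul_add, ENNReal.ofReal_one, one_mul] at key
      have h2 := key.trans (hb₀ h hh)
      have h3 := (ENNReal.ofReal_le_ofReal_iff hC₀).1 h2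
      rw [Real.one_rpow, mul_one]
      linarith
    · have key := truncMoment_le_nodeSum (hzω.weight_nonneg h hh.1) (hzω.weight_summable h hh.1)
        (hzω.norm_node hh.1) (R := R) (A := Ioc 1 R) (B := Ioi R)
        (by rw [Ioc_union_Ioi_eq_Ioi hR1.le]) (c₁ := R ^ (-2 : ℝ)) (c₂ := R ^ (-2 : ℝ))
        (c₃ := 1) (by positivity) (by positivity) zero_le_one (f₂ := fun s => s ^ 2)
        (f₃ := fun _ => 1)
        (fun s => by
          rw [Real.rpow_neg hR0.le, Real.rpow_two, div_eq_inv_mul])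
        (fun s _ _ => by
          rw [Real.rpow_neg hR0.le, Real.rpow_two, ← div_eq_inv_mul]
          exact min_le_left _ _)
        (fun s _ _ => by simp)
      -- Factoring `R^{-α}` out of the weights `R^{-2}` and `1` leaves exactly the powers `R^{α-2}`
      -- and `R^α` of the tail condition.
      have e2 : ENNReal.ofReal (R ^ (-2 : ℝ))
          = ENNReal.ofReal (R ^ (-α)) * ENNReal.ofReal (R ^ (α - 2)) := by
        rw [← ENNReal.ofReal_mul (by positivity), ← Real.rpow_add hR0]
        congr 2; ring
      have e3 : ENNReal.ofReal 1 = ENNReal.ofReal (R ^ (-α)) * ENNReal.ofReal (R ^ α) := by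
        rw [← ENNReal.ofReal_mul (by positivity), ← Real.rpow_add hR0]
        simp
      have b1 : ENNReal.ofReal (R ^ (-2 : ℝ)) * nodeSum (z h) (ω h) (Icc h 1) (fun s => s ^ 2)
          ≤ ENNReal.ofReal (R ^ (-α)) * ENNReal.ofReal C₀ := by
        refine mul_le_mul' (ENNReal.ofReal_le_ofReal ?_) (le_self_add.trans (hb₀ h hh))
        exact Real.rpow_le_rpow_of_exponent_le hR (by linarith [hα.2])
      have b2 := mul_le_mul_right (hb₂ R hR1 h hh) (ENNReal.ofReal (R ^ (-α)))
      rw [mul_add, ← mul_assoc, ← mul_assoc, ← e2, ← e3] at b2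
      have h2 : ENNReal.ofReal (truncMoment (jumpMeasure (z h) (ω h)) R)
          ≤ ENNReal.ofReal (R ^ (-α)) * ENNReal.ofReal C₀
            + ENNReal.ofReal (R ^ (-α)) * ENNReal.ofReal C₁ := by
        refine key.trans ?_
        rw [add_assoc]
        exact add_le_add b1 b2
      rw [← mul_add, ← ENNReal.ofReal_add hC₀ hC₁, ← ENNReal.ofReal_mul (by positivity)] at h2
      rw [mul_comm]
      exact (ENNReal.ofReal_le_ofReal_iff (by positivity)).1 h2

end Admissible

end GPME

end

/-! ### Representatives of the data, interpolation, and construction of the family. -/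

noncomputable section

namespace GPME

variable {N : ℕ}

section Representatives

/-- A function in `L¹ ∩ L^∞` has a representative that is bounded everywhere. -/
theorem exists_bddIntegrable_ae_eq {u : E N → ℝ} (h1 : MemLp u 1 volume) (hi : MemLp u ∞ volume) :
    ∃ (v : E N → ℝ) (M : ℝ), 0 ≤ M ∧ BddIntegrable v ∧ (∀ x, |v x| ≤ M) ∧ v =ᵐ[volume] u := by
  set w := h1.aestronglyMeasurable.mk u with hw
  have hwm : Measurable w := h1.aestronglyMeasurable.stronglyMeasurable_mk.measurable
  have hwu : u =ᵐ[volume] w := h1.aestronglyMeasurable.ae_eq_mk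
  set M := (eLpNorm u ∞ volume).toReal
  have hS : MeasurableSet {x | |w x| ≤ M} := measurableSet_le hwm.abs measurable_const
  have hM : 0 ≤ M := ENNReal.toReal_nonneg
  have hb : ∀ x, |{x | |w x| ≤ M}.indicator w x| ≤ M := fun x => by
    by_cases hx : x ∈ {x | |w x| ≤ M}
    · rw [indicator_of_mem hx]; exact hx
    · rw [indicator_of_notMem hx, abs_zero]; exact hM
  have hae : {x | |w x| ≤ M}.indicator w =ᵐ[volume] u := by
    have h2 : ∀ᵐ x, ‖u x‖ₑ ≤ eLpNorm u ∞ volume := by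
      rw [eLpNorm_exponent_top]; exact ae_le_eLpNormEssSup
    filter_upwards [hwu, h2] with x hx hx2
    have : |w x| ≤ M := by
      rw [← hx, ← Real.norm_eq_abs, ← toReal_enorm]
      exact ENNReal.toReal_mono hi.2.ne hx2
    rw [indicator_of_mem (show x ∈ {x | |w x| ≤ M} from this), hx]
  exact ⟨_, M, hM, ⟨hwm.indicator hS, (memLp_one_iff_integrable.1 h1).congr hae.symm, M, hb⟩, hb, hae⟩

/-- The essential supremum of a slice is at most `a` exactly when the slice of `{a < |g|}` is null,
and measures of slices depend measurably on `t`. -/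
theorem measurable_eLpNorm_top_slice {g : E N × ℝ → ℝ} (hg : Measurable g) :
    Measurable fun t => eLpNorm (fun x => g (x, t)) ∞ volume := by
  refine measurable_of_Iic fun a => ?_
  have hS : MeasurableSet {p | a < ‖g p‖ₑ} := measurableSet_lt measurable_const hg.enorm
  have e : (fun t => eLpNorm (fun x => g (x, t)) ∞ volume) ⁻¹' Iic a
      = {t | (volume : Measure (E N)) ((fun x => (x, t)) ⁻¹' {p | a < ‖g p‖ₑ}) = 0} := by
    ext t
    have h2 : (volume : Measure (E N)) ((fun x => (x, t)) ⁻¹' {p | a < ‖g p‖ₑ}) = 0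
        ↔ ∀ᵐ x : E N, ‖g (x, t)‖ₑ ≤ a := by
      rw [ae_iff]; simp only [not_le]; rfl
    rw [mem_ofPred_eq, h2, mem_preimage, mem_Iic, eLpNorm_exponent_top]
    exact ⟨fun h => ae_le_eLpNormEssSup.mono fun x hx => hx.trans h,
      fun h => essSup_le_of_ae_le a h⟩
  rw [e]
  exact measurable_measure_prodMk_right hS (measurableSet_singleton 0)

/-- A source term has a representative that is measurable and bounded, at every time, by an
integrable function of time. -/
theorem IsSource.exists_isRegularSource {T : ℝ} {g : E N × ℝ → ℝ} (hg : IsSource T g) :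
    ∃ (b : ℝ → ℝ) (g' : E N × ℝ → ℝ), IsRegularSource b g' ∧
      g' =ᵐ[volume.restrict (QT N T)] g := by
  set w := hg.aestronglyMeasurable.mk g
  have hwm : Measurable w := hg.aestronglyMeasurable.stronglyMeasurable_mk.measurable
  have hwg : g =ᵐ[volume.restrict (QT N T)] w := hg.aestronglyMeasurable.ae_eq_mk
  have hsl : ∀ᵐ t ∂(volume.restrict (Ioo 0 T)), (fun x => g (x, t)) =ᵐ[volume] fun x => w (x, t) := by
    have h1 := hwg
    rw [restrict_QT] at h1
    exact Measure.ae_ae_of_ae_prod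
      (Measure.measurePreserving_swap.quasiMeasurePreserving.ae h1)
  have hbm := measurable_eLpNorm_top_slice hwm
  set β : ℝ → ℝ≥0∞ := fun t => eLpNorm (fun x => w (x, t)) ∞ volume with hβ
  have hfin : ∫⁻ t in Ioo 0 T, (eLpNorm (fun x => w (x, t)) 1 volume + β t) < ∞ := by
    refine lt_of_eq_of_lt (lintegral_congr_ae ?_) hg.lintegral_lt_top
    filter_upwards [hsl] with t ht
    rw [hβ, eLpNorm_congr_ae ht, eLpNorm_congr_ae ht]
  have hfinβ : ∫⁻ t in Ioo 0 T, β t ≠ ∞ :=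
    ((lintegral_mono fun t => le_add_self).trans_lt hfin).ne
  have hβtop : ∀ᵐ t ∂(volume.restrict (Ioo 0 T)), β t < ∞ := ae_lt_top hbm hfinβ
  have hwi : IntegrableOn w (QT N T) := by
    refine ⟨hwm.aestronglyMeasurable, ?_⟩
    rw [HasFiniteIntegral, restrict_QT, lintegral_prod_symm _ hwm.enorm.aemeasurable]
    refine lt_of_le_of_lt (lintegral_mono fun t => ?_) hfin
    rw [eLpNorm_one_eq_lintegral_enorm]
    exact le_self_add
  -- Setting the source to zero off `S` enforces the bound at every point; within `Q_T` only a null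
  -- set is affected.
  set S : Set (E N × ℝ) := {p | p.2 ∈ Ioo 0 T ∧ |w p| ≤ (β p.2).toReal}
  have hS : MeasurableSet S := (measurable_snd measurableSet_Ioo).inter
    (measurableSet_le hwm.abs (hbm.comp measurable_snd).ennreal_toReal)
  have hSQ : S ⊆ QT N T := fun p hp => ⟨mem_univ _, hp.1⟩
  have hbi : Integrable ((Ioo 0 T).indicator fun t => (β t).toReal) := by
    rw [integrable_indicator_iff measurableSet_Ioo]
    exact integrable_toReal_of_lintegral_ne_top hbm.aemeasurable hfinβ
  refine ⟨_, S.indicator w, ⟨hwm.indicator hS, ?_, hbi, fun x t => ?_⟩, ?_⟩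
  · rw [integrable_indicator_iff hS]
    exact hwi.mono_set hSQ
  · by_cases hx : (x, t) ∈ S
    · rw [indicator_of_mem hx, indicator_of_mem hx.1]; exact hx.2
    · rw [indicator_of_notMem hx, abs_zero]
      exact indicator_nonneg (fun _ _ => ENNReal.toReal_nonneg) t
  · have hSae : ∀ᵐ p ∂(volume.restrict (QT N T)), p ∈ S := by
      rw [restrict_QT, Measure.ae_prod_iff_ae_ae (p := fun p => p ∈ S) hS, Measure.ae_ae_comm hS]
      filter_upwards [hβtop, ae_restrict_mem measurableSet_Ioo] with t ht htI
      have h2 : ∀ᵐ x : E N, ‖w (x, t)‖ₑ ≤ β t := by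
        rw [hβ]; simp only [eLpNorm_exponent_top]; exact ae_le_eLpNormEssSup
      filter_upwards [h2] with x hx
      refine ⟨htI, ?_⟩
      rw [← Real.norm_eq_abs, ← toReal_enorm]
      exact ENNReal.toReal_mono ht.ne hx
    filter_upwards [hSae, hwg] with p hp hp2
    rw [indicator_of_mem hp, hp2]

end Representatives

section Interpolation

/-- Interpolation between `L¹` and `L^∞`: pointwise `|d|^r ≤ A^{r-1}|d|`. -/
theorem eLpNorm_le_of_abs_le {d : E N → ℝ} (hd : Integrable d) {A : ℝ} (hA : ∀ x, |d x| ≤ A)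
    {r : ℝ≥0∞} (hr : 1 ≤ r) (hr' : r ≠ ∞) : eLpNorm d r volume
      ≤ (ENNReal.ofReal A ^ (r.toReal - 1) * ENNReal.ofReal (∫ x, |d x|)) ^ (1 / r.toReal) := by
  have hρ : 1 ≤ r.toReal := by
    rw [← ENNReal.toReal_one]; exact ENNReal.toReal_mono hr' hr
  rw [eLpNorm_eq_lintegral_rpow_enorm_toReal (one_pos.trans_le hr).ne' hr']
  refine ENNReal.rpow_le_rpow ?_ (by positivity)
  have e : ENNReal.ofReal (∫ x, |d x|) = ∫⁻ x, ‖d x‖ₑ :=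
    ofReal_integral_norm_eq_lintegral_enorm hd
  rw [e, ← lintegral_const_mul' _ _ (ENNReal.rpow_ne_top_of_nonneg (by linarith) ENNReal.ofReal_ne_top)]
  refine lintegral_mono fun x => ?_
  have h1 : ‖d x‖ₑ ≤ ENNReal.ofReal A := by
    rw [← ofReal_norm]; exact ENNReal.ofReal_le_ofReal (hA x)
  calc ‖d x‖ₑ ^ r.toReal = ‖d x‖ₑ ^ ((r.toReal - 1) + 1) := by rw [sub_add_cancel]
    _ = ‖d x‖ₑ ^ (r.toReal - 1) * ‖d x‖ₑ := by
        rw [ENNReal.rpow_add_of_nonneg _ _ (by linarith) zero_le_one, ENNReal.rpow_one]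
    _ ≤ ENNReal.ofReal A ^ (r.toReal - 1) * ‖d x‖ₑ := by
        gcongr

/-- Continuity in `L¹` and boundedness imply continuity in `L^r`. -/
theorem memCLr_of_bounded {T M : ℝ} {u : E N × ℝ → ℝ} (hM : ∀ p, |u p| ≤ M)
    (hi : ∀ t ∈ Icc 0 T, Integrable fun x => u (x, t))
    (hc : ∀ t ∈ Icc 0 T, Tendsto (fun s => ∫ x, |u (x, s) - u (x, t)|) (𝓝[Icc 0 T] t) (𝓝 0))
    {r : ℝ≥0∞} (hr : 1 ≤ r) (hr' : r ≠ ∞) : MemCLr T r u := by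
  have hρ : 1 ≤ r.toReal := by
    rw [← ENNReal.toReal_one]; exact ENNReal.toReal_mono hr' hr
  have hA : ∀ A : ℝ, ENNReal.ofReal A ^ (r.toReal - 1) ≠ ∞ := fun A =>
    ENNReal.rpow_ne_top_of_nonneg (by linarith) ENNReal.ofReal_ne_top
  refine ⟨u, EventuallyEq.rfl, fun t ht => ⟨(hi t ht).aestronglyMeasurable, ?_⟩, fun t ht => ?_⟩
  · refine (eLpNorm_le_of_abs_le (hi t ht) (fun x => hM _) hr hr').trans_lt ?_
    exact ENNReal.rpow_lt_top_of_nonneg (by positivity)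
      (ENNReal.mul_ne_top (hA M) ENNReal.ofReal_ne_top)
  · have hlim : Tendsto (fun s => (ENNReal.ofReal (M + M) ^ (r.toReal - 1)
        * ENNReal.ofReal (∫ x, |u (x, s) - u (x, t)|)) ^ (1 / r.toReal)) (𝓝[Icc 0 T] t) (𝓝 0) := by
      have h1 := ENNReal.tendsto_ofReal (hc t ht)
      have h2 := (ENNReal.continuous_rpow_const (y := 1 / r.toReal)).tendsto _ |>.comp
        (ENNReal.Tendsto.const_mul h1 (Or.inr (hA (M + M))))
      rwa [ENNReal.ofReal_zero, mul_zero, ENNReal.zero_rpow_of_pos (by positivity)] at h2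
    refine tendsto_of_tendsto_of_tendsto_of_le_of_le' tendsto_const_nhds hlim
      (Eventually.of_forall fun _ => zero_le) ?_
    filter_upwards [self_mem_nhdsWithin] with s hs
    exact eLpNorm_le_of_abs_le ((hi s hs).sub (hi t ht))
      (fun x => (abs_sub _ _).trans (add_le_add (hM _) (hM _))) hr hr'

end Interpolation

section Family

theorem IsSchemeFamily.comp {κ β C T : ℝ} {ν : ℕ → Measure (E N)} {φ : ℕ → ℝ → ℝ} {τ : ℕ → ℝ}
    (h : IsSchemeFamily κ β C T ν φ τ) {θ : ℕ → ℕ} (hθ : StrictMono θ) :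
    IsSchemeFamily κ β C T (fun k => ν (θ k)) (fun k => φ (θ k)) (fun k => τ (θ k)) where
  dim_pos := h.dim_pos
  exponent_pos := h.exponent_pos
  exponent_le_one := h.exponent_le_one
  exponent_lt := h.exponent_lt
  const_nonneg := h.const_nonneg
  time_pos := h.time_pos
  finite _ := h.finite _
  symm _ := h.symm _
  stable _ := h.stable _
  step_pos _ := h.step_pos _
  step_tendsto := h.step_tendsto.comp hθ.tendsto_atTop
  holder _ := h.holder _
  bounded _ := h.bounded _
  moment _ := h.moment _

/-- The grid sizes of the approximating schemes. -/
def gridSize (k : ℕ) : ℝ := 1 / (k + 2)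

theorem gridSize_mem (k : ℕ) : gridSize k ∈ Ioo (0 : ℝ) 1 := by
  have : (0 : ℝ) ≤ k := k.cast_nonneg
  refine ⟨by unfold gridSize; positivity, ?_⟩
  rw [gridSize, div_lt_one (by positivity)]
  linarith

theorem tendsto_gridSize : Tendsto gridSize atTop (𝓝[>] 0) := by
  refine tendsto_nhdsWithin_iff.2 ⟨?_, Eventually.of_forall fun k => (gridSize_mem k).1⟩
  have := (tendsto_add_atTop_iff_nat (f := fun n : ℕ => 1 / ((n : ℝ) + 1)) 1).2
    tendsto_one_div_add_atTop_nhds_zero_nat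
  refine this.congr fun k => ?_
  rw [gridSize]
  push_cast
  ring

/-- Grid size and smoothing parameter tend to 0 with no prescribed relation; the time step is chosen
last, small enough for the resulting mass and Lipschitz constant. The constant `2 * C + C₁` covers
the sup, Hölder and moment bounds at once. -/
theorem exists_isSchemeFamily (hN : 0 < N) {T : ℝ} (hT : 0 < T) {κ : ℝ≥0} (hκ : 0 < κ)
    (hκ1 : κ ≤ 1) {z : ℝ → (Fin N → ℤ) → E N} {ω : ℝ → (Fin N → ℤ) → ℝ}
    (hzω : IsDiscretization z ω) (ha : Admissible κ z ω) {f : ℝ → ℝ} {C : ℝ}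
    (hf : Continuous f) (hm : Monotone f) (hf1 : ∀ s, |f s| ≤ C)
    (hf2 : ∀ r s, |f r - f s| ≤ C * |r - s| ^ (κ : ℝ)) :
    ∃ (β C' : ℝ) (τ : ℕ → ℝ), C ≤ C' ∧ (∀ k, ∃ n : ℕ, n * τ k = T) ∧
      IsSchemeFamily κ β C' T (fun k => jumpMeasure (z (gridSize k)) (ω (gridSize k)))
        (fun k => steklov f (1 / (k + 1))) τ := by
  obtain ⟨β, C₁, hβ, hC₁, hmom⟩ := ha.exists_truncMoment_le hN hzω
  have hC : 0 ≤ C := (abs_nonneg _).trans (hf1 0)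
  have hδ : ∀ k : ℕ, (0 : ℝ) < 1 / (k + 1) := fun k => by positivity
  have hex : ∀ k : ℕ, ∃ τ, 0 < τ ∧ τ ≤ 1 / ((k : ℝ) + 1) ∧ (∃ n : ℕ, n * τ = T) ∧
      IsStable (jumpMeasure (z (gridSize k)) (ω (gridSize k))) (steklov f (1 / (k + 1))) τ :=
    fun k => by
      obtain ⟨ℓ, hℓ⟩ := steklov_lipschitz hf (hδ k) hf1
      exact exists_stable_step (steklov_monotone hf hm (hδ k)) hℓ steklov_zero hT (hδ k)
  choose τ hτ0 hτ1 hτT hτs using hex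
  refine ⟨β, 2 * C + C₁, τ, by linarith, hτT, ?_⟩
  have hh : ∀ k, 0 < gridSize k := fun k => (gridSize_mem k).1
  exact
    { dim_pos := hN
      exponent_pos := by exact_mod_cast hκ
      exponent_le_one := by exact_mod_cast hκ1
      exponent_lt := hβ
      const_nonneg := by positivity
      time_pos := hT
      finite := fun k => isFiniteMeasure_jumpMeasure (hzω.weight_nonneg _ (hh k))
        (hzω.weight_summable _ (hh k))
      symm := fun k => isNegInvariant_jumpMeasure (hzω.node_neg _ (hh k)) (hzω.weight_neg _ (hh k))
      stable := hτs
      step_pos := hτ0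
      step_tendsto := squeeze_zero (fun k => (hτ0 k).le) hτ1
        tendsto_one_div_add_atTop_nhds_zero_nat
      holder := fun k s => by
        refine (abs_steklov_le (hδ k) (A := C * |s| ^ (κ : ℝ)) s fun r => ?_).trans ?_
        · have := hf2 (s + r) r
          rwa [add_sub_cancel_right] at this
        · exact mul_le_mul_of_nonneg_right (by linarith) (by positivity)
      bounded := fun k s => (abs_steklov_le (hδ k) (A := 2 * C) s fun r =>
        (abs_sub _ _).trans (by linarith [hf1 (s + r), hf1 r])).trans (by linarith)
      moment := fun k R hR => (hmom _ (gridSize_mem k) R hR).trans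
        (mul_le_mul_of_nonneg_right (by linarith) (by positivity)) }

end Family

end GPME

end

/-! ### Return to the original data and conclusion. -/

noncomputable section

namespace GPME

variable {N : ℕ}

theorem IsTestFunction.eq_zero {T : ℝ} {ψ : E N × ℝ → ℝ} (hψ : IsTestFunction T ψ) (x : E N) :
    ψ (x, T) = 0 :=
  image_eq_zero_of_notMem_tsupport fun h => lt_irrefl T (hψ.tsupport_subset h).2

/-- Passage from a truncated, shifted nonlinearity and regular representatives of the data to the
original weak formulation. -/
theorem weak_eq_of_truncation {T c : ℝ} {μ : Measure (E N)} {φ f : ℝ → ℝ} {g g' : E N × ℝ → ℝ}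
    {u₀ v₀ : E N → ℝ} {u ψ : E N × ℝ → ℝ} {b : ℝ → ℝ}
    (hu : IntegrableOn u (QT N T)) (hg' : IsRegularSource b g')
    (hgg : g' =ᵐ[volume.restrict (QT N T)] g) (hv : v₀ =ᵐ[volume] u₀)
    (hf : ∀ p, f (u p) = φ (u p) - φ 0) (hψ : IsTestFunction T ψ)
    {L : E N × ℝ → ℝ} (hL : L = fun p => diffusionOp c μ (fun y => ψ (y, p.2)) p.1)
    (hfL : IntegrableOn (fun p => f (u p) * L p) (QT N T)) (hLi : IntegrableOn L (QT N T))
    (hL0 : ∀ t, ∫ x, L (x, t) = 0)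
    (hw : (∫ p in QT N T, (u p * timeDeriv ψ p + f (u p) * L p + g' p * ψ p))
      + ∫ x, v₀ x * ψ (x, 0) = 0) :
    Integrable (fun p : E N × ℝ => φ (u p) * diffusionOp c μ (fun y => ψ (y, p.2)) p.1)
      (volume.restrict (QT N T)) ∧
    (∫ p in QT N T,
        (u p * deriv (fun t => ψ (p.1, t)) p.2
          + φ (u p) * diffusionOp c μ (fun y => ψ (y, p.2)) p.1
          + g p * ψ p))
      + ∫ x, u₀ x * ψ (x, 0) = 0 := by
  have hφ : ∀ p, φ (u p) = f (u p) + φ 0 := fun p => by rw [hf]; ring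
  have hLp : ∀ p : E N × ℝ, diffusionOp c μ (fun y => ψ (y, p.2)) p.1 = L p := fun p => by rw [hL]
  have hD : ∀ p : E N × ℝ, deriv (fun t => ψ (p.1, t)) p.2 = timeDeriv ψ p := fun p =>
    (hasDerivAt_time hψ.contDiff p.1 p.2).deriv
  simp only [hφ, hLp, hD]
  refine ⟨(hfL.add (hLi.const_mul (φ 0))).congr (Eventually.of_forall fun p => ?_), ?_⟩
  · simp only [Pi.add_apply]; ring
  obtain ⟨D, hDb⟩ := (hasCompactSupport_timeDeriv hψ.hasCompactSupport).exists_bound_of_continuous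
    (contDiff_timeDeriv hψ.contDiff).continuous
  obtain ⟨X, hX⟩ := hψ.hasCompactSupport.exists_bound_of_continuous hψ.contDiff.continuous
  have i1 : IntegrableOn (fun p => u p * timeDeriv ψ p) (QT N T) :=
    hu.mul_bdd (contDiff_timeDeriv hψ.contDiff).continuous.aestronglyMeasurable
      (Eventually.of_forall hDb)
  have i3 : IntegrableOn (fun p => g' p * ψ p) (QT N T) :=
    hg'.integrable.integrableOn.mul_bdd hψ.contDiff.continuous.aestronglyMeasurable
      (Eventually.of_forall hX)
  have i4 : Integrable (fun p => u p * timeDeriv ψ p + f (u p) * L p + g' p * ψ p)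
      (volume.restrict (QT N T)) := (i1.add hfL).add i3
  -- This removes the shift: replacing `f` by `f + φ 0` changes the weak formulation by `φ 0 * ∫ L`.
  have hLQ : ∫ p in QT N T, L p = 0 := by
    rw [IntegrableOn, restrict_QT] at hLi
    rw [restrict_QT, integral_prod_symm _ hLi]
    simp [hL0]
  have e1 : ∫ p in QT N T, (u p * timeDeriv ψ p + (f (u p) + φ 0) * L p + g p * ψ p)
      = (∫ p in QT N T, (u p * timeDeriv ψ p + f (u p) * L p + g' p * ψ p))
        + φ 0 * ∫ p in QT N T, L p := by
    rw [← integral_const_mul, ← integral_add i4 (hLi.const_mul (φ 0))]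
    refine integral_congr_ae ?_
    filter_upwards [hgg] with p hp
    rw [hp]; ring
  have e2 : ∫ x, u₀ x * ψ (x, 0) = ∫ x, v₀ x * ψ (x, 0) :=
    integral_congr_ae (hv.mono fun x hx => by simp only [hx])
  rw [e1, e2, hLQ, mul_zero, add_zero, hw]

end GPME

end

theorem corollary3p7 {N : ℕ} (hN : 0 < N) {T : ℝ} (hT : 0 < T)
    {κ : ℝ≥0} {φ : ℝ → ℝ} (hφ : GPME.IsNonlinearity κ φ)
    {g : GPME.E N × ℝ → ℝ} (hg : GPME.IsSource T g)
    {u₀ : GPME.E N → ℝ} (hu₀_one : MemLp u₀ 1 volume) (hu₀_top : MemLp u₀ ∞ volume)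
    {c : ℝ} (hc : c = 0 ∨ c = 1)
    {μ : Measure (GPME.E N)} (hμ : GPME.IsSymmetricLevy μ)
    {r : ℝ≥0∞} (hr_one : 1 ≤ r) (hr_top : r ≠ ∞)
    {z : ℝ → (Fin N → ℤ) → GPME.E N} {ω : ℝ → (Fin N → ℤ) → ℝ}
    (hzω : GPME.IsDiscretization z ω)
    (hadm : GPME.Admissible κ z ω)
    (hcons : GPME.Consistent c μ z ω) :
    ∃ u : GPME.E N × ℝ → ℝ,
      GPME.IsVeryWeakSolution T c μ φ g u₀ u ∧
      MemLp u 1 (volume.restrict (GPME.QT N T)) ∧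
      MemLp u ∞ (volume.restrict (GPME.QT N T)) ∧
      GPME.MemCLr T r u := by
  obtain ⟨v₀, M, hM0, hv₀, hvM, hvu⟩ := GPME.exists_bddIntegrable_ae_eq hu₀_one hu₀_top
  obtain ⟨b, g', hg', hgg⟩ := hg.exists_isRegularSource
  have hb : 0 ≤ ∫ t, b t := integral_nonneg fun t => (abs_nonneg _).trans (hg'.abs_le 0 t)
  -- The truncation level `M + ∫ b` is the sup bound that the limit will satisfy, so `f (u p) = φ (u
  -- p) - φ 0` at every point.
  obtain ⟨f, C, hC, hfc, hfm, hf0, hf1, hf2, hfφ⟩ := hφ.exists_truncation (add_nonneg hM0 hb)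
  obtain ⟨β, C', τ, hCC, hτT, hfam⟩ := GPME.exists_isSchemeFamily hN hT hφ.exponent_pos
    hφ.exponent_le_one hzω hadm hfc hfm hf1 hf2
  obtain ⟨u, hum, huM, hui, huc, θ, hθ, hconv⟩ := hfam.exists_limit hv₀ hg' hvM
  have hκ : (0 : ℝ) < κ := by exact_mod_cast hφ.exponent_pos
  have huQ : IntegrableOn u (GPME.QT N T) := by
    refine (GPME.integrable_QT_of_slice hum hT.le (fun t ht => hui t (Ioo_subset_Icc_self ht))
      (A := (∫ x, |v₀ x|) + (∫ p, |g' p|) + 1) fun t ht => ?_).1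
    have ht' := Ioo_subset_Icc_self ht
    -- The first term of the subsequence lies within `(1/2)^0 = 1` of `u` in `L¹` at every time,
    -- which gives a bound uniform in `t`.
    have h1 := hconv 0 t ht'
    have h2 := hfam.integral_abs_approx_le hv₀ hg' (θ 0) ⌊t / τ (θ 0)⌋₊
    have h3 := (hfam.bddIntegrable hv₀ hg' (θ 0) ⌊t / τ (θ 0)⌋₊).integrable
    rw [pow_zero] at h1
    have h4 := integral_mono (hui t ht').abs (h3.abs.add (h3.sub (hui t ht')).abs) fun x => by
      simp only [Pi.add_apply, Pi.sub_apply]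
      refine (le_of_eq ?_).trans (abs_sub _ _)
      rw [sub_sub_cancel]
    rw [integral_add' h3.abs (h3.sub (hui t ht')).abs] at h4
    simp only [Pi.sub_apply] at h4
    linarith
  have key : ∀ ψ : GPME.E N × ℝ → ℝ, GPME.IsTestFunction T ψ →
      Integrable (fun p : GPME.E N × ℝ => φ (u p) *
        GPME.diffusionOp c μ (fun y => ψ (y, p.2)) p.1) (volume.restrict (GPME.QT N T)) ∧
      (∫ p in GPME.QT N T, (u p * deriv (fun t => ψ (p.1, t)) p.2
          + φ (u p) * GPME.diffusionOp c μ (fun y => ψ (y, p.2)) p.1 + g p * ψ p))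
        + ∫ x, u₀ x * ψ (x, 0) = 0 := by
    intro ψ hψ
    have he : Tendsto (fun k : ℕ => 2 * C * (1 / ((θ k : ℝ) + 1)) ^ (κ : ℝ)) atTop (𝓝 0) := by
      have h1 := (tendsto_one_div_add_atTop_nhds_zero_nat (𝕜 := ℝ)).comp hθ.tendsto_atTop
      have h2 := (h1.rpow_const (p := (κ : ℝ)) (Or.inr hκ.le)).const_mul (2 * C)
      rwa [Real.zero_rpow hκ.ne', mul_zero] at h2
    obtain ⟨h1, h2, h3, h4⟩ := (hfam.comp hθ).weak_limit hv₀ hg' (fun k => hτT (θ k)) hfc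
      (fun s => (hf1 s).trans hCC)
      (fun r s => (hf2 r s).trans (mul_le_mul_of_nonneg_right hCC (by positivity))) he
      (fun k s => GPME.abs_steklov_sub_le hfc (by positivity) hC hκ.le hf0 hf2 s)
      hum hui hconv hψ.contDiff hψ.hasCompactSupport hψ.eq_zero
      (GPME.continuous_diffusionOp c hμ hψ.contDiff hψ.hasCompactSupport) (fun t => by
        have hs := GPME.bddIntegrable_slice hψ.contDiff hψ.hasCompactSupport t
        obtain ⟨X, hX⟩ := hs.bounded
        refine ((hcons _ (GPME.contDiff_slice hψ.contDiff t)
          (GPME.hasCompactSupport_slice hψ.hasCompactSupport t)).comp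
          (GPME.tendsto_gridSize.comp hθ.tendsto_atTop)).congr fun k => ?_
        have hh := (GPME.gridSize_mem (θ k)).1
        rw [GPME.jumpOp_jumpMeasure (hzω.weight_nonneg _ hh) (hzω.weight_summable _ hh)
          hs.measurable hX]
        rfl)
    exact GPME.weak_eq_of_truncation huQ hg' hgg hvu (fun p => hfφ _ (huM p)) hψ rfl h1 h2 h3 h4
  refine ⟨u, ⟨huQ.locallyIntegrableOn, fun ψ hψ => (key ψ hψ).1, fun ψ hψ => (key ψ hψ).2⟩,
    memLp_one_iff_integrable.2 huQ, ?_, GPME.memCLr_of_bounded huM hui huc hr_one hr_top⟩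
  exact memLp_top_of_bound hum.aestronglyMeasurable _ (Eventually.of_forall huM)
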